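/- **Objects.** A *tangled-diagram* over $[n]=\{1,\dots,n\}$ is a labelled multigraph of degree at most $2$ (loops, which count twice for the degree, and double arcs are allowed), with arcs $(i,j)$, $i\le j$, drawn in the upper halfplane; two different non-loop arcs with a common endpoint are drawn either crossing or not crossing (one choice for a pair of parallel arcs). Arcs $(i_1,j_1),(i_2,j_2)$ with $i_1<i_2<j_1<j_2$ also cross. A tangled-diagram is *$k$-noncrossing* if it has no $k$-set of mutually crossing arcs. A tangled-diagram is a *matching* if every vertex has degree $1$; a *partition* if every vertex $j$ of degree $2$ is incident to non-crossing arcs $(i,j),(j,s)$ with $i<j<s$; a *braid* if every vertex $j$ of degree $2$ is incident to a loop $(j,j)$ or to crossing arcs $(i,j),(j,h)$ with $i<j<h$. Let $\mathcal G_n$ be the set of tangled-diagrams over $[n]$, and $\mathcal M_k(n),\mathcal P_k(n),\mathcal B_k(n)\subseteq\mathcal G_n$ the sets of $k$-noncrossing matchings, partitions and braids over $[n]$. The *inflation* $\iota(G)$ of $G\in\mathcal G_n$ is the graph with vertices $j$ ($1\le j\le n$) and additionally $j'$ for each $j$ of degree $2$, in the order $1<1'<2<2'<\dots<n<n'$,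 in which the two arc ends at each vertex $j$ of degree $2$ are distributed to $j$ and $j'$ as follows. Arcs $(i,j_1),(i,j_2)$ with $i<j_1<j_2$ start in $i,i'$ respectively if they cross, and in $i',i$ otherwise; arcs $(i_1,j),(i_2,j)$ with $i_1<i_2<j$ end in $j,j'$ respectively if they cross, and in $j',j$ otherwise; for arcs $(i,j),(j,h)$ with $i<j<h$, the first ends in $j'$ and the second starts in $j$ if they cross, and the first ends in $j$ and the second starts in $j'$ otherwise; a double arc $(i,j)$, $i<j$, becomes $(i,j),(i',j')$ if crossing and $(i,j'),(i',j)$ otherwise; a loop $(i,i)$ becomes $(i,i')$. A *vacillating tableau* of shape $\varnothing$ and length $2n$ is a sequence $(\lambda^0,\dots,\lambda^{2n})$ of Young diagrams with $\lambda^0=\lambda^{2n}=\varnothing$ such that for $1\le j\le n$ the pair $(\lambda^{2j-1},\lambda^{2j})$ is derived from $\lambda^{2j-2}$ by one of the elementary steps $(\varnothing,\varnothing)$, $(-\square,\varnothing)$, $(\varnothing,+\square)$, $(\pm\square,\pm\square)$ (do nothing, add a square, or remove a square, in each half of the step). Let $\mathcal V^{2n}_\varnothing$ be the set of these, and write $V\models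 S$ if all steps of $V$ belong to $S$; $V$ has fewer than $k$ rows if each $\lambda^h$ has. For $V\in\mathcal V^{2n}_\varnothing$ the graph $\varphi(V)$ is built from left to right with standard Young tableaux $T_h$ of shape $\lambda^h$ ($0\le h\le 2n$), starting with no arcs and the empty tableau. In the two halves of step $j$ the current vertex is $j$ and then $j'$, except that it is $j$ in the second half as well if the first half does nothing. If a square is added, the current vertex is entered in it. If a square is removed, the new tableau is the unique one of the new shape from which the old one is obtained by RSK-inserting an element $i$, and the arc from $i$ to the current vertex is added. The vertices of $\varphi(V)$ are all $j$, and $j'$ for each step $j$ neither half of which does nothing. **Claim.** The map $\iota$ is injective on $\mathcal G_n$, $\varphi$ is well defined, and there is a bijection $\beta\colon\mathcal V^{2n}_\varnothing\to\mathcal G_n$ with $\iota(\beta(V))=\varphi(V)$ for all $V$. For every $k\ge 0$ the bijection $\beta$ restricts to bijections $$\beta_1\colon\{V\models(-\square,\varnothing),(\varnothing,+\square)\text{ with fewer than }k\text{ rows}\}\to\mathcal M_k(n),$$ $$\beta_2\colon\{V\models(-\square,\varnothing),(\varnothing,+\square),(\varnothing,\varnothing),(-\square,+\square)\text{ with fewer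 than }k\text{ rows}\}\to\mathcal P_k(n),$$ $$\beta_3\colon\{V\models(-\square,\varnothing),(\varnothing,+\square),(\varnothing,\varnothing),(+\square,-\square)\text{ with fewer than }k\text{ rows}\}\to\mathcal B_k(n).$$ -/

import Mathlib

open Set

/-! ### Tangled-diagrams -/

/-- The degree of the vertex `v` in the multigraph with the given arcs; a loop `(v, v)` counts
twice. -/
def arcDegree {n : ℕ} (arcs : Multiset (Fin n × Fin n)) (v : Fin n) : ℕ :=
  arcs.countP (fun a => a.1 = v) + arcs.countP (fun a => a.2 = v)

/-- A tangled-diagram over `[n]`: a labelled multigraph of degree at most `2`, whose arcs `(i, j)`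
with `i ≤ j` are drawn in the upper halfplane. Two different arcs with a common endpoint can be
drawn in two ways, crossing or not; `crossAt` is the set of the vertices at which the two incident
arcs cross. Two parallel arcs `(i, j)`, `(i, j)` are one pair of arcs, hence carry one choice. -/
@[ext]
structure TangledDiagram (n : ℕ) where
  arcs : Multiset (Fin n × Fin n)
  arcs_le : ∀ a ∈ arcs, a.1 ≤ a.2
  degree_le : ∀ v, arcDegree arcs v ≤ 2
  crossAt : Finset (Fin n)
  crossAt_degree : ∀ v ∈ crossAt, arcDegree arcs v = 2
  crossAt_loop : ∀ v ∈ crossAt, (v, v) ∉ arcs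
  crossAt_parallel : ∀ i j, i < j → arcs.count (i, j) = 2 → (i ∈ crossAt ↔ j ∈ crossAt)

namespace TangledDiagram

variable {n : ℕ} (D : TangledDiagram n)

/-- The degree of a vertex. -/
def degree (v : Fin n) : ℕ := arcDegree D.arcs v

/-- The crossing relation between two different arcs `a`, `b` of the diagram (`a = b` as pairs is
meaningful if `a` and `b` are two parallel arcs). -/
def Crossing (a b : Fin n × Fin n) : Prop :=
  (a.1 < b.1 ∧ b.1 < a.2 ∧ a.2 < b.2) ∨ (b.1 < a.1 ∧ a.1 < b.2 ∧ b.2 < a.2) ∨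
    ∃ v ∈ D.crossAt, (a.1 = v ∨ a.2 = v) ∧ (b.1 = v ∨ b.2 = v)

/-- `k`-noncrossing: there is no `k`-set of mutually crossing arcs (parallel arcs count as
different arcs). -/
def Noncrossing (k : ℕ) : Prop :=
  ¬ ∃ l : List (Fin n × Fin n), (l : Multiset (Fin n × Fin n)) ≤ D.arcs ∧ l.length = k ∧
    l.Pairwise D.Crossing

/-- A matching is a `1`-regular tangled-diagram. -/
def IsMatching : Prop := ∀ v, D.degree v = 1

/-- A partition: every vertex `j` of degree two is incident to arcs `(i, j)` and `(j, s)` with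
`i < j < s`, which do not cross. -/
def IsPartition : Prop :=
  ∀ j, D.degree j = 2 → j ∉ D.crossAt ∧ ∃ i s, i < j ∧ j < s ∧ (i, j) ∈ D.arcs ∧ (j, s) ∈ D.arcs

/-- A braid: every vertex `j` of degree two is incident to a loop or to crossing arcs `(i, j)` and
`(j, h)` with `i < j < h`. -/
def IsBraid : Prop :=
  ∀ j, D.degree j = 2 → (j, j) ∈ D.arcs ∨
    (j ∈ D.crossAt ∧ ∃ i h, i < j ∧ j < h ∧ (i, j) ∈ D.arcs ∧ (j, h) ∈ D.arcs)

end TangledDiagram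

/-! ### Inflation -/

/-- The linearly ordered set `1 < 1' < 2 < 2' < ⋯ < n < n'`. -/
abbrev HalfVertex (n : ℕ) : Type := Fin n ×ₗ Bool

/-- The vertex `j`. -/
def HalfVertex.plain {n : ℕ} (j : Fin n) : HalfVertex n := toLex (j, false)

/-- The vertex `j'`. -/
def HalfVertex.prime {n : ℕ} (j : Fin n) : HalfVertex n := toLex (j, true)

open HalfVertex

/-- A graph on some of the vertices `1, 1', …, n, n'`: a set of vertices and a set of arcs. -/
@[ext]
structure HalfGraph (n : ℕ) where
  verts : Set (HalfVertex n)
  arcs : Set (HalfVertex n × HalfVertex n)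

namespace TangledDiagram

variable {n : ℕ} (D : TangledDiagram n)

/-- The arc `(i, j)`, `i < j`, without a parallel arc, gets the lefthand endpoint `i'` in the
inflation (otherwise `i`). Here `(h, i)`, `(i, r)` stand for the second arc at `i`. -/
def LeftPrimed (i j : Fin n) : Prop :=
  (∃ h, h < i ∧ (h, i) ∈ D.arcs ∧ i ∉ D.crossAt) ∨
  (∃ r, i < r ∧ (i, r) ∈ D.arcs ∧ ((i ∈ D.crossAt ∧ r < j) ∨ (i ∉ D.crossAt ∧ j < r)))

/-- The arc `(i, j)`, `i < j`, without a parallel arc, gets the righthand endpoint `j'` in the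
inflation (otherwise `j`). Here `(j, h)`, `(r, j)` stand for the second arc at `j`. -/
def RightPrimed (i j : Fin n) : Prop :=
  (∃ h, j < h ∧ (j, h) ∈ D.arcs ∧ j ∈ D.crossAt) ∨
  (∃ r, r < j ∧ (r, j) ∈ D.arcs ∧ ((j ∈ D.crossAt ∧ r < i) ∨ (j ∉ D.crossAt ∧ i < r)))

/-- The arcs of the inflation. -/
inductive InflationArc : HalfVertex n → HalfVertex n → Prop
  | loop (i : Fin n) : (i, i) ∈ D.arcs → InflationArc (plain i) (prime i)
  | cross_fst (i j : Fin n) : i < j → D.arcs.count (i, j) = 2 → i ∈ D.crossAt →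
      InflationArc (plain i) (plain j)
  | cross_snd (i j : Fin n) : i < j → D.arcs.count (i, j) = 2 → i ∈ D.crossAt →
      InflationArc (prime i) (prime j)
  | nest_fst (i j : Fin n) : i < j → D.arcs.count (i, j) = 2 → i ∉ D.crossAt →
      InflationArc (plain i) (prime j)
  | nest_snd (i j : Fin n) : i < j → D.arcs.count (i, j) = 2 → i ∉ D.crossAt →
      InflationArc (prime i) (plain j)
  | single (i j : Fin n) (x y : HalfVertex n) : i < j → D.arcs.count (i, j) = 1 →
      ((D.LeftPrimed i j ∧ x = prime i) ∨ (¬ D.LeftPrimed i j ∧ x = plain i)) →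
      ((D.RightPrimed i j ∧ y = prime j) ∨ (¬ D.RightPrimed i j ∧ y = plain j)) →
      InflationArc x y

/-- The inflation: every vertex `j` of degree two is resolved into `j` and `j'`. -/
def inflation : HalfGraph n where
  verts := {v | ∃ j, v = plain j ∨ (v = prime j ∧ D.degree j = 2)}
  arcs := {a | D.InflationArc a.1 a.2}

end TangledDiagram

/-! ### Tableaux and RSK-insertion -/

/-- A standard Young tableau with distinct entries in `α`, given by its rows: the (nonempty) rows
have weakly decreasing lengths, rows and columns are strictly increasing. -/
@[ext]
structure Tableau (α : Type*) [LinearOrder α] where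
  rows : List (List α)
  rows_ne_nil : ∀ r ∈ rows, r ≠ []
  lengths : (rows.map List.length).SortedGE
  row_lt : ∀ r ∈ rows, r.Pairwise (· < ·)
  col_lt : rows.Pairwise fun r s => ∀ (j : ℕ) (hr : j < r.length) (hs : j < s.length), r[j] < s[j]
  nodup : rows.flatten.Nodup

/-- Insert `x` into an increasing row: `x` replaces the first entry larger than `x`, which is bumped
(second component), and is appended at the end if there is none. -/
def rowInsert {α : Type*} [LinearOrder α] (x : α) : List α → List α × Option α
  | [] => ([x], none)
  | y :: r => if x < y then (x :: r, some y) else (y :: (rowInsert x r).1, (rowInsert x r).2)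

/-- RSK-insertion of `x`: insert `x` into the first row, the bumped entry into the next row, and so
on. -/
def rskInsert {α : Type*} [LinearOrder α] : α → List (List α) → List (List α)
  | x, [] => [[x]]
  | x, r :: rs =>
    match rowInsert x r with
    | (r', none) => r' :: rs
    | (r', some y) => r' :: rskInsert y rs

namespace Tableau

variable {α : Type*} [LinearOrder α]

/-- The shape of a tableau. -/
def shape (T : Tableau α) : YoungDiagram := YoungDiagram.ofRowLens (T.rows.map List.length) T.lengths

/-- The entry in row `c.1` and column `c.2`, if there is one. -/
def entry (T : Tableau α) (c : ℕ × ℕ) : Option α := T.rows[c.1]?.bind fun r => r[c.2]?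

/-- `T'` arises from `T` by adding the entry `x` in the square(s) of `T'` outside `T`. -/
def IsAddition (T T' : Tableau α) (x : α) : Prop :=
  (∀ c ∈ T.shape, T'.entry c = T.entry c) ∧
    ∀ c ∈ T'.shape, c ∉ T.shape → T'.entry c = some x

end Tableau

/-! ### Vacillating tableaux -/

/-- Half of an elementary step: do nothing, add a square, remove a square. -/
inductive Move
  | stay
  | add
  | remove

/-- The shape `ν` is obtained from the shape `μ` by the given move. -/
def Move.Rel : Move → YoungDiagram → YoungDiagram → Prop
  | .stay, μ, ν => ν = μ
  | .add, μ, ν => μ ≤ ν ∧ ν.card = μ.card + 1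
  | .remove, μ, ν => ν ≤ μ ∧ μ.card = ν.card + 1

/-- The seven elementary steps `(∅,∅)`, `(-□,∅)`, `(∅,+□)`, `(±□,±□)`. -/
def elementarySteps : Set (Move × Move) :=
  {(.stay, .stay), (.remove, .stay), (.stay, .add), (.add, .add), (.add, .remove), (.remove, .add),
    (.remove, .remove)}

/-- The pair of shapes `(μ₁, μ₂)` is derived from `μ₀` by the step `s`. -/
def StepRel (s : Move × Move) (μ₀ μ₁ μ₂ : YoungDiagram) : Prop := s.1.Rel μ₀ μ₁ ∧ s.2.Rel μ₁ μ₂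

/-- Vacillating tableaux of shape `μ` and length `2n`. -/
@[ext]
structure VacillatingTableau (n : ℕ) (μ : YoungDiagram) where
  shape : Fin (2 * n + 1) → YoungDiagram
  shape_zero : shape 0 = ⊥
  shape_last : shape (Fin.last (2 * n)) = μ
  step : ∀ j : Fin n, ∃ s ∈ elementarySteps, StepRel s (shape ⟨2 * j, by omega⟩)
    (shape ⟨2 * j + 1, by omega⟩) (shape ⟨2 * j + 2, by omega⟩)

namespace VacillatingTableau

variable {n : ℕ} {μ : YoungDiagram} (V : VacillatingTableau n μ)

/-- The step of `V` at the vertex `j` (deriving two shapes from the shape with index `2(j - 1)`, for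
`j = 1, …, n`) is `s`. -/
def StepAt (j : Fin n) (s : Move × Move) : Prop :=
  StepRel s (V.shape ⟨2 * j, by omega⟩) (V.shape ⟨2 * j + 1, by omega⟩)
    (V.shape ⟨2 * j + 2, by omega⟩)

/-- `V` is obtained via steps in `S`. -/
def Models (S : Set (Move × Move)) : Prop := ∀ j, ∃ s ∈ S, V.StepAt j s

/-- All shapes of `V` have fewer than `k` rows. -/
def RowsLT (k : ℕ) : Prop := ∀ h, (V.shape h).rowLens.length < k

end VacillatingTableau

/-! ### The map from vacillating tableaux to arcs -/

/-- One move of the construction: from the arcs and the tableau `(P, T)` to `(P', T')`, with `x` the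
current vertex. If a square is added, then `x` is entered in it; if a square is removed, then the
unique `i` is extracted for which RSK-insertion of `i` into `T'` gives `T`, and the arc `(i, x)` is
added. -/
def Move.Act {n : ℕ} (x : HalfVertex n) (P : Set (HalfVertex n × HalfVertex n))
    (T : Tableau (HalfVertex n)) (P' : Set (HalfVertex n × HalfVertex n))
    (T' : Tableau (HalfVertex n)) : Move → Prop
  | .stay => P' = P ∧ T' = T
  | .add => P' = P ∧ T.IsAddition T' x
  | .remove => ∃ i, T.rows = rskInsert i T'.rows ∧ P' = insert (i, x) P

/-- The vertex used in the second half of a step at `j`: it is `j'` unless the first half of the step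
does nothing. -/
def sndVertex {n : ℕ} (j : Fin n) : Move → HalfVertex n
  | .stay => plain j
  | .add => prime j
  | .remove => prime j

/-- `H` is the graph `φ(V)`: there are sets of arcs `P 0, …, P (2n)` and tableaux `T 0, …, T (2n)`,
where `T h` has the shape with index `h` of `V`, which start with `P 0 = ∅` and follow the steps of
`V`; then `H` has the arcs `P (2n)` and the vertices `1, …, n` together with `j'` for every step at
`j` none of whose halves does nothing. -/
def VacillatingTableau.IsPhi {n : ℕ} {μ : YoungDiagram} (V : VacillatingTableau n μ)
    (H : HalfGraph n) : Prop :=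
  (∃ (P : Fin (2 * n + 1) → Set (HalfVertex n × HalfVertex n))
      (T : Fin (2 * n + 1) → Tableau (HalfVertex n)),
    P 0 = ∅ ∧ (∀ h, (T h).shape = V.shape h) ∧
    (∀ (j : Fin n) (s : Move × Move), V.StepAt j s →
      s.1.Act (plain j) (P ⟨2 * j, by omega⟩) (T ⟨2 * j, by omega⟩)
        (P ⟨2 * j + 1, by omega⟩) (T ⟨2 * j + 1, by omega⟩) ∧
      s.2.Act (sndVertex j s.1) (P ⟨2 * j + 1, by omega⟩) (T ⟨2 * j + 1, by omega⟩)
        (P ⟨2 * j + 2, by omega⟩) (T ⟨2 * j + 2, by omega⟩)) ∧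
    H.arcs = P (Fin.last (2 * n))) ∧
  H.verts = {v | ∃ j, v = plain j ∨
    (v = prime j ∧ ∃ a b : Move, a ≠ .stay ∧ b ≠ .stay ∧ V.StepAt j (a, b))}

/-! Both sides are encoded by one object: an involution `m` of the half-vertices `1 < 1' < ⋯ < n <
n'`, whose arcs are the pairs `z < m z`, whose fixed points are the unmatched half-vertices, and in
which `j'` is matched only if `j` is (`IsPairing`).

Tableaux. The current vertices of the moves that do something increase strictly. So an added vertex
exceeds all present entries, and a removed square closes an arc that was opened earlier; as the last
tableau is empty, the arcs produced are those of a pairing (`IsRun.exists_follows`). Conversely `m`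
prescribes the steps (`stepOf`); they are unique because (add, stay) and (stay, remove) are not
elementary. From right to left each move can be undone: a removal at `x` by RSK-inserting `m x`, an
addition at `x` by deleting `x`, which is the largest entry. Starting with the empty tableau at the
end, this recovers the vacillating tableau from `m` (`IsRun.backward_unique`) and constructs one for
every `m` (`Follows.exists_isRun`).

Diagrams. `contract` identifies `j'` with `j` and remembers whether the arcs through `j` and `j'`
cross. This crossing is decided by the positions of the far ends (`crosses_plain_prime_iff`), and
the rules of inflation invert that criterion, so inflating the contraction returns `m`
(`inflation_contract`). Every diagram is a contraction (`exists_contract_eq`): distribute the arc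
ends in any way, then exchange `j` and `j'` where the crossing is wrong. Hence ι is injective, and β
is the composite of the two correspondences.

Rows. The tableau at a given time is Knuth equivalent to the word of the left ends of the open arcs,
sorted by decreasing right ends (`IsRun.exists_word`). Knuth equivalence preserves the lengths of
decreasing subwords, and the longest one in the reading word of a tableau has as many letters as
there are rows. A decreasing subword is a set of simultaneously open arcs whose left and right ends
are ordered alike, that is, a set of mutually crossing arcs; conversely, mutually crossing arcs are
all open just before the first of them closes. Contraction neither creates nor destroys crossings
(`crossing_contract_iff`). Finally, the step at `j` tells whether `j` and `j'` are left ends, right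
ends or unmatched, which separates matchings, partitions and braids. -/

set_option linter.unusedSectionVars false

/-! ### Insertion into a single row and its inverse -/

section RowInsertion

variable {α : Type*} [LinearOrder α]

/-- The row `r` fits above the row `s` in a tableau: `s` is not longer than `r`, and the entries of
`s` are larger than those of `r` in the same columns. -/
def RowAbove : List α → List α → Prop
  | _, [] => True
  | [], _ :: _ => False
  | a :: r, b :: s => a < b ∧ RowAbove r s

@[simp] theorem rowAbove_nil (r : List α) : RowAbove r [] := by cases r <;> trivial

@[simp] theorem not_rowAbove_nil_cons (b : α) (s : List α) : ¬ RowAbove [] (b :: s) := id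

@[simp] theorem rowAbove_cons_cons (a b : α) (r s : List α) :
    RowAbove (a :: r) (b :: s) ↔ a < b ∧ RowAbove r s := Iff.rfl

theorem rowAbove_iff {r s : List α} : RowAbove r s ↔ s.length ≤ r.length ∧
    ∀ (j : ℕ) (hr : j < r.length) (hs : j < s.length), r[j] < s[j] := by
  induction r generalizing s with
  | nil => cases s <;> simp
  | cons a r ih =>
    cases s with
    | nil => simp
    | cons b s =>
      rw [rowAbove_cons_cons, ih]
      constructor
      · rintro ⟨h1, h2, h3⟩
        refine ⟨by simpa using h2, fun j hr hs => ?_⟩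
        cases j with
        | zero => exact h1
        | succ j => exact h3 j (by simpa using hr) (by simpa using hs)
      · rintro ⟨h2, h3⟩
        refine ⟨h3 0 (by simp) (by simp), by simpa using h2, fun j hr hs => ?_⟩
        exact h3 (j + 1) (by simpa using hr) (by simpa using hs)

theorem rowInsert_cons_of_lt {x a : α} (h : x < a) (r : List α) :
    rowInsert x (a :: r) = (x :: r, some a) := by
  rw [rowInsert, if_pos h]

theorem rowInsert_cons_of_not_lt {x a : α} (h : ¬ x < a) {r q : List α} {o : Option α}
    (e : rowInsert x r = (q, o)) : rowInsert x (a :: r) = (a :: q, o) := by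
  rw [rowInsert, if_neg h, e]

theorem RowAbove.trans {r s t : List α} (h : RowAbove r s) (h' : RowAbove s t) : RowAbove r t := by
  rw [rowAbove_iff] at *
  exact ⟨h'.1.trans h.1, fun j hr ht =>
    (h.2 j hr (ht.trans_le h'.1)).trans (h'.2 j (ht.trans_le h'.1) ht)⟩

theorem RowAbove.length_le {r s : List α} (h : RowAbove r s) : s.length ≤ r.length :=
  (rowAbove_iff.1 h).1

theorem RowAbove.exists_lt {r s : List α} (h : RowAbove r s) {b : α} (hb : b ∈ s) :
    ∃ a ∈ r, a < b := by
  rw [rowAbove_iff] at h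
  obtain ⟨j, hj, rfl⟩ := List.getElem_of_mem hb
  exact ⟨r[j], List.getElem_mem _, h.2 j (hj.trans_le h.1) hj⟩

theorem RowAbove.append_left {r s : List α} (h : RowAbove r s) (t : List α) :
    RowAbove (r ++ t) s := by
  rw [rowAbove_iff] at *
  refine ⟨by simp; omega, fun j hr hs => ?_⟩
  rw [List.getElem_append_left (hs.trans_le h.1)]
  exact h.2 j _ hs

theorem RowAbove.of_append_left {r s t : List α} (h : RowAbove (r ++ t) s)
    (hl : s.length ≤ r.length) : RowAbove r s := by
  rw [rowAbove_iff] at *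
  refine ⟨hl, fun j hr hs => ?_⟩
  have := h.2 j (by simp; omega) hs
  rwa [List.getElem_append_left hr] at this

theorem RowAbove.of_append_right {r s t : List α} (h : RowAbove r (s ++ t)) : RowAbove r s := by
  rw [rowAbove_iff] at *
  refine ⟨by have := h.1; simp at this; omega, fun j hr hs => ?_⟩
  have := h.2 j hr (by simp; omega)
  rwa [List.getElem_append_left hs] at this

theorem RowAbove.append_right {r s : List α} {x : α} (h : RowAbove r s) (hl : s.length < r.length)
    (hx : ∀ a ∈ r, a < x) : RowAbove r (s ++ [x]) := by
  rw [rowAbove_iff] at *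
  refine ⟨by simp; omega, fun j hr hs => ?_⟩
  rw [List.getElem_append]
  split
  · exact h.2 j hr _
  · simpa using hx _ (List.getElem_mem _)

theorem rowInsert_none {x : α} {r r' : List α} (h : rowInsert x r = (r', none)) :
    r' = r ++ [x] ∧ ∀ a ∈ r, a ≤ x := by
  induction r generalizing r' with
  | nil => simp [rowInsert] at h; simp [h]
  | cons a r ih =>
    by_cases hxa : x < a
    · simp [rowInsert_cons_of_lt hxa] at h
    · rcases e : rowInsert x r with ⟨q, o⟩
      rw [rowInsert_cons_of_not_lt hxa e, Prod.mk.injEq] at h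
      obtain ⟨rfl, rfl⟩ := h
      obtain ⟨rfl, h2⟩ := ih e
      exact ⟨rfl, by simpa using ⟨not_lt.1 hxa, h2⟩⟩

theorem rowInsert_some {x y : α} {r r' : List α} (h : rowInsert x r = (r', some y)) :
    ∃ A B, r = A ++ y :: B ∧ r' = A ++ x :: B ∧ (∀ a ∈ A, a ≤ x) ∧ x < y := by
  induction r generalizing r' with
  | nil => simp [rowInsert] at h
  | cons a r ih =>
    by_cases hxa : x < a
    · rw [rowInsert_cons_of_lt hxa, Prod.mk.injEq, Option.some.injEq] at h
      obtain ⟨rfl, rfl⟩ := h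
      exact ⟨[], r, rfl, rfl, by simp, hxa⟩
    · rcases e : rowInsert x r with ⟨q, o⟩
      rw [rowInsert_cons_of_not_lt hxa e, Prod.mk.injEq] at h
      obtain ⟨rfl, rfl⟩ := h
      obtain ⟨A, B, rfl, rfl, h3, h4⟩ := ih e
      exact ⟨a :: A, B, rfl, rfl, by simpa using ⟨not_lt.1 hxa, h3⟩, h4⟩

theorem rowInsert_of_forall_le {x : α} {r : List α} (h : ∀ a ∈ r, a ≤ x) :
    rowInsert x r = (r ++ [x], none) := by
  induction r with
  | nil => rfl
  | cons a r ih =>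
    simp only [List.mem_cons, forall_eq_or_imp] at h
    rw [rowInsert, if_neg (not_lt.2 h.1), ih h.2]; rfl

theorem length_rowInsert_some {x y : α} {r r' : List α} (h : rowInsert x r = (r', some y)) :
    r'.length = r.length := by
  obtain ⟨A, B, rfl, rfl, -⟩ := rowInsert_some h
  simp

theorem mem_rowInsert (x : α) (r : List α) : x ∈ (rowInsert x r).1 := by
  rcases h : rowInsert x r with ⟨r', _ | y⟩
  · simp [(rowInsert_none h).1]
  · obtain ⟨A, B, -, rfl, -⟩ := rowInsert_some h
    simp

theorem pairwise_rowInsert {x : α} {r : List α} (hr : r.Pairwise (· < ·)) (hx : x ∉ r) :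
    (rowInsert x r).1.Pairwise (· < ·) := by
  rcases h : rowInsert x r with ⟨r', _ | y⟩
  · obtain ⟨rfl, h2⟩ := rowInsert_none h
    simp only [List.pairwise_append, hr, List.pairwise_singleton, true_and, List.mem_singleton,
      forall_eq]
    exact fun a ha => lt_of_le_of_ne (h2 a ha) fun e => hx (e ▸ ha)
  · obtain ⟨A, B, rfl, rfl, h3, h4⟩ := rowInsert_some h
    simp only [List.pairwise_append, List.pairwise_cons, List.mem_cons, forall_eq_or_imp] at hr ⊢
    refine ⟨hr.1, ⟨fun b hb => h4.trans (hr.2.1.1 b hb), hr.2.1.2⟩, fun a ha => ⟨?_, ?_⟩⟩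
    · exact lt_of_le_of_ne (h3 a ha) fun e => hx (by simp [← e, ha])
    · exact (hr.2.2 a ha).2

/-- Reverse bumping: `y` takes the place of the largest entry smaller than `y`, and that entry is
ejected. -/
theorem exists_rowInsert_eq {y : α} {r : List α} (hr : r.Pairwise (· < ·)) (hy : y ∉ r)
    (h : ∃ a ∈ r, a < y) :
    ∃ x r', rowInsert x r' = (r, some y) ∧ r'.Pairwise (· < ·) ∧ x ∈ r := by
  induction r with
  | nil => simp at h
  | cons a r ih =>
    simp only [List.pairwise_cons, List.mem_cons, not_or, exists_eq_or_imp] at hr hy h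
    by_cases h' : ∃ b ∈ r, b < y
    · obtain ⟨x, r', h1, h2, h3⟩ := ih hr.2 hy.2 h'
      refine ⟨x, a :: r', ?_, ?_, by simp [h3]⟩
      · exact rowInsert_cons_of_not_lt (hr.1 x h3).not_gt h1
      · refine List.pairwise_cons.2 ⟨?_, h2⟩
        obtain ⟨A, B, rfl, rfl, -, h5⟩ := rowInsert_some h1
        intro b hb
        simp only [List.mem_append, List.mem_cons] at hb
        rcases hb with hb | rfl | hb
        · exact hr.1 b (by simp [hb])
        · exact (hr.1 x (by simp)).trans h5
        · exact hr.1 b (by simp [hb])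
    · push Not at h'
      have hay : a < y := by
        rcases h with h | ⟨b, hb, h⟩
        · exact h
        · exact absurd h (h' b hb).not_gt
      refine ⟨a, y :: r, ?_, ?_, by simp⟩
      · rw [rowInsert, if_pos hay]
      · refine List.pairwise_cons.2 ⟨fun b hb => ?_, hr.2⟩
        exact lt_of_le_of_ne (h' b hb) fun e => hy.2 (e ▸ hb)

/-- The inserted entry is the last entry of `r` below the bumped `y`, because everything behind it
already followed `y` in an increasing row. So `r` and `y` determine its position. -/
theorem rowInsert_inj {x₁ x₂ y : α} {r₁ r₂ r : List α} (hr₁ : r₁.Pairwise (· < ·))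
    (hr₂ : r₂.Pairwise (· < ·)) (h₁ : rowInsert x₁ r₁ = (r, some y))
    (h₂ : rowInsert x₂ r₂ = (r, some y)) : x₁ = x₂ ∧ r₁ = r₂ := by
  obtain ⟨A, B, rfl, rfl, h3, h4⟩ := rowInsert_some h₁
  obtain ⟨C, D, rfl, e, h7, h8⟩ := rowInsert_some h₂
  simp only [List.pairwise_append, List.pairwise_cons, List.mem_cons, forall_eq_or_imp] at hr₁ hr₂
  rw [List.append_eq_append_iff] at e
  rcases e with ⟨E, rfl, e⟩ | ⟨E, rfl, e⟩
  · cases E with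
    | nil => simp at e; simp [e]
    | cons c E =>
      simp only [List.cons_append, List.cons.injEq] at e
      have := hr₁.2.1.1 x₂ (by simp [e.2])
      exact absurd this h8.not_gt
  · cases E with
    | nil => simp at e; simp [e]
    | cons c E =>
      simp only [List.cons_append, List.cons.injEq] at e
      have := hr₂.2.1.1 x₁ (by simp [e.2])
      exact absurd this h4.not_gt

/-- The entry below the bumped `y` exceeds `y`, so `y` enters the next row no further right than the
column it left, and there it stands below something smaller. -/
theorem RowAbove.rowInsert_snd {x y : α} {r r' s : List α} (h : RowAbove r s)
    (hs : r.Pairwise (· < ·)) (hx : rowInsert x r = (r', some y)) :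
    RowAbove r' (rowInsert y s).1 := by
  induction r generalizing r' s with
  | nil => simp [rowInsert] at hx
  | cons a r ih =>
    rw [List.pairwise_cons] at hs
    by_cases hxa : x < a
    · rw [rowInsert_cons_of_lt hxa, Prod.mk.injEq, Option.some.injEq] at hx
      obtain ⟨rfl, rfl⟩ := hx
      cases s with
      | nil => simpa [rowInsert]
      | cons b s =>
        rw [rowInsert_cons_of_lt h.1]
        exact ⟨hxa, h.2⟩
    · rcases e : rowInsert x r with ⟨q, o⟩
      rw [rowInsert_cons_of_not_lt hxa e, Prod.mk.injEq] at hx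
      obtain ⟨rfl, rfl⟩ := hx
      have hl := length_rowInsert_some e
      obtain ⟨A, B, h1, h2, h3, h4⟩ := rowInsert_some e
      have hay : a < y := hs.1 y (by simp [h1])
      cases s with
      | nil => simpa [rowInsert]
      | cons b s =>
        by_cases hyb : y < b
        · rw [rowInsert_cons_of_lt hyb]
          refine ⟨hay, ?_⟩
          have h5 := h.2
          rw [rowAbove_iff] at h5 ⊢
          refine ⟨by rw [hl]; exact h5.1, fun j hj hj' => ?_⟩
          -- Insertion only lowers entries: the new row differs from the old one by `x` in place of
          -- the larger `y`.
          refine lt_of_le_of_lt ?_ (h5.2 j (hl ▸ hj) hj')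
          subst h1 h2
          simp only [List.getElem_append, List.getElem_cons]
          split_ifs
          · exact le_rfl
          · exact h4.le
          · exact le_rfl
        · rcases e' : rowInsert y s with ⟨q', o'⟩
          rw [rowInsert_cons_of_not_lt hyb e']
          have := ih h.2 hs.2 e
          rw [e'] at this
          exact ⟨h.1, this⟩

/-- The converse of `RowAbove.rowInsert_snd`, needed to see that un-inserting leaves a tableau. -/
theorem RowAbove.of_rowInsert_snd {x y : α} {r r' s : List α} (hr : r.Pairwise (· < ·))
    (hs : s.Pairwise (· < ·)) (hx : rowInsert x r = (r', some y))
    (h : RowAbove r' (rowInsert y s).1) : RowAbove r s := by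
  induction r generalizing r' s with
  | nil => simp [rowInsert] at hx
  | cons a r ih =>
    cases s with
    | nil => simp
    | cons b s =>
    rw [List.pairwise_cons] at hr hs
    rcases e' : rowInsert y s with ⟨q', o'⟩
    by_cases hxa : x < a
    · rw [rowInsert_cons_of_lt hxa, Prod.mk.injEq, Option.some.injEq] at hx
      obtain ⟨rfl, rfl⟩ := hx
      by_cases hab : a < b
      · rw [rowInsert_cons_of_lt hab] at h
        exact ⟨hab, h.2⟩
      · rw [rowInsert_cons_of_not_lt hab e'] at h
        -- Otherwise `a` would land behind `b` in the second row, below an entry of the tail of the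
        -- first row; but all of these exceed `a`.
        have ha := mem_rowInsert a s
        rw [e'] at ha
        obtain ⟨c, hc, h'⟩ := RowAbove.exists_lt h.2 ha
        exact absurd (hr.1 c hc) h'.not_gt
    · rcases e : rowInsert x r with ⟨q, o⟩
      rw [rowInsert_cons_of_not_lt hxa e, Prod.mk.injEq] at hx
      obtain ⟨rfl, rfl⟩ := hx
      have hl := length_rowInsert_some e
      obtain ⟨A, B, h1, h2, h3, h4⟩ := rowInsert_some e
      have hay : a < y := hr.1 y (by simp [h1])
      by_cases hyb : y < b
      · rw [rowInsert_cons_of_lt hyb] at h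
        refine ⟨hay.trans hyb, ?_⟩
        have h5 := h.2
        rw [rowAbove_iff] at h5 ⊢
        refine ⟨by rw [← hl]; exact h5.1, fun j hj hj' => ?_⟩
        have h6 := h5.2 j (hl.symm ▸ hj) hj'
        subst h1 h2
        simp only [List.getElem_append, List.getElem_cons] at h6 ⊢
        -- Only the column of the bumped entry is new: there the upper row regains `y`, and `y < b`
        -- is less than every entry of `s`.
        split_ifs at h6 ⊢
        · exact h6
        · exact hyb.trans (hs.1 _ (List.getElem_mem _))
        · exact h6
      · rw [rowInsert_cons_of_not_lt hyb e'] at h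
        refine ⟨h.1, ih hr.2 hs.2 e ?_⟩
        rw [e']
        exact h.2

end RowInsertion

/-! ### Tableaux as lists of rows, and their row lengths -/

section Tableaux

variable {α : Type*} [LinearOrder α]

/-- Lists of rows which fit together to a tableau. -/
def IsTab : List (List α) → Prop
  | [] => True
  | r :: rs => r ≠ [] ∧ r.Pairwise (· < ·) ∧ RowAbove r (rs.headD []) ∧ IsTab rs

@[simp] theorem isTab_nil : IsTab ([] : List (List α)) := trivial

@[simp] theorem isTab_cons {r : List α} {rs : List (List α)} : IsTab (r :: rs) ↔
    r ≠ [] ∧ r.Pairwise (· < ·) ∧ RowAbove r (rs.headD []) ∧ IsTab rs := Iff.rfl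

/-- The row lengths. -/
def lens (rows : List (List α)) (i : ℕ) : ℕ := (rows.getD i []).length

@[simp] theorem lens_nil (i : ℕ) : lens ([] : List (List α)) i = 0 := by simp [lens]

@[simp] theorem lens_cons_zero (r : List α) (rs : List (List α)) : lens (r :: rs) 0 = r.length := by
  simp [lens]

@[simp] theorem lens_cons_succ (r : List α) (rs : List (List α)) (i : ℕ) :
    lens (r :: rs) (i + 1) = lens rs i := by
  simp [lens]

theorem length_headD (rs : List (List α)) : (rs.headD []).length = lens rs 0 := by
  cases rs <;> simp

/-- The shape with row lengths `g` has one more square than the shape with row lengths `f`. -/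
def AddsBox (f g : ℕ → ℕ) : Prop := ∃ k, ∀ i, g i = f i + if i = k then 1 else 0

theorem addsBox_of_zero {f g : ℕ → ℕ} (h0 : g 0 = f 0 + 1) (h : ∀ i, g (i + 1) = f (i + 1)) :
    AddsBox f g :=
  ⟨0, fun i => by cases i <;> simp [h0, h]⟩

theorem addsBox_of_succ {f g : ℕ → ℕ} (h0 : g 0 = f 0)
    (h : AddsBox (fun i => f (i + 1)) (fun i => g (i + 1))) : AddsBox f g := by
  obtain ⟨k, hk⟩ := h
  exact ⟨k + 1, fun i => by cases i <;> simp [h0, hk]⟩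

theorem AddsBox.cases {f g : ℕ → ℕ} (h : AddsBox f g) :
    (g 0 = f 0 + 1 ∧ ∀ i, g (i + 1) = f (i + 1)) ∨
      (g 0 = f 0 ∧ AddsBox (fun i => f (i + 1)) (fun i => g (i + 1))) := by
  obtain ⟨k, hk⟩ := h
  cases k with
  | zero => exact .inl ⟨by simp [hk], fun i => by simp [hk]⟩
  | succ k => exact .inr ⟨by simp [hk], k, fun i => by simp [hk]⟩

theorem AddsBox.ne_zero {f g : ℕ → ℕ} (h : AddsBox f g) (hg : Antitone g) : g 0 ≠ 0 := by
  obtain ⟨k, hk⟩ := h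
  have := hg (Nat.zero_le k)
  rw [hk k, if_pos rfl] at this
  omega

theorem antitone_tail {g : ℕ → ℕ} (hg : Antitone g) : Antitone fun i => g (i + 1) :=
  fun _ _ h => hg (Nat.succ_le_succ h)

theorem lens_eq_zero {rows : List (List α)} (h : IsTab rows) (h0 : lens rows 0 = 0) :
    rows = [] := by
  cases rows with
  | nil => rfl
  | cons r rs => simp at h0; exact absurd h0 h.1

theorem antitone_lens {rows : List (List α)} (h : IsTab rows) : Antitone (lens rows) := by
  refine antitone_nat_of_succ_le fun i => ?_
  induction rows generalizing i with
  | nil => simp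
  | cons r rs ih =>
    cases i with
    | zero =>
      have := h.2.2.1.length_le
      rw [length_headD] at this
      simpa using this
    | succ i => simpa using ih h.2.2.2 i

/-! ### Insertion -/

theorem rskInsert_cons_none {x : α} {r q : List α} (h : rowInsert x r = (q, none))
    (rs : List (List α)) : rskInsert x (r :: rs) = q :: rs := by
  rw [rskInsert, h]

theorem rskInsert_cons_some {x y : α} {r q : List α} (h : rowInsert x r = (q, some y))
    (rs : List (List α)) : rskInsert x (r :: rs) = q :: rskInsert y rs := by
  rw [rskInsert, h]

theorem headD_rskInsert (x : α) (rs : List (List α)) :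
    (rskInsert x rs).headD [] = (rowInsert x (rs.headD [])).1 := by
  cases rs with
  | nil => rfl
  | cons r rs =>
    rcases h : rowInsert x r with ⟨q, _ | y⟩
    · simp [rskInsert_cons_none h, h]
    · simp [rskInsert_cons_some h, h]

theorem rskInsert_flatten_perm (x : α) (rows : List (List α)) :
    (rskInsert x rows).flatten.Perm (x :: rows.flatten) := by
  induction rows generalizing x with
  | nil => simp [rskInsert]
  | cons r rs ih =>
    rcases h : rowInsert x r with ⟨q, _ | y⟩
    · rw [rskInsert_cons_none h, (rowInsert_none h).1]
      simp only [List.flatten_cons, List.append_assoc, List.singleton_append]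
      exact List.perm_middle
    · rw [rskInsert_cons_some h]
      obtain ⟨A, B, rfl, rfl, -⟩ := rowInsert_some h
      simp only [List.flatten_cons, List.append_assoc, List.cons_append]
      refine ((((ih y).append_left B).cons x).append_left A).trans ?_
      refine List.perm_middle.trans (.cons x (.append_left A ?_))
      exact List.perm_middle

theorem isTab_rskInsert {x : α} {rows : List (List α)} (h : IsTab rows)
    (hn : (x :: rows.flatten).Nodup) : IsTab (rskInsert x rows) := by
  induction rows generalizing x with
  | nil => simp [rskInsert]
  | cons r rs ih =>
    have hx : x ∉ r := fun hx => (List.nodup_cons.1 hn).1 (by simp [hx])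
    have hp := pairwise_rowInsert h.2.1 hx
    have hne : (rowInsert x r).1 ≠ [] := List.ne_nil_of_mem (mem_rowInsert x r)
    rcases e : rowInsert x r with ⟨q, _ | y⟩
    · rw [rskInsert_cons_none e]
      rw [e] at hp hne
      refine ⟨hne, hp, ?_, h.2.2.2⟩
      rw [(rowInsert_none e).1]
      exact h.2.2.1.append_left _
    · rw [rskInsert_cons_some e]
      rw [e] at hp hne
      refine ⟨hne, hp, ?_, ih h.2.2.2 ?_⟩
      · rw [headD_rskInsert]
        exact h.2.2.1.rowInsert_snd h.2.1 e
      · obtain ⟨A, B, rfl, rfl, -⟩ := rowInsert_some e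
        refine (List.nodup_cons.1 hn).2.sublist ?_
        simp only [List.flatten_cons, List.append_assoc, List.cons_append]
        exact (((List.sublist_append_right B _).cons_cons y).trans (List.sublist_append_right A _))

theorem addsBox_rskInsert (x : α) (rows : List (List α)) :
    AddsBox (lens rows) (lens (rskInsert x rows)) := by
  induction rows generalizing x with
  | nil => exact addsBox_of_zero (by simp [rskInsert]) (by simp [rskInsert])
  | cons r rs ih =>
    rcases h : rowInsert x r with ⟨q, _ | y⟩
    · rw [rskInsert_cons_none h]
      exact addsBox_of_zero (by simp [(rowInsert_none h).1]) (by simp)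
    · rw [rskInsert_cons_some h]
      exact addsBox_of_succ (by simp [length_rowInsert_some h]) (by simpa using ih y)

/-- Reverse RSK. If the square to be removed lies in the first row, the last entry of that row is
extracted; otherwise an entry `y` is extracted from the rows below and reverse-bumped through the
first row. -/
theorem exists_rskInsert_eq {rows : List (List α)} (h : IsTab rows) (hn : rows.flatten.Nodup)
    {g : ℕ → ℕ} (hg : Antitone g) (hb : AddsBox g (lens rows)) :
    ∃ x rows', rskInsert x rows' = rows ∧ IsTab rows' ∧ lens rows' = g := by
  induction rows generalizing g with
  | nil => exact absurd rfl (hb.ne_zero (antitone_lens h))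
  | cons r rs ih =>
    obtain ⟨hr, hp, ha, ht⟩ := h
    rcases hb.cases with ⟨h0, hs⟩ | ⟨h0, hs⟩
    · simp only [lens_cons_zero, lens_cons_succ] at h0 hs
      rcases List.eq_nil_or_concat r with rfl | ⟨r0, x, rfl⟩
      · exact absurd rfl hr
      simp only [List.concat_eq_append] at *
      simp only [List.length_append, List.length_singleton, add_left_inj] at h0
      -- If the first row is a single square, removing it must leave the empty list of rows, since
      -- empty rows are not allowed; antitonicity of `g` shows that nothing lies below.
      by_cases hr0 : r0 = []
      · subst hr0
        simp only [List.length_nil] at h0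
        have hg0 (i : ℕ) : g i = 0 := by have := hg (Nat.zero_le i); omega
        have : rs = [] := lens_eq_zero ht (by simp [hs, hg0])
        subst this
        exact ⟨x, [], rfl, trivial, by ext i; simp [hg0]⟩
      · refine ⟨x, r0 :: rs, ?_, ⟨hr0, ?_, ?_, ht⟩, ?_⟩
        · refine rskInsert_cons_none (rowInsert_of_forall_le fun a ha => ?_) rs
          exact ((List.pairwise_append.1 hp).2.2 a ha x (by simp)).le
        · exact (List.pairwise_append.1 hp).1
        · refine ha.of_append_left ?_
          rw [length_headD, hs, h0]
          exact hg (Nat.zero_le _)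
        · ext i; cases i <;> simp [h0, hs]
    · simp only [lens_cons_zero, lens_cons_succ] at h0 hs
      rw [List.flatten_cons, List.nodup_append'] at hn
      obtain ⟨y, rs', rfl, h2, h3⟩ := ih ht hn.2.1 (antitone_tail hg) hs
      rw [headD_rskInsert] at ha
      -- After its insertion `y` stands in the second row, hence below a smaller entry of `r`, which
      -- is what reverse bumping requires.
      have hy : ∃ a ∈ r, a < y := ha.exists_lt (mem_rowInsert _ _)
      have hy' : y ∉ r := fun hy => hn.2.2 hy ((rskInsert_flatten_perm y rs').symm.subset (by simp))
      obtain ⟨x, r', h4, h5, h6⟩ := exists_rowInsert_eq hp hy' hy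
      refine ⟨x, r' :: rs', rskInsert_cons_some h4 _, ⟨?_, h5, ?_, h2⟩, ?_⟩
      · rintro rfl
        simp [rowInsert] at h4
      · refine RowAbove.of_rowInsert_snd h5 ?_ h4 ha
        cases rs' with
        | nil => simp
        | cons s rs' => exact h2.2.1
      · ext i
        cases i with
        | zero => simp [← h0, length_rowInsert_some h4]
        | succ i => simpa using congrFun h3 i

/-- Equal shapes before insertion and equal results force both insertions to end in the same row, as
the row lengths show; above it, `rowInsert_inj` undoes the bumps one row at a time. -/
theorem rskInsert_inj {x₁ x₂ : α} {rows₁ rows₂ : List (List α)} (h₁ : IsTab rows₁)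
    (h₂ : IsTab rows₂) (hl : lens rows₁ = lens rows₂)
    (h : rskInsert x₁ rows₁ = rskInsert x₂ rows₂) : x₁ = x₂ ∧ rows₁ = rows₂ := by
  induction rows₁ generalizing x₁ x₂ rows₂ with
  | nil =>
    obtain rfl := lens_eq_zero h₂ (by simp [← hl])
    simpa [rskInsert] using h
  | cons r₁ rs₁ ih =>
    cases rows₂ with
    | nil =>
      have := lens_eq_zero h₁ (by rw [hl]; simp)
      simp at this
    | cons r₂ rs₂ =>
      have h0 := congrFun hl 0
      simp only [lens_cons_zero] at h0
      have hs : lens rs₁ = lens rs₂ := by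
        ext i; simpa using congrFun hl (i + 1)
      rcases e₁ : rowInsert x₁ r₁ with ⟨q₁, _ | y₁⟩ <;> rcases e₂ : rowInsert x₂ r₂ with ⟨q₂, _ | y₂⟩
      · rw [rskInsert_cons_none e₁, rskInsert_cons_none e₂, (rowInsert_none e₁).1,
          (rowInsert_none e₂).1, List.cons.injEq] at h
        obtain ⟨h1, h2⟩ := List.append_inj' h.1 rfl
        simp_all
      · rw [rskInsert_cons_none e₁, rskInsert_cons_some e₂, List.cons.injEq] at h
        have h3 := length_rowInsert_some e₂
        rw [← h.1, (rowInsert_none e₁).1, List.length_append, h0, List.length_singleton] at h3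
        omega
      · rw [rskInsert_cons_some e₁, rskInsert_cons_none e₂, List.cons.injEq] at h
        have h3 := length_rowInsert_some e₁
        rw [h.1, (rowInsert_none e₂).1, List.length_append, h0, List.length_singleton] at h3
        omega
      · rw [rskInsert_cons_some e₁, rskInsert_cons_some e₂, List.cons.injEq] at h
        obtain ⟨rfl, rfl⟩ := ih h₁.2.2.2 h₂.2.2.2 hs h.2
        obtain ⟨rfl, h'⟩ := h
        obtain ⟨rfl, rfl⟩ := rowInsert_inj h₁.2.1 h₂.2.1 e₁ e₂
        exact ⟨rfl, rfl⟩

/-! ### Adding an entry in an outer corner -/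

/-- `rows'` arises from `rows` by appending `x` to a row. -/
inductive Appends (x : α) : List (List α) → List (List α) → Prop
  | new : Appends x [] [[x]]
  | here (r : List α) (rs : List (List α)) : Appends x (r :: rs) ((r ++ [x]) :: rs)
  | there (r : List α) {rs rs' : List (List α)} : Appends x rs rs' → Appends x (r :: rs) (r :: rs')

theorem Appends.flatten_perm {x : α} {rows rows' : List (List α)} (h : Appends x rows rows') :
    rows'.flatten.Perm (x :: rows.flatten) := by
  induction h with
  | new => simp
  | here r rs =>
    simp only [List.flatten_cons, List.append_assoc, List.singleton_append]
    exact List.perm_middle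
  | there r h ih =>
    exact (ih.append_left r).trans List.perm_middle

theorem Appends.headD {x : α} {rows rows' : List (List α)} (h : Appends x rows rows') :
    rows'.headD [] = rows.headD [] ∨ rows'.headD [] = rows.headD [] ++ [x] := by
  cases h <;> simp

theorem Appends.addsBox {x : α} {rows rows' : List (List α)} (h : Appends x rows rows') :
    AddsBox (lens rows) (lens rows') := by
  induction h with
  | new => exact addsBox_of_zero (by simp) (by simp)
  | here r rs => exact addsBox_of_zero (by simp) (by simp)
  | there r h ih => exact addsBox_of_succ (by simp) (by simpa using ih)

/-- An entry larger than all others may be put into any outer corner; antitonicity of `g` says that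
the square is such a corner. -/
theorem exists_appends {x : α} {rows : List (List α)} (h : IsTab rows)
    (hx : ∀ a ∈ rows.flatten, a < x) {g : ℕ → ℕ} (hg : Antitone g) (hb : AddsBox (lens rows) g) :
    ∃ rows', Appends x rows rows' ∧ IsTab rows' ∧ lens rows' = g := by
  induction rows generalizing g with
  | nil =>
    refine ⟨[[x]], .new, by simp, ?_⟩
    rcases hb.cases with ⟨h0, hs⟩ | ⟨h0, hs⟩
    · ext i; cases i <;> simp [h0, hs]
    · exact absurd (by simpa using h0) (hb.ne_zero hg)
  | cons r rs ih =>
    simp only [List.flatten_cons, List.mem_append] at hx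
    rcases hb.cases with ⟨h0, hs⟩ | ⟨h0, hs⟩
    · refine ⟨_, .here r rs, ⟨by simp, ?_, h.2.2.1.append_left _, h.2.2.2⟩, ?_⟩
      · simp only [List.pairwise_append, h.2.1, List.pairwise_singleton, List.mem_singleton,
          forall_eq, true_and]
        exact fun a ha => hx a (.inl ha)
      · ext i; cases i <;> simp [h0, hs]
    · simp only [lens_cons_zero, lens_cons_succ] at h0 hs
      obtain ⟨rs', h1, h2, h3⟩ := ih h.2.2.2 (fun a ha => hx a (.inr ha)) (antitone_tail hg) hs
      refine ⟨_, .there r h1, ⟨h.1, h.2.1, ?_, h2⟩, ?_⟩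
      · rcases h1.headD with e | e
        · rw [e]; exact h.2.2.1
        -- The row just below `r` has grown and is still no longer than `r`, so it was strictly
        -- shorter before.
        · have hl := hg (Nat.zero_le 1)
          have h4 := congrArg List.length e
          rw [e]
          refine h.2.2.1.append_right ?_ fun a ha => hx a (.inl ha)
          rw [length_headD, h3, List.length_append, List.length_singleton] at h4
          simp only [zero_add] at h4
          omega
      · ext i
        cases i with
        | zero => simp [h0]
        | succ i => simpa using congrFun h3 i

/-- The largest entry ends its row and has nothing below it, so it can be deleted. This undoes an
added square. -/
theorem exists_appends_of_max {x : α} {rows : List (List α)} (h : IsTab rows)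
    (hn : rows.flatten.Nodup) (hx : x ∈ rows.flatten) (hmax : ∀ a ∈ rows.flatten, a ≤ x) :
    ∃ rows', Appends x rows' rows ∧ IsTab rows' := by
  induction rows with
  | nil => simp at hx
  | cons r rs ih =>
    obtain ⟨hr, hp, ha, ht⟩ := h
    simp only [List.flatten_cons, List.mem_append] at hx hmax
    rw [List.flatten_cons, List.nodup_append'] at hn
    by_cases hxr : x ∈ r
    · obtain ⟨A, B, rfl⟩ := List.append_of_mem hxr
      have hB : B = [] := by
        rw [List.eq_nil_iff_forall_not_mem]
        intro b hb
        have h1 := (List.pairwise_append.1 hp).2.1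
        rw [List.pairwise_cons] at h1
        exact absurd (hmax b (by simp [hb])) (h1.1 b hb).not_ge
      subst hB
      have hlen : (rs.headD []).length ≤ A.length := by
        by_contra! hlt
        rw [rowAbove_iff] at ha
        have h2 := ha.2 A.length (by simp) hlt
        simp only [List.getElem_append_right (le_refl A.length), Nat.sub_self,
          List.getElem_cons_zero] at h2
        refine absurd (hmax _ (.inr ?_)) h2.not_ge
        cases rs with
        | nil => simp at hlt
        | cons s rs => exact List.mem_flatten.2 ⟨s, by simp, List.getElem_mem _⟩
      by_cases hA : A = []
      · subst hA
        have : rs = [] := by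
          refine lens_eq_zero ht ?_
          rw [← length_headD]
          simpa using hlen
        subst this
        exact ⟨[], .new, trivial⟩
      · exact ⟨A :: rs, .here A rs, hA, (List.pairwise_append.1 hp).1, ha.of_append_left hlen, ht⟩
    · obtain ⟨rs', h1, h2⟩ := ih ht hn.2.1 (hx.resolve_left hxr) fun a ha => hmax a (.inr ha)
      refine ⟨r :: rs', .there r h1, hr, hp, ?_, h2⟩
      rcases h1.headD with e | e
      · rwa [← e]
      · rw [e] at ha
        exact ha.of_append_right

end Tableaux

/-! ### Knuth equivalence and decreasing subwords -/

section Knuth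

variable {α : Type*} [LinearOrder α]

/-- The elementary Knuth transformations of words. -/
inductive KnuthStep : List α → List α → Prop
  | fst (A B : List α) {x y z : α} : x < y → y < z →
      KnuthStep (A ++ x :: z :: y :: B) (A ++ z :: x :: y :: B)
  | snd (A B : List α) {x y z : α} : x < y → y < z →
      KnuthStep (A ++ y :: x :: z :: B) (A ++ y :: z :: x :: B)

/-- Knuth equivalence of words. -/
def KnuthEquiv : List α → List α → Prop := Relation.EqvGen KnuthStep

theorem KnuthEquiv.refl (w : List α) : KnuthEquiv w w := Relation.EqvGen.refl w

theorem KnuthEquiv.symm {v w : List α} (h : KnuthEquiv v w) : KnuthEquiv w v :=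
  Relation.EqvGen.symm _ _ h

theorem KnuthEquiv.trans {u v w : List α} (h : KnuthEquiv u v) (h' : KnuthEquiv v w) :
    KnuthEquiv u w :=
  Relation.EqvGen.trans _ _ _ h h'

theorem KnuthStep.equiv {v w : List α} (h : KnuthStep v w) : KnuthEquiv v w := .rel _ _ h

theorem KnuthEquiv.map {f : List α → List α} (hf : ∀ v w, KnuthStep v w → KnuthEquiv (f v) (f w))
    {v w : List α} (h : KnuthEquiv v w) : KnuthEquiv (f v) (f w) := by
  induction h with
  | rel _ _ h => exact hf _ _ h
  | refl _ => exact .refl _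
  | symm _ _ _ ih => exact ih.symm
  | trans _ _ _ _ _ ih ih' => exact ih.trans ih'

theorem KnuthEquiv.append_left (u : List α) {v w : List α} (h : KnuthEquiv v w) :
    KnuthEquiv (u ++ v) (u ++ w) := by
  refine h.map (f := (u ++ ·)) fun v w h => ?_
  cases h with
  | fst A B h h' => simpa using (KnuthStep.fst (u ++ A) B h h').equiv
  | snd A B h h' => simpa using (KnuthStep.snd (u ++ A) B h h').equiv

theorem KnuthEquiv.append_right (u : List α) {v w : List α} (h : KnuthEquiv v w) :
    KnuthEquiv (v ++ u) (w ++ u) := by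
  refine h.map (f := (· ++ u)) fun v w h => ?_
  cases h with
  | fst A B h h' => simpa using (KnuthStep.fst A (B ++ u) h h').equiv
  | snd A B h h' => simpa using (KnuthStep.snd A (B ++ u) h h').equiv

theorem KnuthEquiv.cons (a : α) {v w : List α} (h : KnuthEquiv v w) :
    KnuthEquiv (a :: v) (a :: w) :=
  h.append_left [a]

/-- A Knuth relation either keeps all its three letters or loses at least the largest, `z`; in the
latter case both sides become equal, since only `z` is moved past another letter. -/
theorem KnuthEquiv.filter_lt (m : α) {v w : List α} (h : KnuthEquiv v w) :
    KnuthEquiv (v.filter (· < m)) (w.filter (· < m)) := by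
  refine h.map (f := List.filter (· < m)) fun v w h => ?_
  cases h with
  | @fst A B x y z h h' =>
    by_cases hz : z < m
    · have hy := h'.trans hz
      have hx := h.trans hy
      simpa [hx, hy, hz] using (KnuthStep.fst (A.filter (· < m)) (B.filter (· < m)) h h').equiv
    · simpa [List.filter_cons, hz] using KnuthEquiv.refl _
  | @snd A B x y z h h' =>
    by_cases hz : z < m
    · have hy := h'.trans hz
      have hx := h.trans hy
      simpa [hx, hy, hz] using (KnuthStep.snd (A.filter (· < m)) (B.filter (· < m)) h h').equiv
    · simpa [List.filter_cons, hz] using KnuthEquiv.refl _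

/-- The word `w` has a strictly decreasing subword of length `k`. -/
def HasDecreasing (k : ℕ) (w : List α) : Prop :=
  ∃ l : List α, l.Sublist w ∧ l.length = k ∧ l.Pairwise (· > ·)

/-- Only a subword using `z` and then `x` on the right is lost on the left. It cannot use `y`, which
follows `x` and is larger, so `x` may be replaced by `y`: the later letters are below `x < y`. -/
theorem hasDecreasing_of_knuthStep_fst {k : ℕ} {A B : List α} {x y z : α} (hxy : x < y)
    (hyz : y < z) : HasDecreasing k (A ++ x :: z :: y :: B) ↔
      HasDecreasing k (A ++ z :: x :: y :: B) := by
  constructor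
  · rintro ⟨l, hl, hk, hp⟩
    obtain ⟨l1, l2, rfl, h1, h2⟩ := List.sublist_append_iff.1 hl
    refine ⟨l1 ++ l2, h1.append ?_, hk, hp⟩
    have hp2 := (List.pairwise_append.1 hp).2.1
    rcases List.sublist_cons_iff.1 h2 with h2 | ⟨l3, rfl, h3⟩
    · exact h2.trans (by simp)
    · rw [List.pairwise_cons] at hp2
      rcases List.sublist_cons_iff.1 h3 with h3 | ⟨l4, rfl, h4⟩
      · exact (h3.cons_cons x).trans (by simp)
      · exact absurd (hp2.1 z (by simp)) (hxy.trans hyz).not_gt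
  · rintro ⟨l, hl, hk, hp⟩
    obtain ⟨l1, l2, rfl, h1, h2⟩ := List.sublist_append_iff.1 hl
    obtain ⟨hp1, hp2, hp3⟩ := List.pairwise_append.1 hp
    rcases List.sublist_cons_iff.1 h2 with h2 | ⟨l3, rfl, h3⟩
    · exact ⟨l1 ++ l2, h1.append (h2.trans (((List.Sublist.refl _).cons z).cons_cons x)), hk, hp⟩
    · rw [List.pairwise_cons] at hp2
      rcases List.sublist_cons_iff.1 h3 with h3 | ⟨l4, rfl, h4⟩
      · exact ⟨l1 ++ z :: l3, h1.append ((h3.cons_cons z).cons x), hk, hp⟩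
      · rw [List.pairwise_cons] at hp2
        rcases List.sublist_cons_iff.1 h4 with h4 | ⟨l5, rfl, h5⟩
        · refine ⟨l1 ++ z :: y :: l4, h1.append (((h4.cons_cons y).cons_cons z).cons x),
            by simpa using hk, ?_⟩
          simp only [List.pairwise_append, List.pairwise_cons, List.mem_cons,
            forall_eq_or_imp] at hp ⊢
          refine ⟨hp1, ⟨⟨hyz, fun a ha => hp2.1 a (by simp [ha])⟩,
            fun a ha => (hp2.2.1 a ha).trans hxy, hp2.2.2⟩, fun a ha => ?_⟩
          have := hp.2.2 a ha
          exact ⟨this.1, hyz.trans this.1, this.2.2⟩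
        · exact absurd (hp2.2.1 y (by simp)) hxy.not_gt

/-- Only a subword using `z` and then `x` on the right is lost on the left. It cannot use `y`, which
precedes `z` and is smaller, so `z` may be replaced by `y`: the earlier letters are above `z > y`.
-/
theorem hasDecreasing_of_knuthStep_snd {k : ℕ} {A B : List α} {x y z : α} (hxy : x < y)
    (hyz : y < z) : HasDecreasing k (A ++ y :: x :: z :: B) ↔
      HasDecreasing k (A ++ y :: z :: x :: B) := by
  constructor
  · rintro ⟨l, hl, hk, hp⟩
    obtain ⟨l1, l2, rfl, h1, h2⟩ := List.sublist_append_iff.1 hl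
    refine ⟨l1 ++ l2, h1.append ?_, hk, hp⟩
    have hp2 := (List.pairwise_append.1 hp).2.1
    have key : ∀ l' : List α, l'.Pairwise (· > ·) → l'.Sublist (x :: z :: B) →
        l'.Sublist (z :: x :: B) := by
      intro l' hp' h'
      rcases List.sublist_cons_iff.1 h' with h' | ⟨l3, rfl, h3⟩
      · exact h'.trans (by simp)
      · rw [List.pairwise_cons] at hp'
        rcases List.sublist_cons_iff.1 h3 with h3 | ⟨l4, rfl, h4⟩
        · exact (h3.cons_cons x).trans (by simp)
        · exact absurd (hp'.1 z (by simp)) (hxy.trans hyz).not_gt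
    rcases List.sublist_cons_iff.1 h2 with h2 | ⟨l3, rfl, h3⟩
    · exact (key _ hp2 h2).cons y
    · exact (key _ (List.pairwise_cons.1 hp2).2 h3).cons_cons y
  · rintro ⟨l, hl, hk, hp⟩
    obtain ⟨l1, l2, rfl, h1, h2⟩ := List.sublist_append_iff.1 hl
    obtain ⟨hp1, hp2, hp3⟩ := List.pairwise_append.1 hp
    rcases List.sublist_cons_iff.1 h2 with h2 | ⟨l3, rfl, h3⟩
    · rcases List.sublist_cons_iff.1 h2 with h2 | ⟨l3, rfl, h3⟩
      · exact ⟨l1 ++ l2, h1.append ((h2.trans (((List.Sublist.refl _).cons z).cons_cons x)).cons y),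
          hk, hp⟩
      · rw [List.pairwise_cons] at hp2
        rcases List.sublist_cons_iff.1 h3 with h3 | ⟨l4, rfl, h4⟩
        · exact ⟨l1 ++ z :: l3, h1.append (((h3.cons_cons z).cons x).cons y), hk, hp⟩
        · rw [List.pairwise_cons] at hp2
          refine ⟨l1 ++ y :: x :: l4, h1.append (((h4.cons z).cons_cons x).cons_cons y),
            by simpa using hk, ?_⟩
          simp only [List.pairwise_append, List.pairwise_cons, List.mem_cons,
            forall_eq_or_imp] at hp ⊢
          refine ⟨hp1, ⟨⟨hxy, fun a ha => (hp2.2.1 a ha).trans hxy⟩, hp2.2⟩, fun a ha => ?_⟩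
          have := hp.2.2 a ha
          exact ⟨hyz.trans this.1, this.2⟩
    · rw [List.pairwise_cons] at hp2
      rcases List.sublist_cons_iff.1 h3 with h3 | ⟨l4, rfl, h4⟩
      · exact ⟨l1 ++ y :: l3,
          h1.append ((h3.trans (((List.Sublist.refl _).cons z).cons_cons x)).cons_cons y), hk, hp⟩
      · exact absurd (hp2.1 z (by simp)) hyz.not_gt

theorem KnuthEquiv.hasDecreasing_iff {k : ℕ} {v w : List α} (h : KnuthEquiv v w) :
    HasDecreasing k v ↔ HasDecreasing k w := by
  induction h with
  | rel _ _ h =>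
    cases h with
    | fst A B h h' => exact hasDecreasing_of_knuthStep_fst h h'
    | snd A B h h' => exact hasDecreasing_of_knuthStep_snd h h'
  | refl _ => rfl
  | symm _ _ _ ih => exact ih.symm
  | trans _ _ _ _ _ ih ih' => exact ih.trans ih'

/-! ### Reading words -/

/-- The inserted letter `x` travels left past the entries larger than `y`, by the relation `y x b ~
y b x` for `x < y < b`. -/
theorem knuthEquiv_cons_append_singleton {x y : α} {B : List α} (hB : (y :: B).Pairwise (· < ·))
    (hx : x < y) : KnuthEquiv (y :: (B ++ [x])) (y :: x :: B) := by
  induction B generalizing y with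
  | nil => exact .refl _
  | cons b B ih =>
    rw [List.pairwise_cons] at hB
    have hyb := hB.1 b (by simp)
    exact ((ih hB.2 (hx.trans hyb)).cons y).trans (KnuthStep.snd [] B hx hyb).equiv.symm

/-- The bumped letter `y` travels left to the front of the row, by the relation `a y b ~ y a b` for
`a < b < y`. -/
theorem knuthEquiv_append_cons_cons {x y : α} {A : List α} (C : List α)
    (hA : (A ++ [x]).Pairwise (· < ·)) (hx : x < y) :
    KnuthEquiv (A ++ y :: x :: C) (y :: (A ++ x :: C)) := by
  induction A with
  | nil => exact .refl _
  | cons a A ih =>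
    rw [List.cons_append, List.pairwise_cons] at hA
    refine ((ih hA.2).cons a).trans ?_
    cases A with
    | nil => exact (KnuthStep.fst [] C (hA.1 x (by simp)) hx).equiv
    | cons b A =>
      have hbx : b < x := (List.pairwise_cons.1 hA.2).1 x (by simp)
      exact (KnuthStep.fst [] (A ++ x :: C) (hA.1 b (by simp)) (hbx.trans hx)).equiv

theorem knuthEquiv_rowInsert {x y : α} {r q : List α} (hr : r.Pairwise (· < ·)) (hx : x ∉ r)
    (h : rowInsert x r = (q, some y)) : KnuthEquiv (r ++ [x]) (y :: q) := by
  have hq := pairwise_rowInsert hr hx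
  rw [h] at hq
  obtain ⟨A, B, rfl, rfl, -, hxy⟩ := rowInsert_some h
  rw [List.append_assoc]
  refine ((knuthEquiv_cons_append_singleton (List.pairwise_append.1 hr).2.1 hxy).append_left
    A).trans (knuthEquiv_append_cons_cons B (hq.sublist ?_) hxy)
  simp

/-- The rows from the last to the first one, read from left to right. -/
def readingWord : List (List α) → List α
  | [] => []
  | r :: rs => readingWord rs ++ r

theorem readingWord_perm (rows : List (List α)) : (readingWord rows).Perm rows.flatten := by
  induction rows with
  | nil => simp [readingWord]
  | cons r rs ih => exact List.perm_append_comm.trans (ih.append_left r)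

/-- In the reading word the rows below precede a row. A bumped letter arriving in front of its row
is therefore at the end of the word of the rows below, where it is inserted next. -/
theorem knuthEquiv_rskInsert {x : α} {rows : List (List α)} (h : IsTab rows)
    (hn : (x :: rows.flatten).Nodup) :
    KnuthEquiv (readingWord rows ++ [x]) (readingWord (rskInsert x rows)) := by
  induction rows generalizing x with
  | nil => exact .refl _
  | cons r rs ih =>
    rcases e : rowInsert x r with ⟨q, _ | y⟩
    · rw [rskInsert_cons_none e, (rowInsert_none e).1, readingWord, readingWord, List.append_assoc]
      exact .refl _
    · rw [rskInsert_cons_some e, readingWord, readingWord, List.append_assoc]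
      have hx : x ∉ r := fun hx => (List.nodup_cons.1 hn).1 (by simp [hx])
      refine ((knuthEquiv_rowInsert h.2.1 hx e).append_left _).trans ?_
      rw [List.append_cons]
      refine (ih h.2.2.2 ?_).append_right q
      obtain ⟨A, B, rfl, rfl, -⟩ := rowInsert_some e
      refine (List.nodup_cons.1 hn).2.sublist ?_
      simp only [List.flatten_cons, List.append_assoc, List.cons_append]
      exact (((List.sublist_append_right B _).cons_cons y).trans (List.sublist_append_right A _))

theorem Appends.readingWord_filter {x : α} {rows rows' : List (List α)}
    (h : Appends x rows rows') (hx : ∀ a ∈ rows.flatten, a < x) :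
    (readingWord rows').filter (· < x) = readingWord rows := by
  have key : ∀ l : List α, (∀ a ∈ l, a < x) → l.filter (· < x) = l :=
    fun l hl => List.filter_eq_self.2 fun a ha => by simpa using hl a ha
  have key' (rs : List (List α)) (h : ∀ a ∈ rs.flatten, a < x) :=
    key (readingWord rs) fun a ha => h a ((readingWord_perm rs).subset ha)
  induction h with
  | new => simp [readingWord]
  | here r rs =>
    simp only [List.flatten_cons, List.mem_append] at hx
    simp [readingWord, key r fun a ha => hx a (.inl ha), key' rs fun a ha => hx a (.inr ha)]
  | there r h ih =>
    simp only [List.flatten_cons, List.mem_append] at hx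
    rw [readingWord, List.filter_append, ih fun a ha => hx a (.inr ha),
      key r fun a ha => hx a (.inl ha), readingWord]

/-- Every row is increasing and contributes at most one letter to a decreasing subword; the first
column, read upwards, attains one letter per row. -/
theorem hasDecreasing_readingWord {rows : List (List α)} (h : IsTab rows) {k : ℕ} :
    HasDecreasing k (readingWord rows) ↔ k ≤ rows.length := by
  constructor
  · rintro ⟨l, hl, rfl, hp⟩
    induction rows generalizing l with
    | nil => simp [readingWord] at hl; simp [hl]
    | cons r rs ih =>
      obtain ⟨l1, l2, rfl, h1, h2⟩ := List.sublist_append_iff.1 hl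
      have hp' := List.pairwise_append.1 hp
      have h3 := ih h.2.2.2 l1 h1 hp'.1
      have h4 : l2.length ≤ 1 := by
        have h5 := h.2.1.sublist h2
        match l2, h5, hp'.2.1 with
        | [], _, _ => simp
        | [a], _, _ => simp
        | a :: b :: l, h5, h6 =>
          rw [List.pairwise_cons] at h5 h6
          exact absurd (h5.1 b (by simp)) (h6.1 b (by simp)).not_gt
      simp only [List.length_append, List.length_cons]
      omega
  · intro hk
    -- The last clause is the induction hypothesis needed to see that the head of the next higher
    -- row is smaller than all letters chosen so far.
    suffices ∃ l : List α, l.Sublist (readingWord rows) ∧ l.length = rows.length ∧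
        l.Pairwise (· > ·) ∧ ∀ b ∈ l, ∃ a ∈ rows.headD [], a ≤ b by
      obtain ⟨l, h1, h2, h3, -⟩ := this
      exact ⟨l.take k, (List.take_sublist k l).trans h1, by simp; omega,
        h3.sublist (List.take_sublist k l)⟩
    clear hk
    induction rows with
    | nil => exact ⟨[], by simp [readingWord]⟩
    | cons r rs ih =>
      obtain ⟨l, h1, h2, h3, h4⟩ := ih h.2.2.2
      obtain ⟨a, r, rfl⟩ := List.exists_cons_of_ne_nil h.1
      have hl : ∀ b ∈ l, a < b := by
        intro b hb
        obtain ⟨c, hc, hcb⟩ := h4 b hb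
        obtain ⟨d, hd, hdc⟩ := h.2.2.1.exists_lt hc
        refine lt_of_lt_of_le (lt_of_le_of_lt ?_ hdc) hcb
        rcases List.mem_cons.1 hd with rfl | hd
        · exact le_rfl
        · exact ((List.pairwise_cons.1 h.2.1).1 d hd).le
      refine ⟨l ++ [a], h1.append (by simp), by simp [h2], ?_, ?_⟩
      · simp only [List.pairwise_append, h3, List.pairwise_singleton, List.mem_singleton, forall_eq,
          true_and]
        exact hl
      · intro b hb
        refine ⟨a, by simp, ?_⟩
        simp only [List.mem_append, List.mem_singleton] at hb
        rcases hb with hb | rfl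
        · exact (hl b hb).le
        · exact le_rfl

end Knuth

/-! ### Tableaux and their shapes -/

namespace Tableau

variable {α : Type*} [LinearOrder α]

theorem isTab (T : Tableau α) : IsTab T.rows := by
  obtain ⟨rows, h1, h2, h3, h4, hn⟩ := T
  change IsTab rows
  clear hn
  induction rows with
  | nil => trivial
  | cons r rs ih =>
    rw [List.map_cons, List.sortedGE_iff_pairwise, List.pairwise_cons] at h2
    rw [List.pairwise_cons] at h4
    refine ⟨h1 r (by simp), h3 r (by simp), ?_, ih (fun r hr => h1 r (by simp [hr]))
      (List.sortedGE_iff_pairwise.2 h2.2) (fun r hr => h3 r (by simp [hr])) h4.2⟩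
    cases rs with
    | nil => simp
    | cons s rs =>
      exact rowAbove_iff.2 ⟨h2.1 _ (by simp), h4.1 s (by simp)⟩

theorem pairwise_rowAbove {rows : List (List α)} (h : IsTab rows) : rows.Pairwise RowAbove := by
  have : IsTrans (List α) RowAbove := ⟨fun _ _ _ => RowAbove.trans⟩
  rw [← List.isChain_iff_pairwise]
  induction rows with
  | nil => simp
  | cons r rs ih =>
    cases rs with
    | nil => simp
    | cons s rs => exact List.isChain_cons_cons.2 ⟨h.2.2.1, ih h.2.2.2⟩

/-- The tableau with the given rows. -/
def ofRows (rows : List (List α)) (h : IsTab rows) (hn : rows.flatten.Nodup) : Tableau α where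
  rows := rows
  rows_ne_nil := by
    intro r hr
    induction rows with
    | nil => simp at hr
    | cons s rs ih =>
      rcases List.mem_cons.1 hr with rfl | hr
      · exact h.1
      · exact ih h.2.2.2 (List.nodup_append'.1 hn).2.1 hr
  lengths := by
    rw [List.sortedGE_iff_pairwise, List.pairwise_map]
    exact (pairwise_rowAbove h).imp fun h => h.length_le
  row_lt := by
    intro r hr
    induction rows with
    | nil => simp at hr
    | cons s rs ih =>
      rcases List.mem_cons.1 hr with rfl | hr
      · exact h.2.1
      · exact ih h.2.2.2 (List.nodup_append'.1 hn).2.1 hr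
  col_lt := (pairwise_rowAbove h).imp fun h => (rowAbove_iff.1 h).2
  nodup := hn

@[simp] theorem rows_ofRows (rows : List (List α)) (h : IsTab rows) (hn : rows.flatten.Nodup) :
    (ofRows rows h hn).rows = rows := rfl

theorem mem_shape {T : Tableau α} {c : ℕ × ℕ} : c ∈ T.shape ↔ c.2 < lens T.rows c.1 := by
  rw [shape, YoungDiagram.mem_ofRowLens, lens, List.getD_eq_getElem?_getD]
  by_cases h : c.1 < T.rows.length <;> simp [h]

theorem rowLen_shape (T : Tableau α) : T.shape.rowLen = lens T.rows := by
  ext i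
  refine eq_of_forall_lt_iff fun j => ?_
  rw [← YoungDiagram.mem_iff_lt_rowLen, mem_shape]

theorem length_rowLens_shape (T : Tableau α) : T.shape.rowLens.length = T.rows.length := by
  rw [shape, YoungDiagram.rowLens_length_ofRowLens, List.length_map]
  intro l hl
  obtain ⟨r, hr, rfl⟩ := List.mem_map.1 hl
  exact List.length_pos_of_ne_nil (T.rows_ne_nil r hr)

theorem shape_eq_iff {T : Tableau α} {μ : YoungDiagram} :
    T.shape = μ ↔ lens T.rows = μ.rowLen := by
  rw [← rowLen_shape]
  refine ⟨fun h => by rw [h], fun h => ?_⟩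
  ext ⟨i, j⟩
  rw [YoungDiagram.mem_cells, YoungDiagram.mem_cells, YoungDiagram.mem_iff_lt_rowLen,
    YoungDiagram.mem_iff_lt_rowLen, h]

theorem shape_eq_bot_iff {T : Tableau α} : T.shape = ⊥ ↔ T.rows = [] := by
  rw [shape_eq_iff]
  have h (i : ℕ) : (⊥ : YoungDiagram).rowLen i = 0 := by
    by_contra hi
    exact YoungDiagram.notMem_bot _ (YoungDiagram.mem_iff_lt_rowLen.2 (Nat.pos_of_ne_zero hi))
  constructor
  · intro e
    exact lens_eq_zero T.isTab (by rw [e, h])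
  · intro e
    ext i
    simp [e, h]

end Tableau

theorem YoungDiagram.addsBox_iff {μ ν : YoungDiagram} :
    (μ ≤ ν ∧ ν.card = μ.card + 1) ↔ AddsBox μ.rowLen ν.rowLen := by
  constructor
  · rintro ⟨h1, h2⟩
    have hs := YoungDiagram.cells_subset_iff.2 h1
    have h3 : (ν.cells \ μ.cells).card = 1 := by
      rw [Finset.card_sdiff_of_subset hs]
      change ν.card - μ.card = 1
      omega
    obtain ⟨⟨k, l⟩, hc⟩ := Finset.card_eq_one.1 h3
    have key (i j : ℕ) : j < ν.rowLen i ↔ j < μ.rowLen i ∨ (i = k ∧ j = l) := by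
      have h4 := Finset.ext_iff.1 hc (i, j)
      have h5 := @hs (i, j)
      simp only [Finset.mem_sdiff, Finset.mem_singleton, Prod.mk.injEq, YoungDiagram.mem_cells,
        YoungDiagram.mem_iff_lt_rowLen] at h4 h5
      tauto
    refine ⟨k, fun i => ?_⟩
    split
    · subst i
      have hl : ¬ l < μ.rowLen k := by
        have := (Finset.mem_sdiff.1 (hc.symm ▸ Finset.mem_singleton_self (k, l))).2
        rwa [YoungDiagram.mem_cells, YoungDiagram.mem_iff_lt_rowLen] at this
      have hl' : l < ν.rowLen k := (key k l).2 (.inr ⟨rfl, rfl⟩)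
      -- Both the first column beyond row `k` of `μ` and the last column of row `k` of `ν` must be
      -- the column `l` of the new square.
      have h6 := key k (μ.rowLen k)
      have h7 := key k (ν.rowLen k - 1)
      omega
    · refine eq_of_forall_lt_iff fun j => ?_
      simp [*]
  · rintro ⟨k, hk⟩
    have hc : ν.cells = insert (k, μ.rowLen k) μ.cells := by
      ext ⟨i, j⟩
      simp only [Finset.mem_insert, Prod.mk.injEq, YoungDiagram.mem_cells,
        YoungDiagram.mem_iff_lt_rowLen, hk i]
      split
      · subst i; omega
      · simp [*]
    refine ⟨YoungDiagram.cells_subset_iff.1 (hc ▸ Finset.subset_insert _ _), ?_⟩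
    change ν.cells.card = μ.cells.card + 1
    rw [hc, Finset.card_insert_of_notMem]
    simp [YoungDiagram.mem_iff_lt_rowLen]

theorem YoungDiagram.antitone_rowLen (μ : YoungDiagram) : Antitone μ.rowLen :=
  fun _ _ h => μ.rowLen_anti _ _ h

theorem Move.rel_inj {a b : Move} {μ ν : YoungDiagram} (ha : a.Rel μ ν) (hb : b.Rel μ ν) :
    a = b := by
  cases a <;> cases b <;> simp only [Move.Rel] at ha hb ⊢ <;>
    first
    | (subst ha; omega)
    | (subst hb; omega)
    | omega

/-! ### The two moves on tableaux: existence and uniqueness in both directions -/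

section Entries

variable {α : Type*} [LinearOrder α]

/-- The entry in row `c.1` and column `c.2`. -/
def entryAt (rows : List (List α)) (c : ℕ × ℕ) : Option α := rows[c.1]?.bind fun r => r[c.2]?

theorem entryAt_eq_none_iff {rows : List (List α)} {c : ℕ × ℕ} :
    entryAt rows c = none ↔ ¬ c.2 < lens rows c.1 := by
  rw [entryAt, lens, List.getD_eq_getElem?_getD]
  rcases h : rows[c.1]? with _ | r <;> simp

/-- The rows have to be nonempty because entries do not detect empty rows at the end. -/
theorem ext_entryAt {rows rows' : List (List α)} (h : ∀ r ∈ rows, r ≠ []) (h' : ∀ r ∈ rows', r ≠ [])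
    (e : ∀ c, entryAt rows c = entryAt rows' c) : rows = rows' := by
  induction rows generalizing rows' with
  | nil =>
    cases rows' with
    | nil => rfl
    | cons r rs =>
      have := e (0, 0)
      simp [entryAt] at this
      exact absurd this (h' r (by simp))
  | cons r rs ih =>
    cases rows' with
    | nil =>
      have := e (0, 0)
      simp [entryAt] at this
      exact absurd this (h r (by simp))
    | cons r' rs' =>
      rw [List.cons.injEq]
      refine ⟨List.ext_getElem? fun j => by simpa [entryAt] using e (0, j),
        ih (fun r hr => h r (by simp [hr])) (fun r hr => h' r (by simp [hr])) fun c => ?_⟩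
      simpa [entryAt] using e (c.1 + 1, c.2)

theorem Appends.entryAt {x : α} {rows rows' : List (List α)} (h : Appends x rows rows') :
    (∀ c, c.2 < lens rows c.1 → entryAt rows' c = entryAt rows c) ∧
      ∀ c, c.2 < lens rows' c.1 → ¬ c.2 < lens rows c.1 → entryAt rows' c = some x := by
  induction h with
  | new =>
    refine ⟨by simp, ?_⟩
    rintro ⟨i, j⟩ h -
    cases i with
    | zero => simp at h; simp [_root_.entryAt, h]
    | succ i => simp at h
  | here r rs =>
    constructor
    · rintro ⟨i, j⟩ h
      cases i with
      | zero => simp at h; simp [_root_.entryAt, List.getElem?_append_left h]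
      | succ i => simp [_root_.entryAt]
    · rintro ⟨i, j⟩ h h'
      cases i with
      | zero =>
        simp at h h'
        obtain rfl : j = r.length := by omega
        simp [_root_.entryAt]
      | succ i => simp at h h'; omega
  | there r h ih =>
    constructor
    · rintro ⟨i, j⟩ h
      cases i with
      | zero => simp [_root_.entryAt]
      | succ i => simpa [_root_.entryAt] using ih.1 (i, j) (by simpa using h)
    · rintro ⟨i, j⟩ h h'
      cases i with
      | zero => simp at h h'; omega
      | succ i =>
        simpa [_root_.entryAt] using ih.2 (i, j) (by simpa using h) (by simpa using h')

theorem Tableau.isAddition_of_appends {T T' : Tableau α} {x : α} (h : Appends x T.rows T'.rows) :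
    T.IsAddition T' x := by
  refine ⟨fun c hc => h.entryAt.1 c (mem_shape.1 hc), fun c hc hc' => ?_⟩
  rw [mem_shape] at hc hc'
  exact h.entryAt.2 c hc hc'

theorem Tableau.IsAddition.unique {T T₁ T₂ : Tableau α} {x : α} (h₁ : T.IsAddition T₁ x)
    (h₂ : T.IsAddition T₂ x) (h : T₁.shape = T₂.shape) : T₁ = T₂ := by
  refine Tableau.ext (ext_entryAt T₁.rows_ne_nil T₂.rows_ne_nil fun c => ?_)
  change T₁.entry c = T₂.entry c
  by_cases hc : c ∈ T.shape
  · rw [h₁.1 c hc, h₂.1 c hc]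
  · by_cases hc' : c ∈ T₁.shape
    · rw [h₁.2 c hc' hc, h₂.2 c (h ▸ hc') hc]
    · have h1 : T₁.entry c = none := entryAt_eq_none_iff.2 (mt mem_shape.2 hc')
      have h2 : T₂.entry c = none := entryAt_eq_none_iff.2 (mt mem_shape.2 (h ▸ hc'))
      rw [h1, h2]

theorem Tableau.exists_isAddition {T : Tableau α} {x : α} {ν : YoungDiagram}
    (hx : ∀ u ∈ T.rows.flatten, u < x) (hν : Move.add.Rel T.shape ν) :
    ∃ T' : Tableau α, Appends x T.rows T'.rows ∧ T'.shape = ν := by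
  have h := YoungDiagram.addsBox_iff.1 hν
  rw [rowLen_shape] at h
  obtain ⟨rows, h1, h2, h3⟩ := exists_appends T.isTab hx ν.antitone_rowLen h
  have hn : rows.flatten.Nodup := by
    rw [h1.flatten_perm.nodup_iff, List.nodup_cons]
    exact ⟨fun h => lt_irrefl _ (hx _ h), T.nodup⟩
  exact ⟨ofRows rows h2 hn, h1, shape_eq_iff.2 h3⟩

/-- An addition is determined by its shape, and one that appends `x` to a row exists for every
admissible shape. -/
theorem Tableau.IsAddition.appends {T T' : Tableau α} {x : α} (hx : ∀ u ∈ T.rows.flatten, u < x)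
    (hr : Move.add.Rel T.shape T'.shape) (h : T.IsAddition T' x) : Appends x T.rows T'.rows := by
  obtain ⟨T'', h1, h2⟩ := exists_isAddition hx hr
  rwa [← (isAddition_of_appends h1).unique h h2]

theorem Tableau.rel_add_of_appends {T T' : Tableau α} {x : α} (h : Appends x T.rows T'.rows) :
    Move.add.Rel T.shape T'.shape := by
  refine YoungDiagram.addsBox_iff.2 ?_
  rw [rowLen_shape, rowLen_shape]
  exact h.addsBox

theorem Tableau.rel_remove_of_rskInsert {T T' : Tableau α} {x : α}
    (h : T.rows = rskInsert x T'.rows) : Move.remove.Rel T.shape T'.shape := by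
  refine YoungDiagram.addsBox_iff.2 ?_
  rw [rowLen_shape, rowLen_shape, h]
  exact addsBox_rskInsert x T'.rows

theorem Tableau.exists_eq_rskInsert {T : Tableau α} {ν : YoungDiagram}
    (hν : Move.remove.Rel T.shape ν) :
    ∃ (x : α) (T' : Tableau α), T.rows = rskInsert x T'.rows ∧ T'.shape = ν := by
  have h := YoungDiagram.addsBox_iff.1 hν
  rw [rowLen_shape] at h
  obtain ⟨x, rows, h1, h2, h3⟩ := exists_rskInsert_eq T.isTab T.nodup ν.antitone_rowLen h
  have hn : rows.flatten.Nodup := by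
    have := T.nodup
    rw [← h1, (rskInsert_flatten_perm x rows).nodup_iff] at this
    exact (List.nodup_cons.1 this).2
  exact ⟨x, ofRows rows h2 hn, h1.symm, shape_eq_iff.2 h3⟩

theorem Tableau.nodup_of_eq_rskInsert {T T' : Tableau α} {x : α}
    (h : T.rows = rskInsert x T'.rows) : (x :: T'.rows.flatten).Nodup := by
  rw [← (rskInsert_flatten_perm x T'.rows).nodup_iff, ← h]
  exact T.nodup

theorem Tableau.mem_of_eq_rskInsert {T T' : Tableau α} {x : α}
    (h : T.rows = rskInsert x T'.rows) {u : α} :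
    u ∈ T.rows.flatten ↔ u = x ∨ u ∈ T'.rows.flatten := by
  rw [h, (rskInsert_flatten_perm x T'.rows).mem_iff, List.mem_cons]

theorem Appends.mem {x : α} {rows rows' : List (List α)} (h : Appends x rows rows') {u : α} :
    u ∈ rows'.flatten ↔ u = x ∨ u ∈ rows.flatten := by
  rw [h.flatten_perm.mem_iff, List.mem_cons]

theorem Tableau.rskInsert_unique {T T₁ T₂ : Tableau α} {x₁ x₂ : α}
    (h₁ : T.rows = rskInsert x₁ T₁.rows) (h₂ : T.rows = rskInsert x₂ T₂.rows)
    (h : T₁.shape = T₂.shape) : x₁ = x₂ ∧ T₁ = T₂ := by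
  rw [shape_eq_iff, rowLen_shape] at h
  obtain ⟨h3, h4⟩ := rskInsert_inj T₁.isTab T₂.isTab h (h₁.symm.trans h₂)
  exact ⟨h3, Tableau.ext h4⟩

/-- Removing the entries which are not smaller than `x`. -/
def restrictLT (x : α) (rows : List (List α)) : List (List α) :=
  (rows.map (List.filter (· < x))).filter (· ≠ [])

theorem restrictLT_eq_self {x : α} {rows : List (List α)} (h : ∀ r ∈ rows, r ≠ [])
    (hx : ∀ u ∈ rows.flatten, u < x) : restrictLT x rows = rows := by
  induction rows with
  | nil => rfl
  | cons r rs ih =>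
    simp only [List.flatten_cons, List.mem_append] at hx
    have h1 : r.filter (· < x) = r :=
      List.filter_eq_self.2 fun a ha => by simpa using hx a (.inl ha)
    have h2 := ih (fun r hr => h r (by simp [hr])) fun u hu => hx u (.inr hu)
    rw [restrictLT] at h2 ⊢
    rw [List.map_cons, h1, List.filter_cons_of_pos (by simpa using h r (by simp)), h2]

theorem Appends.restrictLT_eq {x : α} {rows rows' : List (List α)} (h : Appends x rows rows')
    (hr : ∀ r ∈ rows, r ≠ []) (hx : ∀ u ∈ rows.flatten, u < x) : restrictLT x rows' = rows := by
  induction h with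
  | new => simp [restrictLT]
  | here r rs =>
    refine Eq.trans ?_ (restrictLT_eq_self hr hx)
    simp [restrictLT]
  | there r h ih =>
    simp only [List.flatten_cons, List.mem_append] at hx
    have h1 : r.filter (· < x) = r :=
      List.filter_eq_self.2 fun a ha => by simpa using hx a (.inl ha)
    have h2 := ih (fun r hr' => hr r (by simp [hr'])) fun u hu => hx u (.inr hu)
    rw [restrictLT] at h2 ⊢
    rw [List.map_cons, h1, List.filter_cons_of_pos (by simpa using hr r (by simp)), h2]

/-- Both predecessors are the restriction of `T` to the entries below `x`. -/
theorem Tableau.appends_unique {T T₁ T₂ : Tableau α} {x : α} (h₁ : Appends x T₁.rows T.rows)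
    (h₂ : Appends x T₂.rows T.rows) (hx₁ : ∀ u ∈ T₁.rows.flatten, u < x)
    (hx₂ : ∀ u ∈ T₂.rows.flatten, u < x) : T₁ = T₂ :=
  Tableau.ext ((h₁.restrictLT_eq T₁.rows_ne_nil hx₁).symm.trans
    (h₂.restrictLT_eq T₂.rows_ne_nil hx₂))

end Entries

/-! ### Sequences built step by step under an invariant, forwards and backwards -/

theorem exists_seq_of_step {S : Type*} (Inv : ℕ → S → Prop) (R : ℕ → S → S → Prop) (N : ℕ) (s₀ : S)
    (h₀ : Inv 0 s₀) (step : ∀ h < N, ∀ s, Inv h s → ∃ s', Inv (h + 1) s' ∧ R h s s') :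
    ∃ f : ℕ → S, f 0 = s₀ ∧ (∀ h ≤ N, Inv h (f h)) ∧ ∀ h < N, R h (f h) (f (h + 1)) := by
  induction N with
  | zero => exact ⟨fun _ => s₀, rfl, fun h hh => by rwa [Nat.le_zero.1 hh], by simp⟩
  | succ N ih =>
    obtain ⟨f, h1, h2, h3⟩ := ih fun h hh => step h (hh.trans (Nat.lt_succ_self N))
    obtain ⟨s', h4, h5⟩ := step N (Nat.lt_succ_self N) (f N) (h2 N le_rfl)
    refine ⟨fun h => if h ≤ N then f h else s', by simp [h1], fun h hh => ?_, fun h hh => ?_⟩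
    · dsimp only
      split
      · exact h2 h ‹_›
      · obtain rfl : h = N + 1 := by omega
        exact h4
    · dsimp only
      rw [if_pos (Nat.lt_succ_iff.1 hh)]
      split
      · exact h3 h ‹_›
      · obtain rfl : h = N := by omega
        exact h5

theorem exists_seq_of_backward_step {S : Type*} (Inv : ℕ → S → Prop) (R : ℕ → S → S → Prop) (N : ℕ)
    (s₀ : S) (h₀ : Inv N s₀) (step : ∀ h < N, ∀ s, Inv (h + 1) s → ∃ s', Inv h s' ∧ R h s' s) :
    ∃ f : ℕ → S, f N = s₀ ∧ (∀ h ≤ N, Inv h (f h)) ∧ ∀ h < N, R h (f h) (f (h + 1)) := by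
  obtain ⟨f, h1, h2, h3⟩ := exists_seq_of_step (fun h => Inv (N - h))
    (fun h s s' => R (N - h - 1) s' s) N s₀ (by simpa using h₀) fun h hh s hs => by
      obtain ⟨s', h4, h5⟩ := step (N - h - 1) (by omega) s
        (by rwa [show N - h - 1 + 1 = N - h by omega])
      exact ⟨s', by rwa [show N - (h + 1) = N - h - 1 by omega], h5⟩
  refine ⟨fun h => f (N - h), by simpa using h1, fun h hh => ?_, fun h hh => ?_⟩
  · have := h2 (N - h) (by omega)
    rwa [show N - (N - h) = h by omega] at this
  · have := h3 (N - (h + 1)) (by omega)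
    rwa [show N - (N - (h + 1)) - 1 = h by omega, show N - (h + 1) + 1 = N - h by omega] at this

/-! ### Runs of the construction of `φ` -/

section Runs

variable {n N : ℕ}

/-- The vertices `x h` of the moves `a h` which do something are strictly increasing. -/
def IncreasingMoves (x : Fin N → HalfVertex n) (a : Fin N → Move) : Prop :=
  ∀ h h', h < h' → a h ≠ .stay → a h' ≠ .stay → x h < x h'

theorem IncreasingMoves.lt_iff {x : Fin N → HalfVertex n} {a : Fin N → Move}
    (H : IncreasingMoves x a) {h h' : Fin N} (ha : a h ≠ .stay) (ha' : a h' ≠ .stay) :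
    x h < x h' ↔ h < h' := by
  refine ⟨fun hx => ?_, fun hh => H h h' hh ha ha'⟩
  by_contra hh
  rcases (not_lt.1 hh).eq_or_lt with rfl | hh
  · exact lt_irrefl _ hx
  · exact lt_asymm hx (H _ _ hh ha' ha)

theorem IncreasingMoves.eq_of_eq {x : Fin N → HalfVertex n} {a : Fin N → Move}
    (H : IncreasingMoves x a) {h h' : Fin N} (ha : a h ≠ .stay) (ha' : a h' ≠ .stay)
    (hx : x h = x h') : h = h' := by
  rcases lt_trichotomy h h' with hh | hh | hh
  · exact absurd hx (H _ _ hh ha ha').ne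
  · exact hh
  · exact absurd hx (H _ _ hh ha' ha).ne'

/-- The sets of arcs `P` and the tableaux `T` follow the moves `a` at the vertices `x`. -/
structure IsRun (x : Fin N → HalfVertex n) (a : Fin N → Move)
    (P : ℕ → Set (HalfVertex n × HalfVertex n)) (T : ℕ → Tableau (HalfVertex n)) : Prop where
  arcs_zero : P 0 = ∅
  rows_zero : (T 0).rows = []
  act : ∀ h : Fin N, (a h).Act (x h) (P h) (T h) (P (h + 1)) (T (h + 1))
  rel : ∀ h : Fin N, (a h).Rel (T h).shape (T (h + 1)).shape

variable {x : Fin N → HalfVertex n} {a : Fin N → Move}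

theorem exists_isRun (H : IncreasingMoves x a) (sh : ℕ → YoungDiagram) (h₀ : sh 0 = ⊥)
    (hsh : ∀ h : Fin N, (a h).Rel (sh h) (sh (h + 1))) :
    ∃ P T, IsRun x a P T ∧ ∀ h ≤ N, (T h).shape = sh h := by
  let T₀ : Tableau (HalfVertex n) := .ofRows [] trivial (by simp)
  have hT₀ : T₀.rows = [] := rfl
  have key := exists_seq_of_step
    (S := Set (HalfVertex n × HalfVertex n) × Tableau (HalfVertex n))
    -- Invariant: the shape is the prescribed one, and every entry lies below all active vertices
    -- still to come, so the next added vertex is larger than all entries.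
    (fun h s => s.2.shape = sh h ∧ ∀ u ∈ s.2.rows.flatten, ∀ h' : Fin N, h ≤ h' →
      a h' ≠ .stay → u < x h')
    (fun h s s' => ∀ hh : h < N, (a ⟨h, hh⟩).Act (x ⟨h, hh⟩) s.1 s.2 s'.1 s'.2) N (∅, T₀)
    ⟨by rw [h₀]; exact Tableau.shape_eq_bot_iff.2 rfl, fun u hu => by simp [hT₀] at hu⟩ (by
    rintro h hh ⟨P, T⟩ ⟨hT, hx⟩
    have hr := hsh ⟨h, hh⟩
    simp only at hr hT hx
    rcases e : a ⟨h, hh⟩ with _ | _ | _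
    · rw [e] at hr
      refine ⟨(P, T), ⟨hT.trans hr.symm, fun u hu h' hh' => hx u hu h' (by omega)⟩, fun _ => ?_⟩
      rw [e]
      exact ⟨rfl, rfl⟩
    · rw [e, ← hT] at hr
      have he : a ⟨h, hh⟩ ≠ .stay := by simp [e]
      obtain ⟨T', h4, h5⟩ := Tableau.exists_isAddition (fun u hu => hx u hu ⟨h, hh⟩ le_rfl he) hr
      refine ⟨(P, T'), ⟨h5, fun u hu h' hh' ha' => ?_⟩, fun _ => ?_⟩
      · rcases h4.mem.1 hu with rfl | hu
        · exact H _ _ (Fin.lt_def.2 hh') he ha'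
        · exact hx u hu h' (by omega) ha'
      · rw [e]
        exact ⟨rfl, Tableau.isAddition_of_appends h4⟩
    · rw [e, ← hT] at hr
      obtain ⟨i, T', h4, h5⟩ := Tableau.exists_eq_rskInsert hr
      refine ⟨(insert (i, x ⟨h, hh⟩) P, T'), ⟨h5, fun u hu h' hh' ha' => ?_⟩, fun _ => ?_⟩
      · exact hx u ((Tableau.mem_of_eq_rskInsert h4).2 (.inr hu)) h' (by omega) ha'
      · rw [e]
        exact ⟨i, h4, rfl⟩)
  obtain ⟨f, h1, h2, h3⟩ := key
  refine ⟨fun h => (f h).1, fun h => (f h).2, ⟨by simp [h1], by simp [h1, hT₀], fun h => ?_,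
    fun h => ?_⟩, fun h hh => (h2 h hh).1⟩
  · exact h3 h h.2 h.2
  · rw [(h2 h h.2.le).1, (h2 (h + 1) h.2).1]
    exact hsh h

/-- Given the shapes, each move is deterministic forwards: an addition by its shape, a removal by
the uniqueness of reverse RSK. -/
theorem IsRun.unique {P P' : ℕ → Set (HalfVertex n × HalfVertex n)}
    {T T' : ℕ → Tableau (HalfVertex n)} (hR : IsRun x a P T) (hR' : IsRun x a P' T')
    (hs : ∀ h ≤ N, (T h).shape = (T' h).shape) : ∀ h ≤ N, P h = P' h ∧ T h = T' h := by
  intro h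
  induction h with
  | zero =>
    exact fun _ => ⟨hR.arcs_zero.trans hR'.arcs_zero.symm,
      Tableau.ext (hR.rows_zero.trans hR'.rows_zero.symm)⟩
  | succ h ih =>
    intro hh
    obtain ⟨h1, h2⟩ := ih (by omega)
    have ha := hR.act ⟨h, hh⟩
    have ha' := hR'.act ⟨h, hh⟩
    have hs := hs _ hh
    simp only [← h1, ← h2] at ha ha'
    rcases e : a ⟨h, hh⟩ with _ | _ | _ <;> rw [e] at ha ha'
    · exact ⟨ha.1.trans ha'.1.symm, ha.2.trans ha'.2.symm⟩
    · exact ⟨ha.1.trans ha'.1.symm, ha.2.unique ha'.2 hs⟩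
    · obtain ⟨i, h3, h4⟩ := ha
      obtain ⟨i', h3', h4'⟩ := ha'
      obtain ⟨rfl, h5⟩ := Tableau.rskInsert_unique h3 h3' hs
      exact ⟨h4.trans h4'.symm, h5⟩

variable {P : ℕ → Set (HalfVertex n × HalfVertex n)} {T : ℕ → Tableau (HalfVertex n)}

theorem IsRun.exists_of_mem (H : IncreasingMoves x a) (hR : IsRun x a P T) {h : ℕ} (hh : h ≤ N)
    {u : HalfVertex n} (hu : u ∈ (T h).rows.flatten) : ∃ h' : Fin N, h' < h ∧ a h' = .add ∧
      x h' = u := by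
  induction h generalizing u with
  | zero => simp [hR.rows_zero] at hu
  | succ h ih =>
    have ha := hR.act ⟨h, hh⟩
    have hr := hR.rel ⟨h, hh⟩
    have key : u ∈ (T h).rows.flatten → ∃ h' : Fin N, h' < h + 1 ∧ a h' = .add ∧ x h' = u := by
      intro hu
      obtain ⟨h', h1, h2⟩ := ih (by omega) hu
      exact ⟨h', by omega, h2⟩
    rcases e : a ⟨h, hh⟩ with _ | _ | _ <;> rw [e] at ha hr
    · exact key (by rw [← ha.2]; exact hu)
    · have hx : ∀ u ∈ (T h).rows.flatten, u < x ⟨h, hh⟩ := by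
        intro u hu
        obtain ⟨h', h1, h2, rfl⟩ := ih (by omega) hu
        exact H _ _ h1 (by simp [h2]) (by simp [e])
      rcases (ha.2.appends hx hr).mem.1 hu with rfl | hu
      · exact ⟨⟨h, hh⟩, by simp, e, rfl⟩
      · exact key hu
    · obtain ⟨i, h3, -⟩ := ha
      exact key ((Tableau.mem_of_eq_rskInsert h3).2 (.inr hu))

theorem IsRun.lt_of_mem (H : IncreasingMoves x a) (hR : IsRun x a P T) {h : ℕ} (hh : h ≤ N)
    {u : HalfVertex n} (hu : u ∈ (T h).rows.flatten) {h' : Fin N} (hh' : h ≤ h')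
    (ha : a h' ≠ .stay) : u < x h' := by
  obtain ⟨h1, h2, h3, rfl⟩ := hR.exists_of_mem H hh hu
  exact H _ _ (Fin.lt_def.2 (by omega)) (by simp [h3]) ha

theorem IsRun.appends (H : IncreasingMoves x a) (hR : IsRun x a P T) {h : Fin N}
    (ha : a h = .add) : Appends (x h) (T h).rows (T (h + 1)).rows := by
  have h1 := hR.act h
  have h2 := hR.rel h
  rw [ha] at h1 h2
  exact h1.2.appends (fun u hu => hR.lt_of_mem H h.2.le hu le_rfl (by simp [ha])) h2

theorem IsRun.monotone_arcs (hR : IsRun x a P T) {h h' : ℕ} (hh : h ≤ h') (hh' : h' ≤ N) :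
    P h ⊆ P h' := by
  induction h', hh using Nat.le_induction with
  | base => exact subset_rfl
  | succ k hk ih =>
    refine (ih (by omega)).trans ?_
    have ha := hR.act ⟨k, hh'⟩
    rcases e : a ⟨k, hh'⟩ with _ | _ | _ <;> rw [e] at ha
    · exact ha.1.ge
    · exact ha.1.ge
    · obtain ⟨i, -, h3⟩ := ha
      simp only at h3
      rw [h3]
      exact Set.subset_insert _ _

/-- The arcs of the partial matching given by an involution. -/
def arcsOf (m : HalfVertex n → HalfVertex n) : Set (HalfVertex n × HalfVertex n) :=
  {p | p.1 < p.2 ∧ m p.1 = p.2}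

theorem eq_of_arcsOf_eq {m m' : HalfVertex n → HalfVertex n} (hm : Function.Involutive m)
    (hm' : Function.Involutive m') (h : arcsOf m = arcsOf m') : m = m' := by
  have key : ∀ {m m' : HalfVertex n → HalfVertex n}, Function.Involutive m →
      Function.Involutive m' → arcsOf m = arcsOf m' → ∀ z, m z ≠ z → m' z = m z := by
    intro m m' hm hm' h z hz
    rcases lt_or_gt_of_ne hz with hlt | hlt
    · have h1 : (m z, z) ∈ arcsOf m := ⟨hlt, hm z⟩
      rw [h] at h1
      have h2 : m' (m z) = z := h1.2
      rw [← hm' (m z), h2]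
    · have h1 : (z, m z) ∈ arcsOf m := ⟨hlt, rfl⟩
      rw [h] at h1
      exact h1.2
  ext1 z
  by_cases hz : m z = z
  · by_cases hz' : m' z = z
    · rw [hz, hz']
    · exact key hm' hm h.symm z hz'
  · exact (key hm hm' h z hz).symm

/-- Matching the unmatched half-vertices `x` and `y`. -/
def joinEnds (m : HalfVertex n → HalfVertex n) (x y z : HalfVertex n) : HalfVertex n :=
  if z = x then y else if z = y then x else m z

section JoinEnds

variable {m : HalfVertex n → HalfVertex n} {x y z : HalfVertex n}

theorem joinEnds_left : joinEnds m x y x = y := if_pos rfl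

theorem joinEnds_right : joinEnds m x y y = x := by
  rw [joinEnds, if_pos rfl, ite_eq_right_iff]
  exact id

theorem joinEnds_of_ne (hx : z ≠ x) (hy : z ≠ y) : joinEnds m x y z = m z := by
  rw [joinEnds, if_neg hx, if_neg hy]

theorem joinEnds_involutive (hm : Function.Involutive m) (hx : m x = x) (hy : m y = y) :
    Function.Involutive (joinEnds m x y) := by
  intro z
  by_cases hzx : z = x
  · rw [hzx, joinEnds_left, joinEnds_right]
  by_cases hzy : z = y
  · rw [hzy, joinEnds_right, joinEnds_left]
  rw [joinEnds_of_ne hzx hzy, joinEnds_of_ne, hm]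
  · exact fun h => hzx (by rw [← hm z, h, hx])
  · exact fun h => hzy (by rw [← hm z, h, hy])

theorem arcsOf_joinEnds (hx : m x = x) (hy : m y = y) (hxy : x < y) :
    arcsOf (joinEnds m x y) = insert (x, y) (arcsOf m) := by
  ext ⟨u, v⟩
  simp only [Set.mem_insert_iff, Prod.mk.injEq, arcsOf, Set.mem_ofPred_eq]
  by_cases hux : u = x
  · subst hux
    rw [joinEnds_left, hx]
    constructor
    · rintro ⟨-, rfl⟩
      exact .inl ⟨rfl, rfl⟩
    · rintro (⟨-, rfl⟩ | ⟨h9, h10⟩)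
      · exact ⟨hxy, rfl⟩
      · exact absurd h10 h9.ne
  by_cases huy : u = y
  · subst huy
    rw [joinEnds_right, hy]
    constructor
    · rintro ⟨h9, rfl⟩
      exact absurd h9 hxy.not_gt
    · rintro (⟨h9, -⟩ | ⟨h9, h10⟩)
      · exact absurd h9 hxy.ne'
      · exact absurd h10 h9.ne
  rw [joinEnds_of_ne hux huy]
  simp [hux]

end JoinEnds

/-- The moves `a` at the vertices `x` are the ones required by the involution `m`. -/
structure Follows (x : Fin N → HalfVertex n) (a : Fin N → Move)
    (m : HalfVertex n → HalfVertex n) : Prop where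
  involutive : Function.Involutive m
  ne_iff : ∀ z, m z ≠ z ↔ ∃ h, a h ≠ .stay ∧ x h = z
  add : ∀ h, a h = .add → x h < m (x h)
  remove : ∀ h, a h = .remove → m (x h) < x h

theorem IsRun.exists_follows (H : IncreasingMoves x a) (hR : IsRun x a P T)
    (hT : (T N).rows = []) : ∃ m, Follows x a m ∧ P N = arcsOf m := by
  -- At time `h`, the involution `m` matches the ends of the arcs closed so far. The entries of the
  -- tableau are left ends still waiting and hence fixed by `m`; when the tableau is empty at the
  -- end, none is left.
  suffices key : ∀ h ≤ N, ∃ m : HalfVertex n → HalfVertex n, Function.Involutive m ∧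
      P h = arcsOf m ∧ (∀ u ∈ (T h).rows.flatten, m u = u) ∧
      (∀ h' : Fin N, h' < h → a h' = .add → x h' ∈ (T h).rows.flatten ∨ x h' < m (x h')) ∧
      (∀ h' : Fin N, h' < h → a h' = .remove → m (x h') < x h') ∧
      ∀ z, m z ≠ z → ∃ h' : Fin N, h' < h ∧ a h' ≠ .stay ∧ x h' = z by
    obtain ⟨m, h1, h2, -, h4, h5, h6⟩ := key N le_rfl
    have hadd : ∀ h, a h = .add → x h < m (x h) := fun h ha => by
      simpa [hT] using h4 h h.2 ha
    refine ⟨m, ⟨h1, fun z => ⟨fun hz => ?_, ?_⟩, hadd, fun h => h5 h h.2⟩, h2⟩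
    · obtain ⟨h', -, h7⟩ := h6 z hz
      exact ⟨h', h7⟩
    · rintro ⟨h, ha, rfl⟩
      rcases e : a h with _ | _ | _
      · exact absurd e ha
      · exact (hadd h e).ne'
      · exact (h5 h h.2 e).ne
  intro h
  induction h with
  | zero =>
    refine fun _ => ⟨id, fun _ => rfl, ?_, by simp, by simp, by simp, by simp⟩
    rw [hR.arcs_zero]
    ext p
    simp only [Set.mem_empty_iff_false, false_iff]
    rintro ⟨h1, h2⟩
    exact h1.ne h2
  | succ h ih =>
    intro hh
    obtain ⟨m, h1, h2, h3, h4, h5, h6⟩ := ih (by omega)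
    have ha := hR.act ⟨h, hh⟩
    have hlast {h' : Fin N} (hh' : (h' : ℕ) < h + 1) : (h' : ℕ) < h ∨ h' = ⟨h, hh⟩ := by
      rcases Nat.lt_succ_iff_lt_or_eq.1 hh' with h7 | h7
      · exact .inl h7
      · exact .inr (Fin.ext h7)
    rcases e : a ⟨h, hh⟩ with _ | _ | _
    · rw [e] at ha
      obtain ⟨ha, ha'⟩ := ha
      simp only at ha ha'
      refine ⟨m, h1, by rw [ha, h2], by rwa [ha'], fun h' hh' e' => ?_, fun h' hh' e' => ?_,
        fun z hz => ?_⟩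
      · rcases hlast hh' with h7 | rfl
        · rw [ha']
          exact h4 h' h7 e'
        · simp [e] at e'
      · rcases hlast hh' with h7 | rfl
        · exact h5 h' h7 e'
        · simp [e] at e'
      · obtain ⟨h', h7, h8⟩ := h6 z hz
        exact ⟨h', by omega, h8⟩
    · have hA := hR.appends H e
      rw [e] at ha
      have ha := ha.1
      simp only at ha hA
      have hx : m (x ⟨h, hh⟩) = x ⟨h, hh⟩ := by
        by_contra hx
        obtain ⟨h', h7, h8, h9⟩ := h6 _ hx
        exact (H h' ⟨h, hh⟩ h7 h8 (by simp [e])).ne h9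
      refine ⟨m, h1, by rw [ha, h2], fun u hu => ?_, fun h' hh' e' => ?_, fun h' hh' e' => ?_,
        fun z hz => ?_⟩
      · rcases hA.mem.1 hu with rfl | hu
        · exact hx
        · exact h3 u hu
      · rcases hlast hh' with h7 | rfl
        · exact (h4 h' h7 e').imp_left fun h => hA.mem.2 (.inr h)
        · exact .inl (hA.mem.2 (.inl rfl))
      · rcases hlast hh' with h7 | rfl
        · exact h5 h' h7 e'
        · simp [e] at e'
      · obtain ⟨h', h7, h8⟩ := h6 z hz
        exact ⟨h', by omega, h8⟩
    · rw [e] at ha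
      obtain ⟨i, h7, h8⟩ := ha
      simp only at h7 h8
      have hi : i ∈ (T h).rows.flatten := (Tableau.mem_of_eq_rskInsert h7).2 (.inl rfl)
      have hix : i < x ⟨h, hh⟩ := hR.lt_of_mem H (by omega) hi le_rfl (by simp [e])
      have hmi := h3 i hi
      -- The current vertex lies beyond all vertices used so far, hence is unmatched and free to be
      -- joined to `i`.
      have hx : m (x ⟨h, hh⟩) = x ⟨h, hh⟩ := by
        by_contra hx
        obtain ⟨h', h9, h10, h11⟩ := h6 _ hx
        exact (H h' ⟨h, hh⟩ h9 h10 (by simp [e])).ne h11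
      set y := x ⟨h, hh⟩ with hy
      set m' := joinEnds m i y with hm'_def
      have hm'i : m' i = y := joinEnds_left
      have hm'y : m' y = i := joinEnds_right
      have hm' {z : HalfVertex n} (hzi : z ≠ i) (hzy : z ≠ y) : m' z = m z :=
        joinEnds_of_ne hzi hzy
      have hn := Tableau.nodup_of_eq_rskInsert h7
      refine ⟨m', joinEnds_involutive h1 hmi hx, by rw [h8, h2, arcsOf_joinEnds hmi hx hix],
        fun u hu => ?_, fun h' hh' e' => ?_, fun h' hh' e' => ?_, fun z hz => ?_⟩
      · have h9 : u ≠ i := by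
          rintro rfl
          exact (List.nodup_cons.1 hn).1 hu
        have h10 : u ∈ (T h).rows.flatten := (Tableau.mem_of_eq_rskInsert h7).2 (.inr hu)
        have h11 : u < y := hR.lt_of_mem H (by omega) h10 le_rfl (by simp [e])
        rw [hm' h9 h11.ne, h3 u h10]
      · rcases hlast hh' with h9 | rfl
        · have h10 : x h' < y := H h' ⟨h, hh⟩ h9 (by simp [e']) (by simp [e])
          by_cases h11 : x h' = i
          · right
            rw [h11, hm'i]
            exact hix
          · rw [hm' h11 h10.ne]
            refine (h4 h' h9 e').imp_left fun h12 => ?_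
            exact ((Tableau.mem_of_eq_rskInsert h7).1 h12).resolve_left h11
        · simp [e] at e'
      · rcases hlast hh' with h9 | rfl
        · have h10 : x h' < y := H h' ⟨h, hh⟩ h9 (by simp [e']) (by simp [e])
          have h12 := h5 h' h9 e'
          have h11 : x h' ≠ i := by
            intro h11
            rw [h11, hmi] at h12
            exact lt_irrefl _ h12
          rwa [hm' h11 h10.ne]
        · rw [← hy, hm'y]
          exact hix
      · by_cases hzi : z = i
        · obtain ⟨h', h9, h10, h11⟩ := hR.exists_of_mem H (by omega) hi
          exact ⟨h', by omega, by simp [h10], h11.trans hzi.symm⟩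
        by_cases hzy : z = y
        · exact ⟨⟨h, hh⟩, by simp, by simp [e], hzy.symm⟩
        rw [hm' hzi hzy] at hz
        obtain ⟨h', h9, h10⟩ := h6 z hz
        exact ⟨h', by omega, h10⟩

/-- The arc added by a removal stays until the end, so the extracted element can only be the partner
of the current vertex. -/
theorem IsRun.eq_rskInsert {m : HalfVertex n → HalfVertex n} (hm : Function.Involutive m)
    (hR : IsRun x a P T) (hP : P N = arcsOf m) {h : Fin N} (ha : a h = .remove) :
    (T h).rows = rskInsert (m (x h)) (T (h + 1)).rows := by
  have h1 := hR.act h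
  rw [ha] at h1
  obtain ⟨i, h2, h3⟩ := h1
  have h4 : (i, x h) ∈ P N := by
    refine hR.monotone_arcs h.2 le_rfl ?_
    rw [h3]
    exact Set.mem_insert _ _
  rw [hP] at h4
  have h5 : m i = x h := h4.2
  rwa [← h5, hm i]

/-- No agreement of shapes is assumed: backwards from the empty tableau, a removal is undone by
inserting a known element and an addition by deleting the largest entry. -/
theorem IsRun.backward_unique (H : IncreasingMoves x a)
    {P' : ℕ → Set (HalfVertex n × HalfVertex n)} {T' : ℕ → Tableau (HalfVertex n)}
    {m : HalfVertex n → HalfVertex n} (hm : Function.Involutive m)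
    (hR : IsRun x a P T) (hR' : IsRun x a P' T') (hP : P N = arcsOf m) (hP' : P' N = arcsOf m)
    (hT : (T N).rows = []) (hT' : (T' N).rows = []) {h : ℕ} (hh : h ≤ N) : T h = T' h := by
  induction hh using Nat.decreasingInduction with
  | self => exact Tableau.ext (hT.trans hT'.symm)
  | of_succ h hh ih =>
    rcases e : a ⟨h, hh⟩ with _ | _ | _
    · have ha := hR.act ⟨h, hh⟩
      have ha' := hR'.act ⟨h, hh⟩
      rw [e] at ha ha'
      exact ha.2.symm.trans (ih.trans ha'.2)
    · have h1 := hR.appends H e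
      have h2 := hR'.appends H e
      simp only [← ih] at h1 h2
      exact Tableau.appends_unique h1 h2
        (fun u hu => hR.lt_of_mem H hh.le hu le_rfl (by simp [e]))
        (fun u hu => hR'.lt_of_mem H hh.le hu le_rfl (by simp [e]))
    · have h1 := hR.eq_rskInsert hm hP e
      have h2 := hR'.eq_rskInsert hm hP' e
      simp only [← ih] at h1 h2
      exact Tableau.ext (h1.trans h2.symm)

end Runs

/-! ### The run of a given partial matching, built backwards -/

section Follows

variable {n N : ℕ} {x : Fin N → HalfVertex n} {a : Fin N → Move} {m : HalfVertex n → HalfVertex n}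

theorem Follows.exists_add (F : Follows x a m) {z : HalfVertex n} (hz : z < m z) :
    ∃ h, a h = .add ∧ x h = z := by
  obtain ⟨h, h1, rfl⟩ := (F.ne_iff z).1 hz.ne'
  rcases e : a h with _ | _ | _
  · exact absurd e h1
  · exact ⟨h, e, rfl⟩
  · exact absurd (F.remove h e) hz.not_gt

theorem Follows.exists_remove (F : Follows x a m) {z : HalfVertex n} (hz : m z < z) :
    ∃ h, a h = .remove ∧ x h = z := by
  obtain ⟨h, h1, rfl⟩ := (F.ne_iff z).1 hz.ne
  rcases e : a h with _ | _ | _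
  · exact absurd e h1
  · exact absurd (F.add h e) hz.not_gt
  · exact ⟨h, e, rfl⟩

/-- The arc starting in `u` is open at time `h`. -/
def IsOpenAt (x : Fin N → HalfVertex n) (a : Fin N → Move) (m : HalfVertex n → HalfVertex n)
    (h : ℕ) (u : HalfVertex n) : Prop :=
  (∃ h' : Fin N, h' < h ∧ a h' = .add ∧ x h' = u) ∧
    ∃ h' : Fin N, h ≤ h' ∧ a h' = .remove ∧ x h' = m u

theorem isOpenAt_stay {h : Fin N} (e : a h = .stay) {u : HalfVertex n} :
    IsOpenAt x a m h u ↔ IsOpenAt x a m (h + 1) u := by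
  constructor
  · rintro ⟨⟨h1, h2, h3, h4⟩, h5, h6, h7, h8⟩
    refine ⟨⟨h1, by omega, h3, h4⟩, h5, ?_, h7, h8⟩
    rcases h6.eq_or_lt with h6 | h6
    · rw [Fin.ext h6] at e; simp [e] at h7
    · exact h6
  · rintro ⟨⟨h1, h2, h3, h4⟩, h5, h6, h7, h8⟩
    refine ⟨⟨h1, ?_, h3, h4⟩, h5, by omega, h7, h8⟩
    rcases Nat.lt_succ_iff_lt_or_eq.1 h2 with h2 | h2
    · exact h2
    · rw [← Fin.ext h2] at e; simp [e] at h3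

theorem Follows.isOpenAt_add (H : IncreasingMoves x a) (F : Follows x a m) {h : Fin N}
    (e : a h = .add) {u : HalfVertex n} :
    IsOpenAt x a m (h + 1) u ↔ u = x h ∨ IsOpenAt x a m h u := by
  constructor
  · rintro ⟨⟨h1, h2, h3, h4⟩, h5, h6, h7, h8⟩
    rcases Nat.lt_succ_iff_lt_or_eq.1 h2 with h2 | h2
    · exact .inr ⟨⟨h1, h2, h3, h4⟩, h5, by omega, h7, h8⟩
    · rw [← h4, Fin.ext h2]; exact .inl rfl
  · rintro (rfl | ⟨⟨h1, h2, h3, h4⟩, h5, h6, h7, h8⟩)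
    · have h1 := F.add h e
      obtain ⟨h2, h3, h4⟩ := F.exists_remove (z := m (x h)) (by rwa [F.involutive])
      refine ⟨⟨h, by simp, e, rfl⟩, h2, ?_, h3, h4⟩
      rw [← h4, H.lt_iff (by simp [e]) (by simp [h3])] at h1
      exact h1
    · refine ⟨⟨h1, by omega, h3, h4⟩, h5, ?_, h7, h8⟩
      rcases h6.eq_or_lt with h6 | h6
      · rw [Fin.ext h6] at e; simp [e] at h7
      · exact h6

theorem Follows.isOpenAt_remove (H : IncreasingMoves x a) (F : Follows x a m) {h : Fin N}
    (e : a h = .remove) {u : HalfVertex n} :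
    IsOpenAt x a m h u ↔ u = m (x h) ∨ IsOpenAt x a m (h + 1) u := by
  constructor
  · rintro ⟨⟨h1, h2, h3, h4⟩, h5, h6, h7, h8⟩
    rcases h6.eq_or_lt with h6 | h6
    · left
      rw [Fin.ext h6, h8, F.involutive]
    · exact .inr ⟨⟨h1, by omega, h3, h4⟩, h5, h6, h7, h8⟩
  · rintro (rfl | ⟨⟨h1, h2, h3, h4⟩, h5, h6, h7, h8⟩)
    · have h1 := F.remove h e
      obtain ⟨h2, h3, h4⟩ := F.exists_add (z := m (x h)) (by rwa [F.involutive])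
      refine ⟨⟨h2, ?_, h3, h4⟩, h, le_rfl, e, by rw [F.involutive]⟩
      rw [← h4, H.lt_iff (by simp [h3]) (by simp [e])] at h1
      exact h1
    · refine ⟨⟨h1, ?_, h3, h4⟩, h5, by omega, h7, h8⟩
      rcases Nat.lt_succ_iff_lt_or_eq.1 h2 with h2 | h2
      · exact h2
      · rw [← Fin.ext h2] at e; simp [e] at h3

theorem IsOpenAt.lt (H : IncreasingMoves x a) {h : ℕ} {u : HalfVertex n}
    (hu : IsOpenAt x a m h u) {h' : Fin N} (hh : h ≤ h') (ha : a h' ≠ .stay) : u < x h' := by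
  obtain ⟨⟨h1, h2, h3, rfl⟩, -⟩ := hu
  exact H _ _ (Fin.lt_def.2 (by omega)) (by simp [h3]) ha

theorem Follows.exists_isRun (H : IncreasingMoves x a) (F : Follows x a m) :
    ∃ P T, IsRun x a P T ∧ (T N).rows = [] ∧ P N = arcsOf m := by
  let T₀ : Tableau (HalfVertex n) := .ofRows [] trivial (by simp)
  have hT₀ : T₀.rows = [] := rfl
  have hnil : ∀ rows : List (List (HalfVertex n)), (∀ r ∈ rows, r ≠ []) →
      (∀ u, u ∉ rows.flatten) → rows = [] := by
    intro rows h1 h2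
    cases rows with
    | nil => rfl
    | cons r rs =>
      obtain ⟨b, r, rfl⟩ := List.exists_cons_of_ne_nil (h1 r (by simp))
      exact absurd (by simp) (h2 b)
  have key := exists_seq_of_backward_step
    -- Invariant: the entries are exactly the left ends of the open arcs. This makes `x h` the
    -- largest entry after an addition and `m (x h)` a new one for an insertion.
    (fun h (T : Tableau (HalfVertex n)) => ∀ u, u ∈ T.rows.flatten ↔ IsOpenAt x a m h u)
    (fun h T T' => ∀ hh : h < N, (a ⟨h, hh⟩ = .stay → T' = T) ∧
      (a ⟨h, hh⟩ = .add → Appends (x ⟨h, hh⟩) T.rows T'.rows) ∧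
      (a ⟨h, hh⟩ = .remove → T.rows = rskInsert (m (x ⟨h, hh⟩)) T'.rows)) N T₀
    (by
      intro u
      simp only [hT₀, List.flatten_nil, List.not_mem_nil, false_iff]
      rintro ⟨-, h, h1, -⟩
      omega) (by
    intro h hh T hT
    rcases e : a ⟨h, hh⟩ with _ | _ | _
    · refine ⟨T, fun u => ?_, fun _ => ⟨fun _ => rfl, by simp [e], by simp [e]⟩⟩
      rw [hT, isOpenAt_stay e]
    · have hmem : x ⟨h, hh⟩ ∈ T.rows.flatten := by
        rw [hT, F.isOpenAt_add H (h := ⟨h, hh⟩) e]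
        exact .inl rfl
      obtain ⟨rows, h1, h2⟩ := exists_appends_of_max T.isTab T.nodup hmem fun u hu => by
        rw [hT, F.isOpenAt_add H (h := ⟨h, hh⟩) e] at hu
        rcases hu with rfl | hu
        · exact le_rfl
        · exact (hu.lt H le_rfl (by simp [e])).le
      have hn := T.nodup
      rw [h1.flatten_perm.nodup_iff] at hn
      refine ⟨.ofRows rows h2 (List.nodup_cons.1 hn).2, fun u => ?_,
        fun _ => ⟨by simp [e], fun _ => h1, by simp [e]⟩⟩
      have h3 := hT u
      rw [h1.mem, F.isOpenAt_add H (h := ⟨h, hh⟩) e] at h3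
      have h4 : u ∈ rows.flatten → u ≠ x ⟨h, hh⟩ := by
        rintro h5 rfl
        exact (List.nodup_cons.1 hn).1 h5
      have h5 : IsOpenAt x a m h u → u ≠ x ⟨h, hh⟩ := fun h6 =>
        (h6.lt H le_rfl (h' := ⟨h, hh⟩) (by simp [e])).ne
      rw [Tableau.rows_ofRows]
      change u = _ ∨ _ ↔ u = _ ∨ IsOpenAt x a m h u at h3
      tauto
    · have hn : (m (x ⟨h, hh⟩) :: T.rows.flatten).Nodup := by
        refine List.nodup_cons.2 ⟨fun h1 => ?_, T.nodup⟩
        rw [hT] at h1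
        obtain ⟨-, h', h2, h3, h4⟩ := h1
        rw [F.involutive] at h4
        have := congrArg Fin.val (H.eq_of_eq (by simp [h3]) (by simp [e]) h4)
        simp only at this
        omega
      refine ⟨.ofRows _ (isTab_rskInsert T.isTab hn)
        ((rskInsert_flatten_perm _ _).nodup_iff.2 hn), fun u => ?_,
        fun _ => ⟨by simp [e], by simp [e], fun _ => rfl⟩⟩
      rw [Tableau.rows_ofRows, (rskInsert_flatten_perm _ _).mem_iff, List.mem_cons, hT]
      exact (F.isOpenAt_remove H (h := ⟨h, hh⟩) e).symm)
  obtain ⟨T, h1, h2, h3⟩ := key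
  -- The arcs need no recursion: at time `h` they are the ones closed by earlier removals.
  let P : ℕ → Set (HalfVertex n × HalfVertex n) := fun h =>
    {p | ∃ h' : Fin N, h' < h ∧ a h' = .remove ∧ p = (m (x h'), x h')}
  have hP {h : Fin N} (e : a h ≠ .remove) : P (h + 1) = P h := by
    ext p
    constructor
    · rintro ⟨h', h4, h5, h6⟩
      refine ⟨h', ?_, h5, h6⟩
      rcases Nat.lt_succ_iff_lt_or_eq.1 h4 with h4 | h4
      · exact h4
      · rw [Fin.ext h4] at h5; exact absurd h5 e
    · rintro ⟨h', h4, h5, h6⟩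
      exact ⟨h', by omega, h5, h6⟩
  refine ⟨P, T, ⟨?_, ?_, fun h => ?_, fun h => ?_⟩, by rw [h1, hT₀], ?_⟩
  · ext p
    simp only [Set.mem_empty_iff_false, iff_false]
    rintro ⟨h', h4, -⟩
    omega
  · refine hnil _ (T 0).rows_ne_nil fun u hu => ?_
    rw [h2 0 (Nat.zero_le _)] at hu
    obtain ⟨⟨h', h4, -⟩, -⟩ := hu
    omega
  · obtain ⟨h4, h5, h6⟩ := h3 h h.2 h.2
    rcases e : a h with _ | _ | _
    · exact ⟨hP (by simp [e]), h4 e⟩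
    · exact ⟨hP (by simp [e]), Tableau.isAddition_of_appends (h5 e)⟩
    · refine ⟨m (x h), h6 e, ?_⟩
      ext p
      constructor
      · rintro ⟨h', h7, h8, rfl⟩
        rcases Nat.lt_succ_iff_lt_or_eq.1 h7 with h7 | h7
        · exact .inr ⟨h', h7, h8, rfl⟩
        · rw [Fin.ext h7]
          exact .inl rfl
      · rintro (rfl | ⟨h', h7, h8, h9⟩)
        · exact ⟨h, by simp, e, rfl⟩
        · exact ⟨h', by omega, h8, h9⟩
  · obtain ⟨h4, h5, h6⟩ := h3 h h.2 h.2
    rcases e : a h with _ | _ | _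
    · rw [h4 e]
      rfl
    · exact Tableau.rel_add_of_appends (h5 e)
    · exact Tableau.rel_remove_of_rskInsert (h6 e)
  · ext ⟨u, v⟩
    constructor
    · rintro ⟨h, -, h4, h5⟩
      rw [Prod.mk.injEq] at h5
      obtain ⟨rfl, rfl⟩ := h5
      exact ⟨F.remove h h4, F.involutive _⟩
    · rintro ⟨h4, h5⟩
      simp only at h4 h5
      have hv : m v = u := by rw [← h5, F.involutive]
      obtain ⟨h, h6, rfl⟩ := F.exists_remove (z := v) (by rwa [hv])
      exact ⟨h, h.2, h6, by rw [hv]⟩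

/-! ### Crossings and rows -/

/-- The partial matching given by `m` has `k` mutually crossing arcs. -/
def HasCrossing (m : HalfVertex n → HalfVertex n) (k : ℕ) : Prop :=
  ∃ l : List (HalfVertex n), l.length = k ∧ l.Pairwise (fun u v => v < u ∧ m v < m u) ∧
    ∀ u ∈ l, ∀ v ∈ l, u < m v

variable {P : ℕ → Set (HalfVertex n × HalfVertex n)} {T : ℕ → Tableau (HalfVertex n)}

/-- Backwards, a removal at `x` inserts `m x`; its arc closes before all other open arcs, so this
letter goes to the end of the word. An addition deletes the largest letter `x`, and Knuth
equivalence survives restriction to the letters below `x`. -/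
theorem IsRun.exists_word (H : IncreasingMoves x a) (F : Follows x a m) (hR : IsRun x a P T)
    (hP : P N = arcsOf m) (hT : (T N).rows = []) {h : ℕ} (hh : h ≤ N) :
    ∃ w : List (HalfVertex n), KnuthEquiv w (readingWord (T h).rows) ∧
      w.Pairwise (fun u v => m v < m u) ∧ ∀ u, u ∈ w ↔ IsOpenAt x a m h u := by
  induction hh using Nat.decreasingInduction with
  | self =>
    refine ⟨[], by rw [hT]; exact .refl _, by simp, fun u => ?_⟩
    simp only [List.not_mem_nil, false_iff]
    rintro ⟨-, h, h1, -⟩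
    omega
  | of_succ h hh ih =>
    obtain ⟨w, h1, h2, h3⟩ := ih
    rcases e : a ⟨h, hh⟩ with _ | _ | _
    · have ha := hR.act ⟨h, hh⟩
      rw [e] at ha
      refine ⟨w, by rw [← ha.2]; exact h1, h2, fun u => ?_⟩
      rw [h3, isOpenAt_stay e]
    · refine ⟨w.filter (· < x ⟨h, hh⟩), ?_, h2.sublist List.filter_sublist, fun u => ?_⟩
      · have h4 := h1.filter_lt (x ⟨h, hh⟩)
        rwa [(hR.appends H e).readingWord_filter fun u hu =>
          hR.lt_of_mem H hh.le hu le_rfl (by simp [e])] at h4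
      · have h4 := F.isOpenAt_add H e (u := u)
        rw [List.mem_filter, h3, decide_eq_true_eq]
        have h5 : IsOpenAt x a m h u → u < x ⟨h, hh⟩ := fun h6 =>
          h6.lt H le_rfl (by simp [e])
        have h6 : u < x ⟨h, hh⟩ → u ≠ x ⟨h, hh⟩ := fun h => h.ne
        change IsOpenAt x a m (h + 1) u ↔ u = _ ∨ IsOpenAt x a m h u at h4
        tauto
    · have h4 := hR.eq_rskInsert F.involutive hP e
      have h5 := Tableau.nodup_of_eq_rskInsert h4
      refine ⟨w ++ [m (x ⟨h, hh⟩)], ?_, ?_, fun u => ?_⟩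
      · simp only at h4
        rw [h4]
        exact (h1.append_right _).trans (knuthEquiv_rskInsert (T (h + 1)).isTab h5)
      · simp only [List.pairwise_append, h2, List.pairwise_singleton, List.mem_singleton, forall_eq,
          true_and, F.involutive (x ⟨h, hh⟩)]
        intro u hu
        obtain ⟨-, h', h6, h7, h8⟩ := (h3 u).1 hu
        rw [← h8, H.lt_iff (by simp [e]) (by simp [h7])]
        exact h6
      · rw [List.mem_append, h3, List.mem_singleton, or_comm]
        exact (F.isOpenAt_remove H e).symm

theorem IsRun.hasCrossing_iff (H : IncreasingMoves x a) (F : Follows x a m) (hR : IsRun x a P T)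
    (hP : P N = arcsOf m) (hT : (T N).rows = []) {k : ℕ} :
    HasCrossing m k ↔ ∃ h ≤ N, k ≤ (T h).rows.length := by
  constructor
  · rintro ⟨l, rfl, h1, h2⟩
    rcases List.eq_nil_or_concat l with rfl | ⟨l', v, rfl⟩
    · exact ⟨0, Nat.zero_le _, by simp⟩
    rw [List.concat_eq_append] at *
    set l := l' ++ [v] with hl
    have hvl : v ∈ l := by simp [hl]
    have hv : v < m v := h2 v hvl v hvl
    -- The last element `v` of the list has the smallest right end. At the time of its removal,
    -- before the arc is closed, all arcs of the list are open.
    obtain ⟨h, h3, h4⟩ := F.exists_remove (z := m v) (by rwa [F.involutive])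
    refine ⟨h, h.2.le, ?_⟩
    obtain ⟨w, h5, h6, h7⟩ := hR.exists_word H F hP hT h.2.le
    rw [← hasDecreasing_readingWord (T h).isTab, ← h5.hasDecreasing_iff]
    have h1' : l.Pairwise (fun u v => m v < m u) := h1.imp fun h => h.2
    have : Std.Antisymm (α := HalfVertex n) (fun u v => m v < m u) :=
      ⟨fun u v h h' => absurd h h'.not_gt⟩
    have hlt : l.Pairwise (· > ·) := h1.imp fun h => h.1
    -- Both `l` and the word of open left ends are sorted by decreasing right ends, so containment
    -- of letters already gives a subword.
    refine ⟨l, List.sublist_of_subperm_of_pairwise (List.subperm_of_subset ?_ ?_) h1' h6, rfl, hlt⟩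
    · exact hlt.imp fun h => h.ne'
    · intro u hu
      rw [h7]
      have hmu : m v ≤ m u := by
        rw [hl, List.mem_append, List.mem_singleton] at hu
        rcases hu with hu | rfl
        · exact ((List.pairwise_append.1 h1).2.2 u hu v (by simp)).2.le
        · exact le_rfl
      have huv := h2 u hu v hvl
      obtain ⟨h8, h9, h10⟩ := F.exists_add (huv.trans_le hmu)
      obtain ⟨h11, h12, h13⟩ := F.exists_remove (z := m u)
        (by rw [F.involutive]; exact huv.trans_le hmu)
      refine ⟨⟨h8, ?_, h9, h10⟩, h11, ?_, h12, h13⟩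
      · rw [← h10, ← h4, H.lt_iff (by simp [h9]) (by simp [h3])] at huv
        exact huv
      · by_contra! hlt
        have := (H.lt_iff (by simp [h12]) (by simp [h3])).2 (Fin.lt_def.2 hlt)
        rw [h13, h4] at this
        exact this.not_ge hmu
  · rintro ⟨h, hh, hk⟩
    obtain ⟨w, h5, h6, h7⟩ := hR.exists_word H F hP hT hh
    rw [← hasDecreasing_readingWord (T h).isTab, ← h5.hasDecreasing_iff] at hk
    obtain ⟨l, h1, h2, h3⟩ := hk
    refine ⟨l, h2, h3.and (h6.sublist h1), fun u hu v hv => ?_⟩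
    have hu' := (h7 u).1 (h1.subset hu)
    obtain ⟨-, h', h8, h9, h10⟩ := (h7 v).1 (h1.subset hv)
    rw [← h10]
    exact hu'.lt H h8 (by simp [h9])

end Follows

/-! ### Half-vertices -/

namespace HalfVertex

variable {n : ℕ}

/-- The vertex `j` to which `j` and `j'` belong. -/
def base (z : HalfVertex n) : Fin n := (ofLex z).1

@[simp] theorem base_plain (j : Fin n) : base (plain j) = j := rfl

@[simp] theorem base_prime (j : Fin n) : base (prime j) = j := rfl

theorem eq_plain_or_eq_prime (z : HalfVertex n) : z = plain (base z) ∨ z = prime (base z) := by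
  rcases h : (ofLex z).2 with _ | _
  · left
    rw [← toLex_ofLex z]
    exact congrArg toLex (Prod.ext rfl h)
  · right
    rw [← toLex_ofLex z]
    exact congrArg toLex (Prod.ext rfl h)

theorem base_eq_iff {z : HalfVertex n} {j : Fin n} : base z = j ↔ z = plain j ∨ z = prime j := by
  constructor
  · rintro rfl
    exact eq_plain_or_eq_prime z
  · rintro (rfl | rfl) <;> rfl

@[simp] theorem plain_lt_prime (j : Fin n) : plain j < prime j := by
  simp [plain, prime, Prod.Lex.toLex_lt_toLex]

@[simp] theorem plain_ne_prime (i j : Fin n) : plain i ≠ prime j := by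
  intro h
  simp [plain, prime] at h

@[simp] theorem prime_ne_plain (i j : Fin n) : prime i ≠ plain j := (plain_ne_prime j i).symm

@[simp] theorem plain_inj {i j : Fin n} : plain i = plain j ↔ i = j := by
  simp [plain]

@[simp] theorem prime_inj {i j : Fin n} : prime i = prime j ↔ i = j := by
  simp [prime]

theorem lt_of_base_lt {y z : HalfVertex n} (h : base y < base z) : y < z :=
  Prod.Lex.lt_iff.2 (.inl h)

theorem base_le_of_lt {y z : HalfVertex n} (h : y < z) : base y ≤ base z := by
  by_contra! h'
  exact (lt_of_base_lt h').not_gt h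

theorem eq_of_lt_of_base_eq {y z : HalfVertex n} (h : y < z) (h' : base y = base z) :
    y = plain (base z) ∧ z = prime (base z) := by
  rcases eq_plain_or_eq_prime y with hy | hy <;> rcases eq_plain_or_eq_prime z with hz | hz <;>
    rw [h'] at hy
  · exact absurd (hy.trans hz.symm) h.ne
  · exact ⟨hy, hz⟩
  · rw [hy] at h
    rw [hz] at h
    exact absurd h (plain_lt_prime _).not_gt
  · exact absurd (hy.trans hz.symm) h.ne

theorem filter_base_eq (j : Fin n) : Finset.univ.filter (fun z : HalfVertex n => base z = j) =
    {plain j, prime j} := by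
  ext z
  simp [base_eq_iff]

end HalfVertex

/-! ### Partial matchings of the half-vertices -/

section Pairing

variable {n : ℕ} {m : HalfVertex n → HalfVertex n}

/-- A partial matching of the half-vertices (unmatched half-vertices are fixed points), such that
`j'` is matched only if `j` is. -/
structure IsPairing (m : HalfVertex n → HalfVertex n) : Prop where
  involutive : Function.Involutive m
  plain_ne : ∀ j, m (prime j) ≠ prime j → m (plain j) ≠ plain j

/-- The arcs through `p` and `q` cross. -/
def Crosses (m : HalfVertex n → HalfVertex n) (p q : HalfVertex n) : Prop :=
  (min p (m p) < min q (m q) ∧ min q (m q) < max p (m p) ∧ max p (m p) < max q (m q)) ∨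
    (min q (m q) < min p (m p) ∧ min p (m p) < max q (m q) ∧ max q (m q) < max p (m p))

theorem Crosses.symm {p q : HalfVertex n} (h : Crosses m p q) : Crosses m q p := Or.symm h

theorem crosses_comm {p q : HalfVertex n} : Crosses m p q ↔ Crosses m q p := ⟨.symm, .symm⟩

theorem crosses_apply_left (hm : Function.Involutive m) {p q : HalfVertex n} :
    Crosses m (m p) q ↔ Crosses m p q := by
  rw [Crosses, hm, min_comm, max_comm]
  rfl

theorem crosses_apply_right (hm : Function.Involutive m) {p q : HalfVertex n} :
    Crosses m p (m q) ↔ Crosses m p q := by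
  rw [crosses_comm, crosses_apply_left hm, crosses_comm]

theorem Crosses.ne_left {p q : HalfVertex n} (h : Crosses m p q) : m p ≠ p := by
  intro e
  rw [Crosses, e, min_self, max_self] at h
  rcases h with h | h
  · exact lt_asymm h.1 h.2.1
  · exact lt_asymm h.2.1 h.2.2

theorem Crosses.ne_right {p q : HalfVertex n} (h : Crosses m p q) : m q ≠ q := h.symm.ne_left

theorem not_crosses_self (hm : Function.Involutive m) (p : HalfVertex n) :
    ¬ Crosses m p (m p) := by
  rw [crosses_apply_right hm]
  rintro (h | h) <;> exact lt_irrefl _ h.1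

theorem crosses_iff_of_lt {p q : HalfVertex n} (hp : p < m p) (hq : q < m q) :
    Crosses m p q ↔ (p < q ∧ q < m p ∧ m p < m q) ∨ (q < p ∧ p < m q ∧ m q < m p) := by
  rw [Crosses, min_eq_left hp.le, min_eq_left hq.le, max_eq_right hp.le, max_eq_right hq.le]

/-- The arcs in a vertex of degree two which is not incident to a loop cross iff their other ends
are in increasing order if they are on the same side, and in decreasing order otherwise. -/
theorem crosses_plain_prime_iff {v : Fin n} (hp : base (m (plain v)) ≠ v)
    (hq : base (m (prime v)) ≠ v) : Crosses m (plain v) (prime v) ↔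
      (m (plain v) < m (prime v) ∧ (base (m (plain v)) < v ↔ base (m (prime v)) < v)) ∨
        (base (m (prime v)) < v ∧ v < base (m (plain v))) := by
  have hpq := plain_lt_prime v
  rcases lt_or_gt_of_ne hp with h1 | h1 <;> rcases lt_or_gt_of_ne hq with h2 | h2
  · have h3 : m (plain v) < plain v := lt_of_base_lt h1
    have h4 : m (prime v) < prime v := lt_of_base_lt h2
    have h5 : m (prime v) < plain v := lt_of_base_lt h2
    rw [Crosses, min_eq_right h3.le, min_eq_right h4.le, max_eq_left h3.le, max_eq_left h4.le]
    simp [h1, h2, h1.not_gt, h5, hpq, hpq.not_gt]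
  · have h3 : m (plain v) < plain v := lt_of_base_lt h1
    have h4 : prime v < m (prime v) := lt_of_base_lt h2
    rw [Crosses, min_eq_right h3.le, min_eq_left h4.le, max_eq_left h3.le, max_eq_right h4.le]
    simp [h1, h2.not_gt, hpq.not_gt, (h3.trans hpq).not_gt]
  · have h3 : plain v < m (plain v) := lt_of_base_lt h1
    have h4 : m (prime v) < prime v := lt_of_base_lt h2
    have h5 : m (prime v) < plain v := lt_of_base_lt h2
    have h6 : prime v < m (plain v) := lt_of_base_lt h1
    rw [Crosses, min_eq_left h3.le, min_eq_right h4.le, max_eq_right h3.le, max_eq_left h4.le]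
    simp [h1, h2, h5, h6, hpq]
  · have h3 : plain v < m (plain v) := lt_of_base_lt h1
    have h4 : prime v < m (prime v) := lt_of_base_lt h2
    have h6 : prime v < m (plain v) := lt_of_base_lt h1
    rw [Crosses, min_eq_left h3.le, min_eq_left h4.le, max_eq_right h3.le, max_eq_right h4.le]
    simp [h1.not_gt, h2.not_gt, h6, hpq, hpq.not_gt]

/-! ### Contraction to a tangled-diagram -/

/-- The left ends of the arcs. -/
def openers (m : HalfVertex n → HalfVertex n) : Finset (HalfVertex n) :=
  Finset.univ.filter fun z => z < m z

@[simp] theorem mem_openers {z : HalfVertex n} : z ∈ openers m ↔ z < m z := by simp [openers]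

/-- The arc with left end `z` of the contracted graph. -/
def baseArc (m : HalfVertex n → HalfVertex n) (z : HalfVertex n) : Fin n × Fin n :=
  (base z, base (m z))

/-- The arcs of the graph in which `j'` is identified with `j`. -/
def contractArcs (m : HalfVertex n → HalfVertex n) : Multiset (Fin n × Fin n) :=
  (openers m).val.map (baseArc m)

theorem mem_contractArcs {p : Fin n × Fin n} :
    p ∈ contractArcs m ↔ ∃ z, z < m z ∧ base z = p.1 ∧ base (m z) = p.2 := by
  simp [contractArcs, baseArc, Prod.ext_iff]

theorem count_contractArcs (p : Fin n × Fin n) : (contractArcs m).count p =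
    (Finset.univ.filter fun z => z < m z ∧ base z = p.1 ∧ base (m z) = p.2).card := by
  rw [contractArcs, Multiset.count_map, openers]
  change Finset.card (Finset.filter _ (Finset.filter _ _)) = _
  rw [Finset.filter_filter]
  congr 1
  ext z
  simp only [Finset.mem_filter, Finset.mem_univ, true_and, baseArc, Prod.ext_iff]
  tauto

theorem card_filter_pair {β : Type*} [DecidableEq β] {p q : β} (hpq : p ≠ q) (f : β → Prop)
    [DecidablePred f] : (Finset.filter f {p, q}).card =
      (if f p then 1 else 0) + (if f q then 1 else 0) := by
  rw [Finset.card_filter, Finset.sum_pair hpq]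

theorem count_contractArcs_left {i j : Fin n} (hij : i < j) : (contractArcs m).count (i, j) =
    (if base (m (plain i)) = j then 1 else 0) + (if base (m (prime i)) = j then 1 else 0) := by
  rw [count_contractArcs, ← card_filter_pair (plain_ne_prime i i) (fun z => base (m z) = j),
    ← filter_base_eq, Finset.filter_filter]
  congr 1
  ext z
  simp only [Finset.mem_filter, Finset.mem_univ, true_and, and_iff_right_iff_imp, and_imp]
  rintro rfl rfl
  exact lt_of_base_lt hij

theorem count_contractArcs_right (hm : Function.Involutive m) {i j : Fin n} (hij : i < j) :
    (contractArcs m).count (i, j) =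
      (if base (m (plain j)) = i then 1 else 0) + (if base (m (prime j)) = i then 1 else 0) := by
  rw [count_contractArcs, ← card_filter_pair (plain_ne_prime j j) (fun z => base (m z) = i),
    ← filter_base_eq, Finset.filter_filter]
  refine Finset.card_bij' (fun z _ => m z) (fun z _ => m z) ?_ ?_ (fun z _ => hm z)
    (fun z _ => hm z)
  · intro z hz
    simp only [Finset.mem_filter, Finset.mem_univ, true_and] at hz ⊢
    rw [hm]
    exact ⟨hz.2.2, hz.2.1⟩
  · intro z hz
    simp only [Finset.mem_filter, Finset.mem_univ, true_and] at hz ⊢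
    rw [hm]
    refine ⟨lt_of_base_lt ?_, hz.2, hz.1⟩
    rwa [hz.1, hz.2]

theorem mem_contractArcs_left {i j : Fin n} (hij : i < j) : (i, j) ∈ contractArcs m ↔
    base (m (plain i)) = j ∨ base (m (prime i)) = j := by
  rw [← Multiset.count_pos, count_contractArcs_left hij]
  split_ifs <;> simp [*]

theorem mem_contractArcs_right (hm : Function.Involutive m) {i j : Fin n} (hij : i < j) :
    (i, j) ∈ contractArcs m ↔ base (m (plain j)) = i ∨ base (m (prime j)) = i := by
  rw [← Multiset.count_pos, count_contractArcs_right hm hij]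
  split_ifs <;> simp [*]

theorem mem_contractArcs_loop {j : Fin n} : (j, j) ∈ contractArcs m ↔ m (plain j) = prime j := by
  rw [mem_contractArcs]
  constructor
  · rintro ⟨z, h1, h2, h3⟩
    obtain ⟨h4, h5⟩ := eq_of_lt_of_base_eq h1 (h2.trans h3.symm)
    simp only at h3
    rw [h3] at h4 h5
    rw [← h4, h5]
  · intro h
    exact ⟨plain j, by simp [h], by simp [h]⟩

/-- Each matched half-vertex at `v` is the left or the right end of exactly one arc; `m` carries the
count over right ends to one over half-vertices at `v`. -/
theorem arcDegree_contractArcs (hm : Function.Involutive m) (v : Fin n) :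
    arcDegree (contractArcs m) v =
      (if m (plain v) ≠ plain v then 1 else 0) + (if m (prime v) ≠ prime v then 1 else 0) := by
  have h1 : (contractArcs m).countP (fun p => p.1 = v) =
      (Finset.univ.filter fun z => z < m z ∧ base z = v).card := by
    rw [contractArcs, Multiset.countP_map]
    change Finset.card (Finset.filter _ _) = _
    rw [openers, Finset.filter_filter]
    rfl
  have h2 : (contractArcs m).countP (fun p => p.2 = v) =
      (Finset.univ.filter fun z => z < m z ∧ base (m z) = v).card := by
    rw [contractArcs, Multiset.countP_map]
    change Finset.card (Finset.filter _ _) = _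
    rw [openers, Finset.filter_filter]
    rfl
  have h3 : (Finset.univ.filter fun z => z < m z ∧ base (m z) = v).card =
      (Finset.univ.filter fun z => m z < z ∧ base z = v).card := by
    refine Finset.card_bij' (fun z _ => m z) (fun z _ => m z) ?_ ?_ (fun z _ => hm z)
      (fun z _ => hm z)
    · intro z hz
      simp only [Finset.mem_filter, Finset.mem_univ, true_and] at hz ⊢
      rwa [hm]
    · intro z hz
      simp only [Finset.mem_filter, Finset.mem_univ, true_and] at hz ⊢
      rwa [hm]
  rw [arcDegree, h1, h2, h3, ← card_filter_pair (plain_ne_prime v v) (fun z => m z ≠ z),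
    ← filter_base_eq, Finset.filter_filter, ← Finset.card_union_of_disjoint]
  · congr 1
    ext z
    simp only [Finset.mem_union, Finset.mem_filter, Finset.mem_univ, true_and, ne_iff_lt_or_gt]
    tauto
  · rw [Finset.disjoint_left]
    intro z hz hz'
    simp only [Finset.mem_filter, Finset.mem_univ, true_and] at hz hz'
    exact lt_asymm hz.1 hz'.1

open Classical in
/-- The tangled-diagram obtained by identifying `j'` with `j` for all `j`. -/
noncomputable def contract (m : HalfVertex n → HalfVertex n) (hm : Function.Involutive m) :
    TangledDiagram n where
  arcs := contractArcs m
  arcs_le p hp := by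
    obtain ⟨z, h1, h2, h3⟩ := mem_contractArcs.1 hp
    rw [← h2, ← h3]
    exact base_le_of_lt h1
  degree_le v := by
    rw [arcDegree_contractArcs hm]
    split_ifs <;> simp
  crossAt := Finset.univ.filter fun v => Crosses m (plain v) (prime v)
  crossAt_degree v hv := by
    rw [Finset.mem_filter] at hv
    rw [arcDegree_contractArcs hm, if_pos hv.2.ne_left, if_pos hv.2.ne_right]
  crossAt_loop v hv h := by
    rw [Finset.mem_filter] at hv
    rw [mem_contractArcs_loop] at h
    rw [← h] at hv
    exact not_crosses_self hm _ hv.2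
  crossAt_parallel i j hij h := by
    simp only [Finset.mem_filter, Finset.mem_univ, true_and]
    rw [count_contractArcs_left hij] at h
    have hi : base (m (plain i)) = j ∧ base (m (prime i)) = j := by
      split_ifs at h <;> simp_all
    rw [base_eq_iff, base_eq_iff] at hi
    have hne : m (plain i) ≠ m (prime i) := hm.injective.ne (by simp)
    -- A double arc maps the two half-vertices of `i` onto those of `j`, so crossing at `i` and at
    -- `j` concerns the same two arcs.
    rw [← crosses_apply_left hm, ← crosses_apply_right hm]
    rcases hi.1 with h1 | h1 <;> rcases hi.2 with h2 | h2
    · exact absurd (h1.trans h2.symm) hne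
    · rw [h1, h2]
    · rw [h1, h2, crosses_comm]
    · exact absurd (h1.trans h2.symm) hne

variable {hm : Function.Involutive m}

@[simp] theorem contract_arcs : (contract m hm).arcs = contractArcs m := rfl

@[simp] theorem mem_contract_crossAt {v : Fin n} :
    v ∈ (contract m hm).crossAt ↔ Crosses m (plain v) (prime v) := by
  simp [contract]

theorem degree_contract_eq_two_iff {v : Fin n} :
    (contract m hm).degree v = 2 ↔ m (plain v) ≠ plain v ∧ m (prime v) ≠ prime v := by
  rw [TangledDiagram.degree, contract_arcs, arcDegree_contractArcs hm]
  split_ifs <;> simp_all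

/-! ### Inflation of the contraction -/

/-- The graph with the arcs given by a partial matching. -/
def halfGraphOf (m : HalfVertex n → HalfVertex n) : HalfGraph n where
  verts := {v | ∃ j, v = plain j ∨ (v = prime j ∧ m (prime j) ≠ prime j)}
  arcs := arcsOf m

theorem lt_iff_base_lt {y z : HalfVertex n} (h : base y ≠ base z) : y < z ↔ base y < base z :=
  ⟨fun h' => lt_of_le_of_ne (base_le_of_lt h') h, lt_of_base_lt⟩

/-- `crosses_plain_prime_iff` in terms of the vertices for arcs which are not parallel. -/
theorem crosses_plain_prime_iff_base {v : Fin n} (hp : base (m (plain v)) ≠ v)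
    (hq : base (m (prime v)) ≠ v) (h : base (m (plain v)) ≠ base (m (prime v))) :
    Crosses m (plain v) (prime v) ↔ (base (m (plain v)) < base (m (prime v)) ∧
      (base (m (plain v)) < v ↔ base (m (prime v)) < v)) ∨
        (base (m (prime v)) < v ∧ v < base (m (plain v))) := by
  rw [crosses_plain_prime_iff hp hq, lt_iff_base_lt h]

theorem base_apply_plain_ne (H : IsPairing m) {v : Fin n} (h : base (m (prime v)) ≠ v) :
    base (m (plain v)) ≠ v := by
  intro h'
  rcases base_eq_iff.1 h' with h' | h'
  · refine H.plain_ne v (fun e => h ?_) h'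
    rw [e, base_prime]
  · rw [← h', H.involutive] at h
    simp at h

/-- Since the arc is not parallel to another one, crossing at `i` is a comparison of the vertices at
the far ends. Putting this into the rules for primed ends leaves a finite case check. -/
theorem leftPrimed_iff (H : IsPairing m) {i j : Fin n} (hij : i < j) {x : HalfVertex n}
    (hx : base x = i) (hmx : base (m x) = j) (hc : (contractArcs m).count (i, j) = 1) :
    (contract m H.involutive).LeftPrimed i j ↔ x = prime i := by
  have hl {h : Fin n} (hh : h < i) := mem_contractArcs_right H.involutive hh
  have hr {r : Fin n} (hh : i < r) := mem_contractArcs_left (m := m) hh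
  have h1 : (contract m H.involutive).LeftPrimed i j ↔
    (∃ h, h < i ∧ (base (m (plain i)) = h ∨ base (m (prime i)) = h) ∧
      ¬ Crosses m (plain i) (prime i)) ∨
    (∃ r, i < r ∧ (base (m (plain i)) = r ∨ base (m (prime i)) = r) ∧
      ((Crosses m (plain i) (prime i) ∧ r < j) ∨ (¬ Crosses m (plain i) (prime i) ∧ j < r))) := by
    simp only [TangledDiagram.LeftPrimed, contract_arcs, mem_contract_crossAt]
    refine or_congr (exists_congr fun h => and_congr_right fun hh => ?_)
      (exists_congr fun h => and_congr_right fun hh => ?_)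
    · rw [hl hh]
    · rw [hr hh]
  rw [h1]
  rw [count_contractArcs_left hij] at hc
  rcases base_eq_iff.1 hx with rfl | rfl
  · have hne : base (m (prime i)) ≠ j := by
      intro h
      rw [if_pos hmx, if_pos h] at hc
      omega
    simp only [hmx, plain_ne_prime, iff_false]
    -- In the first case `i'` is unmatched, and the only arc that the rule could find is the given
    -- one, for which both comparisons fail.
    by_cases hb : base (m (prime i)) = i
    · grind
    · have h2 := crosses_plain_prime_iff_base (by rw [hmx]; exact hij.ne') hb
        (by rw [hmx]; exact hne.symm)
      rw [hmx] at h2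
      grind
  · have hne : base (m (plain i)) ≠ j := by
      intro h
      rw [if_pos hmx, if_pos h] at hc
      omega
    have hb : base (m (prime i)) ≠ i := by rw [hmx]; exact hij.ne'
    have hb' := base_apply_plain_ne H hb
    have h2 := crosses_plain_prime_iff_base hb' hb (by rw [hmx]; exact hne)
    rw [hmx] at h2
    simp only [hmx, iff_true]
    grind

theorem rightPrimed_iff (H : IsPairing m) {i j : Fin n} (hij : i < j) {y : HalfVertex n}
    (hy : base y = j) (hmy : base (m y) = i) (hc : (contractArcs m).count (i, j) = 1) :
    (contract m H.involutive).RightPrimed i j ↔ y = prime j := by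
  have hl {h : Fin n} (hh : h < j) := mem_contractArcs_right H.involutive hh
  have hr {r : Fin n} (hh : j < r) := mem_contractArcs_left (m := m) hh
  have h1 : (contract m H.involutive).RightPrimed i j ↔
    (∃ h, j < h ∧ (base (m (plain j)) = h ∨ base (m (prime j)) = h) ∧
      Crosses m (plain j) (prime j)) ∨
    (∃ r, r < j ∧ (base (m (plain j)) = r ∨ base (m (prime j)) = r) ∧
      ((Crosses m (plain j) (prime j) ∧ r < i) ∨ (¬ Crosses m (plain j) (prime j) ∧ i < r))) := by
    simp only [TangledDiagram.RightPrimed, contract_arcs, mem_contract_crossAt]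
    refine or_congr (exists_congr fun h => and_congr_right fun hh => ?_)
      (exists_congr fun h => and_congr_right fun hh => ?_)
    · rw [hr hh]
    · rw [hl hh]
  rw [h1]
  rw [count_contractArcs_right H.involutive hij] at hc
  rcases base_eq_iff.1 hy with rfl | rfl
  · have hne : base (m (prime j)) ≠ i := by
      intro h
      rw [if_pos hmy, if_pos h] at hc
      omega
    simp only [hmy, plain_ne_prime, iff_false]
    by_cases hb : base (m (prime j)) = j
    · grind
    · have h2 := crosses_plain_prime_iff_base (by rw [hmy]; exact hij.ne) hb
        (by rw [hmy]; exact hne.symm)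
      rw [hmy] at h2
      grind
  · have hne : base (m (plain j)) ≠ i := by
      intro h
      rw [if_pos hmy, if_pos h] at hc
      omega
    have hb : base (m (prime j)) ≠ j := by rw [hmy]; exact hij.ne
    have hb' := base_apply_plain_ne H hb
    have h2 := crosses_plain_prime_iff_base hb' hb (by rw [hmy]; exact hne)
    rw [hmy] at h2
    simp only [hmy, iff_true]
    grind

/-- Injectivity of `m` leaves two ways to join the half-vertices of `i` and `j`; the
order-preserving one crosses, the other one nests. -/
theorem parallel_cases (hm : Function.Involutive m) {i j : Fin n} (hij : i < j)
    (hc : (contractArcs m).count (i, j) = 2) :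
    (Crosses m (plain i) (prime i) ∧ m (plain i) = plain j ∧ m (prime i) = prime j) ∨
      (¬ Crosses m (plain i) (prime i) ∧ m (plain i) = prime j ∧ m (prime i) = plain j) := by
  rw [count_contractArcs_left hij] at hc
  have h1 : base (m (plain i)) = j ∧ base (m (prime i)) = j := by
    split_ifs at hc <;> simp_all
  have hne : m (plain i) ≠ m (prime i) := hm.injective.ne (by simp)
  have h2 := crosses_plain_prime_iff (m := m) (v := i) (by rw [h1.1]; exact hij.ne')
    (by rw [h1.2]; exact hij.ne')
  rw [h1.1, h1.2] at h2
  simp only [hij.not_gt, false_and, or_false, and_true] at h2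
  rw [base_eq_iff, base_eq_iff] at h1
  rcases h1.1 with h3 | h3 <;> rcases h1.2 with h4 | h4
  · exact absurd (h3.trans h4.symm) hne
  · rw [h3, h4] at h2
    exact .inl ⟨h2.2 (plain_lt_prime j), h3, h4⟩
  · rw [h3, h4] at h2
    exact .inr ⟨fun h => (plain_lt_prime j).not_gt (h2.1 h), h3, h4⟩
  · exact absurd (h3.trans h4.symm) hne

/-- The multiplicity of a non-loop arc selects between the rule for double arcs (`parallel_cases`)
and the primed-end rules (`leftPrimed_iff`, `rightPrimed_iff`); each returns the half-vertices the
arc came from. -/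
theorem inflationArc_contract_iff (H : IsPairing m) {x y : HalfVertex n} :
    (contract m H.involutive).InflationArc x y ↔ x < y ∧ m x = y := by
  constructor
  · intro h
    cases h with
    | loop i h => exact ⟨plain_lt_prime i, mem_contractArcs_loop.1 h⟩
    | cross_fst i j hij hc hi =>
      rw [mem_contract_crossAt] at hi
      have := parallel_cases H.involutive hij hc
      exact ⟨lt_of_base_lt hij, by tauto⟩
    | cross_snd i j hij hc hi =>
      rw [mem_contract_crossAt] at hi
      have := parallel_cases H.involutive hij hc
      exact ⟨lt_of_base_lt hij, by tauto⟩
    | nest_fst i j hij hc hi =>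
      rw [mem_contract_crossAt] at hi
      have := parallel_cases H.involutive hij hc
      exact ⟨lt_of_base_lt hij, by tauto⟩
    | nest_snd i j hij hc hi =>
      rw [mem_contract_crossAt] at hi
      have := parallel_cases H.involutive hij hc
      exact ⟨lt_of_base_lt hij, by tauto⟩
    | single i j x y hij hc hx hy =>
      have hmem : (i, j) ∈ contractArcs m := by
        rw [← Multiset.count_pos]
        exact hc ▸ Nat.one_pos
      obtain ⟨z, h1, h2, h3⟩ := mem_contractArcs.1 hmem
      rw [leftPrimed_iff H hij h2 h3 hc] at hx
      rw [rightPrimed_iff H hij h3 (by rw [H.involutive, h2]) hc] at hy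
      have hzx : x = z := by
        rcases base_eq_iff.1 h2 with h4 | h4 <;> simp [h4] at hx <;> rw [hx, h4]
      have hzy : y = m z := by
        rcases base_eq_iff.1 h3 with h4 | h4 <;> simp [h4] at hy <;> rw [hy, h4]
      rw [hzx, hzy]
      exact ⟨h1, rfl⟩
  · rintro ⟨h, rfl⟩
    rcases (base_le_of_lt h).eq_or_lt with hb | hb
    · obtain ⟨h1, h2⟩ := eq_of_lt_of_base_eq h hb
      rw [← hb] at h1 h2
      have := TangledDiagram.InflationArc.loop (D := contract m H.involutive) (base x)
        (mem_contractArcs_loop.2 (by rw [← h1]; exact h2))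
      rwa [← h1, ← h2] at this
    · have hmem : (base x, base (m x)) ∈ contractArcs m := mem_contractArcs.2 ⟨x, h, rfl, rfl⟩
      rw [← Multiset.count_pos] at hmem
      have hle : (contractArcs m).count (base x, base (m x)) ≤ 2 := by
        rw [count_contractArcs_left hb]
        split_ifs <;> simp
      rcases (show (contractArcs m).count (base x, base (m x)) = 1 ∨
        (contractArcs m).count (base x, base (m x)) = 2 by omega) with hc | hc
      · refine .single _ _ _ _ hb hc ?_ ?_
        · rw [leftPrimed_iff H hb rfl rfl hc]
          rcases eq_plain_or_eq_prime x with h1 | h1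
          · exact .inr ⟨by rw [h1]; simp, h1⟩
          · exact .inl ⟨h1, h1⟩
        · rw [rightPrimed_iff H hb rfl (by rw [H.involutive]) hc]
          rcases eq_plain_or_eq_prime (m x) with h1 | h1
          · exact .inr ⟨by rw [h1]; simp, h1⟩
          · exact .inl ⟨h1, h1⟩
      · rcases parallel_cases H.involutive hb hc with ⟨h1, h2, h3⟩ | ⟨h1, h2, h3⟩ <;>
          rw [← mem_contract_crossAt (hm := H.involutive)] at h1 <;>
          rcases eq_plain_or_eq_prime x with h4 | h4
        · have := TangledDiagram.InflationArc.cross_fst _ _ hb hc h1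
          rwa [← h2, ← h4] at this
        · have := TangledDiagram.InflationArc.cross_snd _ _ hb hc h1
          rwa [← h3, ← h4] at this
        · have := TangledDiagram.InflationArc.nest_fst _ _ hb hc h1
          rwa [← h2, ← h4] at this
        · have := TangledDiagram.InflationArc.nest_snd _ _ hb hc h1
          rwa [← h3, ← h4] at this

theorem inflation_contract (H : IsPairing m) :
    (contract m H.involutive).inflation = halfGraphOf m := by
  ext x
  · simp only [TangledDiagram.inflation, halfGraphOf, Set.mem_ofPred_eq,
      degree_contract_eq_two_iff]
    refine exists_congr fun j => or_congr_right (and_congr_right fun _ => ?_)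
    exact ⟨fun h => h.2, fun h => ⟨H.plain_ne j h, h⟩⟩
  · exact inflationArc_contract_iff H

end Pairing

/-! ### Crossings are preserved by contraction -/

section Noncrossing

variable {n : ℕ} {m : HalfVertex n → HalfVertex n}

theorem TangledDiagram.Crossing.symm {D : TangledDiagram n} {a b : Fin n × Fin n}
    (h : D.Crossing a b) : D.Crossing b a := by
  rcases h with h | h | ⟨v, h1, h2, h3⟩
  · exact .inr (.inl h)
  · exact .inl h
  · exact .inr (.inr ⟨v, h1, h3, h2⟩)

/-- If all three inequalities stay strict on the vertices, the arcs cross geometrically. An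
inequality that collapses compares some `v` with `v'`, and then the crossing is recorded at `v`. -/
theorem crossing_of_lt (hm : Function.Involutive m) {x y : HalfVertex n} (h1 : x < y)
    (h2 : y < m x) (h3 : m x < m y) :
    (contract m hm).Crossing (baseArc m x) (baseArc m y) := by
  have hc : Crosses m x y :=
    (crosses_iff_of_lt (h1.trans h2) (h2.trans h3)).2 (.inl ⟨h1, h2, h3⟩)
  simp only [TangledDiagram.Crossing, baseArc, mem_contract_crossAt]
  rcases (base_le_of_lt h1).eq_or_lt with hb1 | hb1
  · obtain ⟨h4, h5⟩ := eq_of_lt_of_base_eq h1 hb1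
    refine .inr (.inr ⟨base y, ?_, .inl hb1, .inl rfl⟩)
    rwa [← h4, ← h5]
  rcases (base_le_of_lt h2).eq_or_lt with hb2 | hb2
  · obtain ⟨h4, h5⟩ := eq_of_lt_of_base_eq h2 hb2
    refine .inr (.inr ⟨base (m x), ?_, .inr rfl, .inl hb2⟩)
    rwa [← h4, ← h5, crosses_apply_right hm, crosses_comm]
  rcases (base_le_of_lt h3).eq_or_lt with hb3 | hb3
  · obtain ⟨h4, h5⟩ := eq_of_lt_of_base_eq h3 hb3
    refine .inr (.inr ⟨base (m y), ?_, .inr hb3, .inr rfl⟩)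
    rwa [← h4, ← h5, crosses_apply_right hm, crosses_apply_left hm]
  · exact .inl ⟨hb1, hb2, hb3⟩

theorem crossing_contract_iff (hm : Function.Involutive m) {x y : HalfVertex n} (hx : x < m x)
    (hy : y < m y) (hne : x ≠ y) :
    (contract m hm).Crossing (baseArc m x) (baseArc m y) ↔ Crosses m x y := by
  constructor
  · rintro (⟨h1, h2, h3⟩ | ⟨h1, h2, h3⟩ | ⟨v, h1, h2, h3⟩)
    · exact (crosses_iff_of_lt hx hy).2
        (.inl ⟨lt_of_base_lt h1, lt_of_base_lt h2, lt_of_base_lt h3⟩)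
    · exact (crosses_iff_of_lt hx hy).2
        (.inr ⟨lt_of_base_lt h1, lt_of_base_lt h2, lt_of_base_lt h3⟩)
    · rw [mem_contract_crossAt] at h1
      have h4 {z : HalfVertex n} (h : (baseArc m z).1 = v ∨ (baseArc m z).2 = v) :
          ∃ p, (p = z ∨ p = m z) ∧ (p = plain v ∨ p = prime v) := by
        rcases h with h | h
        · exact ⟨z, .inl rfl, base_eq_iff.1 h⟩
        · exact ⟨m z, .inr rfl, base_eq_iff.1 h⟩
      obtain ⟨p, hp1, hp2⟩ := h4 h2
      obtain ⟨q, hq1, hq2⟩ := h4 h3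
      -- Different arcs have no half-vertex in common, so the ends of the two arcs at `v` are `v`
      -- and `v'`.
      have hpq : p ≠ q := by
        rintro rfl
        rcases hp1 with rfl | rfl <;> rcases hq1 with h5 | h5
        · exact hne h5
        · rw [h5, hm] at hx
          exact hx.not_gt hy
        · rw [← h5, hm] at hy
          exact hx.not_gt hy
        · exact hne (hm.injective h5)
      have hc : Crosses m p q := by
        rcases hp2 with rfl | rfl <;> rcases hq2 with rfl | rfl
        · exact absurd rfl hpq
        · exact h1
        · exact h1.symm
        · exact absurd rfl hpq
      have hc' : Crosses m x q := by
        rcases hp1 with rfl | rfl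
        · exact hc
        · exact (crosses_apply_left hm).1 hc
      rcases hq1 with rfl | rfl
      · exact hc'
      · exact (crosses_apply_right hm).1 hc'
  · rw [crosses_iff_of_lt hx hy]
    rintro (⟨h1, h2, h3⟩ | ⟨h1, h2, h3⟩)
    · exact crossing_of_lt hm h1 h2 h3
    · exact (crossing_of_lt hm h1 h2 h3).symm

theorem noncrossing_contract_iff (hm : Function.Involutive m) {k : ℕ} :
    (contract m hm).Noncrossing k ↔ ¬ HasCrossing m k := by
  refine not_congr ⟨?_, ?_⟩
  · rintro ⟨l, h1, rfl, h3⟩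
    -- Lifting the arcs to their left half-vertices makes parallel arcs distinguishable, so that the
    -- lifted list has no repetitions.
    have h4 : List.Subperm l ((openers m).toList.map (baseArc m)) := by
      rw [← Multiset.coe_le, ← Multiset.map_coe, Finset.coe_toList]
      exact h1
    obtain ⟨l', h5, h6⟩ := h4
    obtain ⟨l₂, h7, rfl⟩ := List.sublist_map_iff.1 h6
    have hn : l₂.Nodup := (openers m).nodup_toList.sublist h7
    have hmem : ∀ u ∈ l₂, u < m u := fun u hu => by
      simpa using Finset.mem_toList.1 (h7.subset hu)
    rw [← h5.pairwise_iff TangledDiagram.Crossing.symm, List.pairwise_map] at h3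
    have h8 : l₂.Pairwise fun u v => u ≠ v ∧ Crosses m u v :=
      (h3.and hn).imp_of_mem fun hu hv h =>
        ⟨h.2, (crossing_contract_iff hm (hmem _ hu) (hmem _ hv) h.2).1 h.1⟩
    -- Once the left ends are in decreasing order, crossing means that the right ends decrease too
    -- and lie beyond the left ends.
    set l₃ := l₂.insertionSort (· ≥ ·) with hl₃
    have hp : l₃.Perm l₂ := List.perm_insertionSort _ _
    have h9 : l₃.Pairwise (· ≥ ·) := List.pairwise_insertionSort _ _
    rw [← hp.pairwise_iff fun h => ⟨h.1.symm, h.2.symm⟩] at h8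
    have h10 : l₃.Pairwise fun u v => (v < u ∧ m v < m u) ∧ u < m v := by
      refine (h8.and h9).imp_of_mem fun hu hv h => ?_
      obtain ⟨⟨h11, h12⟩, h13⟩ := h
      rw [crosses_iff_of_lt (hmem _ (hp.subset hu)) (hmem _ (hp.subset hv))] at h12
      have h14 := lt_of_le_of_ne h13 h11.symm
      rcases h12 with h12 | h12
      · exact absurd h12.1 h14.not_gt
      · exact ⟨⟨h12.1, h12.2.2⟩, h12.2.1⟩
    refine ⟨l₃, ?_, h10.imp fun h => h.1, ?_⟩
    · rw [hp.length_eq, ← h5.length_eq, List.length_map]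
    · have hmem' : ∀ u ∈ l₃, u < m u := fun u hu => hmem u (hp.subset hu)
      refine List.Pairwise.forall_of_forall_of_flip hmem' (h10.imp fun h => h.2) ?_
      refine h10.imp_of_mem fun {u v} hu hv h => ?_
      exact h.1.1.trans (hmem' u hu)
  · rintro ⟨l, rfl, h2, h3⟩
    refine ⟨l.map (baseArc m), ?_, List.length_map _, ?_⟩
    · rw [← Multiset.map_coe]
      refine Multiset.map_le_map ((Multiset.le_iff_subset ?_).2 fun u hu => ?_)
      · exact Multiset.coe_nodup.2 (h2.imp fun h => h.1.ne')
      · rw [Finset.mem_val, mem_openers]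
        exact h3 u hu u hu
    · rw [List.pairwise_map]
      refine h2.imp_of_mem fun {u v} hu hv h => (crossing_contract_iff hm (h3 u hu u hu)
        (h3 v hv v hv) h.1.ne').2 ?_
      rw [crosses_iff_of_lt (h3 u hu u hu) (h3 v hv v hv)]
      exact .inr ⟨h.1, h3 u hu v hv, h.2⟩

end Noncrossing

/-! ### Every tangled-diagram is a contraction -/

section Surjectivity

variable {n : ℕ} {m : HalfVertex n → HalfVertex n}

theorem contractArcs_joinEnds {x y : HalfVertex n} (hx : m x = x)
    (hy : m y = y) (hxy : x < y) :
    contractArcs (joinEnds m x y) = (base x, base y) ::ₘ contractArcs m := by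
  have h1 : openers (joinEnds m x y) = insert x (openers m) := by
    ext z
    rw [Finset.mem_insert, mem_openers, mem_openers]
    by_cases hzx : z = x
    · rw [hzx, joinEnds_left]
      simp [hxy]
    by_cases hzy : z = y
    · rw [hzy, joinEnds_right, hy]
      simp [hxy.ne', hxy.not_gt]
    rw [joinEnds_of_ne hzx hzy]
    simp [hzx]
  have h2 : x ∉ openers m := by simp [hx]
  rw [contractArcs, h1, Finset.insert_val_of_notMem h2, Multiset.map_cons, baseArc, joinEnds_left,
    contractArcs]
  congr 1
  refine Multiset.map_congr rfl fun z hz => ?_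
  rw [Finset.mem_val, mem_openers] at hz
  rw [baseArc, joinEnds_of_ne, baseArc]
  · rintro rfl
    exact hz.ne hx.symm
  · rintro rfl
    exact hz.ne hy.symm

theorem IsPairing.joinEnds {x y : HalfVertex n} (H : IsPairing m) (hx : m x = x)
    (hy : m y = y) (hxy : x < y) (h : ∀ j, (x = prime j ∨ y = prime j) →
      m (plain j) ≠ plain j ∨ plain j = x ∨ plain j = y) : IsPairing (joinEnds m x y) := by
  refine ⟨joinEnds_involutive H.involutive hx hy, fun j hj => ?_⟩
  by_cases h1 : plain j = x
  · rw [h1, joinEnds_left]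
    exact hxy.ne'
  by_cases h2 : plain j = y
  · rw [h2, joinEnds_right]
    exact hxy.ne
  rw [joinEnds_of_ne h1 h2]
  by_cases h3 : x = prime j ∨ y = prime j
  · have := h j h3
    tauto
  · push Not at h3
    rw [joinEnds_of_ne h3.1.symm h3.2.symm] at hj
    exact H.plain_ne j hj

/-- Insert the arcs one by one, using `v` if it is still free and `v'` otherwise; the degree bound
guarantees a free place. Crossings are ignored here. -/
theorem exists_contractArcs_eq (arcs : Multiset (Fin n × Fin n)) (hle : ∀ a ∈ arcs, a.1 ≤ a.2)
    (hdeg : ∀ v, arcDegree arcs v ≤ 2) : ∃ m, IsPairing m ∧ contractArcs m = arcs := by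
  induction arcs using Multiset.induction_on with
  | empty =>
    refine ⟨id, ⟨fun _ => rfl, fun j h => absurd rfl h⟩, ?_⟩
    simp [contractArcs, openers]
  | cons p s ih =>
    obtain ⟨i, j⟩ := p
    have hd (v : Fin n) : arcDegree ((i, j) ::ₘ s) v =
        arcDegree s v + ((if i = v then 1 else 0) + if j = v then 1 else 0) := by
      simp only [arcDegree, Multiset.countP_cons]
      omega
    obtain ⟨m, H, rfl⟩ := ih (fun a ha => hle a (Multiset.mem_cons_of_mem ha)) fun v => by
      have := hdeg v
      rw [hd] at this
      omega
    have hij : i ≤ j := hle (i, j) (Multiset.mem_cons_self _ _)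
    have hfree (v : Fin n) (hv : i = v ∨ j = v) (hne : i < j) :
        ∃ z, base z = v ∧ m z = z ∧ ∀ k, z = prime k → m (plain k) ≠ plain k := by
      by_cases h1 : m (plain v) = plain v
      · exact ⟨plain v, rfl, h1, by simp⟩
      · refine ⟨prime v, rfl, ?_, fun k hk => by rwa [← prime_inj.1 hk]⟩
        by_contra h2
        have h3 := hdeg v
        rw [hd, arcDegree_contractArcs H.involutive, if_pos h1, if_pos h2] at h3
        rcases hv with rfl | rfl <;> simp at h3
    rcases hij.eq_or_lt with rfl | hij
    · have h3 := hdeg i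
      rw [hd, arcDegree_contractArcs H.involutive] at h3
      have h1 : m (plain i) = plain i := by
        by_contra h
        rw [if_pos h] at h3
        simp at h3
      have h2 : m (prime i) = prime i := by
        by_contra h
        rw [if_pos h] at h3
        simp at h3
      refine ⟨joinEnds m (plain i) (prime i), H.joinEnds h1 h2 (plain_lt_prime i) ?_,
        contractArcs_joinEnds h1 h2 (plain_lt_prime i)⟩
      rintro k (hk | hk)
      · simp at hk
      · exact .inr (.inl (by rw [prime_inj.1 hk]))
    · obtain ⟨x, hx1, hx2, hx3⟩ := hfree i (.inl rfl) hij
      obtain ⟨y, hy1, hy2, hy3⟩ := hfree j (.inr rfl) hij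
      have hxy : x < y := lt_of_base_lt (by rwa [hx1, hy1])
      refine ⟨joinEnds m x y, H.joinEnds hx2 hy2 hxy ?_, ?_⟩
      · rintro k (hk | hk)
        · exact .inl (hx3 k hk)
        · exact .inl (hy3 k hk)
      · rw [contractArcs_joinEnds hx2 hy2 hxy, hx1, hy1]

/-- Exchange `j` and `j'` for all `j` in `S`. -/
def flipOn (S : Finset (Fin n)) (z : HalfVertex n) : HalfVertex n :=
  if base z ∈ S then toLex ((ofLex z).1, !(ofLex z).2) else z

theorem flipOn_of_notMem {S : Finset (Fin n)} {z : HalfVertex n} (h : base z ∉ S) :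
    flipOn S z = z := if_neg h

theorem flipOn_plain {S : Finset (Fin n)} {j : Fin n} (h : j ∈ S) :
    flipOn S (plain j) = prime j := if_pos h

theorem flipOn_prime {S : Finset (Fin n)} {j : Fin n} (h : j ∈ S) :
    flipOn S (prime j) = plain j := if_pos h

@[simp] theorem base_flipOn (S : Finset (Fin n)) (z : HalfVertex n) :
    base (flipOn S z) = base z := by
  rw [flipOn]
  split <;> rfl

theorem flipOn_involutive (S : Finset (Fin n)) : Function.Involutive (flipOn S) := by
  intro z
  by_cases h : base z ∈ S
  · rcases eq_plain_or_eq_prime z with hz | hz <;> rw [hz]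
    · rw [flipOn_plain h, flipOn_prime h]
    · rw [flipOn_prime h, flipOn_plain h]
  · rw [flipOn_of_notMem h, flipOn_of_notMem h]

/-- The partial matching in which `j` and `j'` are exchanged for all `j` in `S`. -/
def conjFlip (S : Finset (Fin n)) (m : HalfVertex n → HalfVertex n) (z : HalfVertex n) :
    HalfVertex n :=
  flipOn S (m (flipOn S z))

theorem conjFlip_involutive (S : Finset (Fin n)) (hm : Function.Involutive m) :
    Function.Involutive (conjFlip S m) := by
  intro z
  rw [conjFlip, conjFlip, flipOn_involutive, hm, flipOn_involutive]

theorem base_conjFlip (S : Finset (Fin n)) (z : HalfVertex n) :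
    base (conjFlip S m z) = base (m (flipOn S z)) := base_flipOn _ _

/-- There are two arcs and no loop at the vertex `v`. -/
def IsSplit (m : HalfVertex n → HalfVertex n) (v : Fin n) : Prop :=
  base (m (plain v)) ≠ v ∧ base (m (prime v)) ≠ v

variable {S : Finset (Fin n)}

theorem IsPairing.conjFlip (H : IsPairing m) (hS : ∀ v ∈ S, IsSplit m v) :
    IsPairing (conjFlip S m) := by
  refine ⟨conjFlip_involutive S H.involutive, fun j hj => ?_⟩
  by_cases h : j ∈ S
  · intro e
    have h1 := base_conjFlip S (m := m) (plain j)
    rw [e, flipOn_plain h, base_plain] at h1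
    exact (hS j h).2 h1.symm
  · intro e
    rw [_root_.conjFlip, flipOn_of_notMem (show base (prime j) ∉ S from h)] at hj
    rw [_root_.conjFlip, flipOn_of_notMem (show base (plain j) ∉ S from h)] at e
    refine H.plain_ne j (fun e' => hj ?_) ?_
    · rw [e', flipOn_of_notMem h]
    · rw [← flipOn_involutive S (m (plain j)), e, flipOn_of_notMem h]

theorem IsSplit.base_ne {v : Fin n} (h : IsSplit m v) {z : HalfVertex n} (hz : base z = v) :
    base (m z) ≠ v := by
  rcases base_eq_iff.1 hz with rfl | rfl
  · exact h.1
  · exact h.2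

/-- Flipping does not change vertices, which decide the order of the ends of an arc unless both
belong to one vertex; such a vertex is not split and hence not flipped. -/
theorem lt_conjFlip_iff (hS : ∀ v ∈ S, IsSplit m v) {z : HalfVertex n} :
    z < conjFlip S m z ↔ flipOn S z < m (flipOn S z) := by
  by_cases h : base (m (flipOn S z)) = base z
  · have hz : base z ∉ S := fun hz => (hS _ hz).base_ne (base_flipOn S z) h
    rw [flipOn_of_notMem hz] at h
    rw [conjFlip, flipOn_of_notMem hz, flipOn_of_notMem (z := m z) (by rwa [h])]
  · rw [lt_iff_base_lt, lt_iff_base_lt, base_conjFlip, base_flipOn]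
    · rw [base_flipOn]
      exact Ne.symm h
    · rw [base_conjFlip]
      exact Ne.symm h

theorem contractArcs_conjFlip (hS : ∀ v ∈ S, IsSplit m v) :
    contractArcs (conjFlip S m) = contractArcs m := by
  ext p
  rw [count_contractArcs, count_contractArcs]
  refine Finset.card_bij' (fun z _ => flipOn S z) (fun z _ => flipOn S z) ?_ ?_
    (fun z _ => flipOn_involutive S z) (fun z _ => flipOn_involutive S z)
  · intro z hz
    simp only [Finset.mem_filter, Finset.mem_univ, true_and] at hz ⊢
    rw [lt_conjFlip_iff hS, base_conjFlip] at hz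
    rwa [base_flipOn]
  · intro z hz
    simp only [Finset.mem_filter, Finset.mem_univ, true_and] at hz ⊢
    rw [lt_conjFlip_iff hS, base_conjFlip, flipOn_involutive]
    rwa [base_flipOn]

theorem crosses_plain_prime_iff_of_base_eq {v : Fin n} (hv : IsSplit m v)
    (h : base (m (plain v)) = base (m (prime v))) :
    Crosses m (plain v) (prime v) ↔ m (plain v) < m (prime v) := by
  rw [crosses_plain_prime_iff hv.1 hv.2, h]
  refine ⟨fun h' => ?_, fun h' => .inl ⟨h', Iff.rfl⟩⟩
  rcases h' with h' | h'
  · exact h'.1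
  · exact absurd h'.2 h'.1.not_gt

theorem crosses_conjFlip_of_notMem {v : Fin n} (hv : IsSplit m v) (hvS : v ∉ S)
    (h : base (m (plain v)) = base (m (prime v)) → base (m (plain v)) ∉ S) :
    Crosses (conjFlip S m) (plain v) (prime v) ↔ Crosses m (plain v) (prime v) := by
  have h2 : base (conjFlip S m (plain v)) = base (m (plain v)) := by
    rw [base_conjFlip, flipOn_of_notMem (z := plain v) hvS]
  have h3 : base (conjFlip S m (prime v)) = base (m (prime v)) := by
    rw [base_conjFlip, flipOn_of_notMem (z := prime v) hvS]
  have hv' : IsSplit (conjFlip S m) v := ⟨by rw [h2]; exact hv.1, by rw [h3]; exact hv.2⟩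
  by_cases hne : base (m (plain v)) = base (m (prime v))
  · rw [crosses_plain_prime_iff_of_base_eq hv hne,
      crosses_plain_prime_iff_of_base_eq hv' (by rw [h2, h3, hne]), conjFlip, conjFlip,
      flipOn_of_notMem (z := plain v) hvS, flipOn_of_notMem (z := prime v) hvS,
      flipOn_of_notMem (h hne), flipOn_of_notMem (hne ▸ h hne)]
  · rw [crosses_plain_prime_iff_base hv.1 hv.2 hne,
      crosses_plain_prime_iff_base hv'.1 hv'.2 (by rwa [h2, h3]), h2, h3]

/-- Exchanging the ends at `v` reverses the crossing criterion, while flips elsewhere do not change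
the vertices of the far ends. The hypothesis on double arcs is essential: flipping both their ends
would cancel. -/
theorem crosses_conjFlip_of_mem (hm : Function.Involutive m) {v : Fin n} (hv : IsSplit m v)
    (hvS : v ∈ S) (h : base (m (plain v)) = base (m (prime v)) → base (m (plain v)) ∉ S) :
    Crosses (conjFlip S m) (plain v) (prime v) ↔ ¬ Crosses m (plain v) (prime v) := by
  have h2 : base (conjFlip S m (plain v)) = base (m (prime v)) := by
    rw [base_conjFlip, flipOn_plain hvS]
  have h3 : base (conjFlip S m (prime v)) = base (m (plain v)) := by
    rw [base_conjFlip, flipOn_prime hvS]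
  have hv' : IsSplit (conjFlip S m) v := ⟨by rw [h2]; exact hv.2, by rw [h3]; exact hv.1⟩
  by_cases hne : base (m (plain v)) = base (m (prime v))
  · rw [crosses_plain_prime_iff_of_base_eq hv hne,
      crosses_plain_prime_iff_of_base_eq hv' (by rw [h2, h3, hne]), conjFlip, conjFlip,
      flipOn_plain hvS, flipOn_prime hvS, flipOn_of_notMem (h hne),
      flipOn_of_notMem (hne ▸ h hne), not_lt]
    exact ⟨fun h => h.le, fun h => lt_of_le_of_ne h (hm.injective.ne (by simp))⟩
  · rw [crosses_plain_prime_iff_base hv.1 hv.2 hne,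
      crosses_plain_prime_iff_base hv'.1 hv'.2 (by rw [h2, h3]; exact Ne.symm hne), h2, h3]
    have h5 := hv.1
    have h6 := hv.2
    grind

theorem isSplit_of_mem_crossAt (hm : Function.Involutive m) {D : TangledDiagram n}
    (hD : D.arcs = contractArcs m) {v : Fin n} (hv : v ∈ D.crossAt) : IsSplit m v := by
  have h1 := D.crossAt_degree v hv
  have h2 := D.crossAt_loop v hv
  rw [hD, arcDegree_contractArcs hm] at h1
  rw [hD, mem_contractArcs_loop] at h2
  have h3 : m (plain v) ≠ plain v ∧ m (prime v) ≠ prime v := by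
    split_ifs at h1 <;> simp_all
  constructor
  · intro h
    rcases base_eq_iff.1 h with h | h
    · exact h3.1 h
    · exact h2 h
  · intro h
    rcases base_eq_iff.1 h with h | h
    · rw [← h, hm] at h2
      exact h2 rfl
    · exact h3.2 h

theorem exists_contract_eq (D : TangledDiagram n) :
    ∃ (m : HalfVertex n → HalfVertex n) (H : IsPairing m), contract m H.involutive = D := by
  classical
  obtain ⟨m, H, hD⟩ := exists_contractArcs_eq D.arcs D.arcs_le D.degree_le
  -- Flip where the crossing is wrong, but never at the right end of a double arc: there the flip at
  -- the left end already corrects the common crossing.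
  set S : Finset (Fin n) := Finset.univ.filter fun v => IsSplit m v ∧
    ¬ (v ∈ D.crossAt ↔ Crosses m (plain v) (prime v)) ∧
    ¬ (base (m (plain v)) = base (m (prime v)) ∧ base (m (plain v)) < v) with hS_def
  have hS : ∀ v ∈ S, IsSplit m v := fun v hv => (Finset.mem_filter.1 hv).2.1
  have hmemS (v : Fin n) : v ∈ S ↔ IsSplit m v ∧
    ¬ (v ∈ D.crossAt ↔ Crosses m (plain v) (prime v)) ∧
    ¬ (base (m (plain v)) = base (m (prime v)) ∧ base (m (plain v)) < v) := by simp [hS_def]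
  set m' := conjFlip S m with hm'
  have H' : IsPairing m' := H.conjFlip hS
  have hA : contractArcs m' = contractArcs m := contractArcs_conjFlip hS
  have hleft (v : Fin n) (hv : IsSplit m v)
      (hn : ¬ (base (m (plain v)) = base (m (prime v)) ∧ base (m (plain v)) < v)) :
      Crosses m' (plain v) (prime v) ↔ v ∈ D.crossAt := by
    have hvS := hmemS v
    simp only [hv, hn, true_and, not_false_eq_true, and_true] at hvS
    have huS : base (m (plain v)) = base (m (prime v)) → base (m (plain v)) ∉ S := by
      intro hne
      have hgt : v < base (m (plain v)) :=
        lt_of_le_of_ne (not_lt.1 fun h => hn ⟨hne, h⟩) hv.1.symm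
      set u := base (m (plain v)) with hu
      rw [hmemS]
      rintro ⟨-, -, h⟩
      refine h ?_
      have hc : (contractArcs m).count (v, u) = 2 := by
        rw [count_contractArcs_left hgt, if_pos rfl, if_pos hne.symm]
      rw [count_contractArcs_right H.involutive hgt] at hc
      have : base (m (plain u)) = v ∧ base (m (prime u)) = v := by
        split_ifs at hc <;> simp_all
      exact ⟨this.1.trans this.2.symm, by rw [this.1]; exact hgt⟩
    by_cases hvS' : v ∈ S
    · rw [hm', crosses_conjFlip_of_mem H.involutive hv hvS' huS]
      exact not_iff.1 fun h => hvS.1 hvS' h.symm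
    · rw [hm', crosses_conjFlip_of_notMem hv hvS' huS]
      exact (not_not.1 (mt hvS.2 hvS')).symm
  refine ⟨m', H', TangledDiagram.ext (hA.trans hD) ?_⟩
  ext v
  by_cases hv : IsSplit m v
  · by_cases hn : base (m (plain v)) = base (m (prime v)) ∧ base (m (plain v)) < v
    -- At the right end `v` of a double arc both diagrams agree with their left end `u`, where the
    -- crossing is already correct.
    · set u := base (m (plain v)) with hu
      have hc : (contractArcs m).count (u, v) = 2 := by
        rw [count_contractArcs_right H.involutive hn.2, if_pos rfl, if_pos hn.1.symm]
      have h1 := D.crossAt_parallel u v hn.2 (by rwa [← hD])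
      have h2 := (contract m' H'.involutive).crossAt_parallel u v hn.2
        (by rwa [contract_arcs, hA])
      rw [← h1, ← h2, mem_contract_crossAt]
      rw [count_contractArcs_left hn.2] at hc
      have h3 : base (m (plain u)) = v ∧ base (m (prime u)) = v := by
        split_ifs at hc <;> simp_all
      refine hleft u ⟨?_, ?_⟩ ?_
      · rw [h3.1]; exact hn.2.ne'
      · rw [h3.2]; exact hn.2.ne'
      · rw [h3.1]
        exact fun h => hn.2.not_gt h.2
    · rw [mem_contract_crossAt]
      exact hleft v hv hn
  · exact ⟨fun h => absurd (isSplit_of_mem_crossAt H.involutive (contract_arcs.trans hA) h) hv,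
      fun h => absurd (isSplit_of_mem_crossAt H.involutive hD.symm h) hv⟩

end Surjectivity

/-! ### Steps, half-steps and current vertices -/

section Times

variable {n : ℕ}

/-- The first half of the step at `j`. -/
def fstTime (j : Fin n) : Fin (2 * n) := ⟨2 * j, by omega⟩

/-- The second half of the step at `j`. -/
def sndTime (j : Fin n) : Fin (2 * n) := ⟨2 * j + 1, by omega⟩

theorem eq_fstTime_or_eq_sndTime (h : Fin (2 * n)) : ∃ j, h = fstTime j ∨ h = sndTime j := by
  refine ⟨⟨h / 2, by omega⟩, ?_⟩
  rcases Nat.mod_two_eq_zero_or_one h with h' | h'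
  · left
    ext
    simp only [fstTime]
    omega
  · right
    ext
    simp only [sndTime]
    omega

/-- The current vertex at a time, for given steps. -/
def vertexAt (s : Fin n → Move × Move) (h : Fin (2 * n)) : HalfVertex n :=
  if (h : ℕ) % 2 = 0 then plain ⟨h / 2, by omega⟩ else
    sndVertex ⟨h / 2, by omega⟩ (s ⟨h / 2, by omega⟩).1

/-- The move at a time, for given steps. -/
def moveAt (s : Fin n → Move × Move) (h : Fin (2 * n)) : Move :=
  if (h : ℕ) % 2 = 0 then (s ⟨h / 2, by omega⟩).1 else (s ⟨h / 2, by omega⟩).2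

variable {s : Fin n → Move × Move}

@[simp] theorem vertexAt_fstTime (j : Fin n) : vertexAt s (fstTime j) = plain j := by
  simp [vertexAt, fstTime]

@[simp] theorem moveAt_fstTime (j : Fin n) : moveAt s (fstTime j) = (s j).1 := by
  simp [moveAt, fstTime]

theorem half_sndTime (j : Fin n) : (⟨(sndTime j : Fin (2 * n)) / 2, by omega⟩ : Fin n) = j := by
  ext
  simp only [sndTime]
  omega

@[simp] theorem vertexAt_sndTime (j : Fin n) :
    vertexAt s (sndTime j) = sndVertex j (s j).1 := by
  rw [vertexAt, if_neg, half_sndTime]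
  simp only [sndTime]
  omega

@[simp] theorem moveAt_sndTime (j : Fin n) : moveAt s (sndTime j) = (s j).2 := by
  rw [moveAt, if_neg, half_sndTime]
  simp only [sndTime]
  omega

theorem base_sndVertex (j : Fin n) (a : Move) : base (sndVertex j a) = j := by
  cases a <;> rfl

theorem sndVertex_of_ne {j : Fin n} {a : Move} (h : a ≠ .stay) : sndVertex j a = prime j := by
  cases a
  · exact absurd rfl h
  · rfl
  · rfl

/-- Different steps use different vertices. Within one step the second half moves on to `j'` as soon
as the first half does something. -/
theorem increasingMoves_vertexAt : IncreasingMoves (vertexAt s) (moveAt s) := by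
  intro h h' hh ha ha'
  have hlt : ∀ {y z : HalfVertex n} {j j' : Fin n}, base y = j → base z = j' → j < j' → y < z := by
    rintro y z _ _ rfl rfl h
    exact lt_of_base_lt h
  obtain ⟨j, rfl | rfl⟩ := eq_fstTime_or_eq_sndTime h <;>
    obtain ⟨j', rfl | rfl⟩ := eq_fstTime_or_eq_sndTime h' <;>
    simp only [fstTime, sndTime, Fin.mk_lt_mk] at hh
  · simp only [vertexAt_fstTime]
    exact hlt (base_plain j) (base_plain j') (by omega)
  · rw [vertexAt_fstTime, vertexAt_sndTime]
    rcases (show j ≤ j' by omega).eq_or_lt with rfl | hj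
    · rw [moveAt_fstTime] at ha
      rw [sndVertex_of_ne ha]
      exact plain_lt_prime j
    · exact hlt rfl (base_sndVertex _ _) hj
  · rw [vertexAt_fstTime, vertexAt_sndTime]
    exact hlt (base_sndVertex _ _) (base_plain j') (by omega)
  · rw [vertexAt_sndTime, vertexAt_sndTime]
    exact hlt (base_sndVertex _ _) (base_sndVertex _ _) (by omega)

theorem exists_vertexAt_eq_prime {j : Fin n} :
    (∃ h, moveAt s h ≠ .stay ∧ vertexAt s h = prime j) ↔ (s j).1 ≠ .stay ∧ (s j).2 ≠ .stay := by
  constructor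
  · rintro ⟨h, h1, h2⟩
    obtain ⟨i, rfl | rfl⟩ := eq_fstTime_or_eq_sndTime h
    · simp at h2
    · rw [vertexAt_sndTime] at h2
      have hij : i = j := by
        have := congrArg base h2
        rwa [base_sndVertex, base_prime] at this
      subst hij
      rw [moveAt_sndTime] at h1
      refine ⟨fun h3 => ?_, h1⟩
      rw [h3] at h2
      simp [sndVertex] at h2
  · rintro ⟨h1, h2⟩
    exact ⟨sndTime j, by rwa [moveAt_sndTime], by rw [vertexAt_sndTime, sndVertex_of_ne h1]⟩

theorem exists_vertexAt_eq_plain {j : Fin n} :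
    (∃ h, moveAt s h ≠ .stay ∧ vertexAt s h = plain j) ↔ (s j).1 ≠ .stay ∨ (s j).2 ≠ .stay := by
  constructor
  · rintro ⟨h, h1, h2⟩
    obtain ⟨i, rfl | rfl⟩ := eq_fstTime_or_eq_sndTime h
    · rw [vertexAt_fstTime, plain_inj] at h2
      subst h2
      exact .inl (by simpa using h1)
    · rw [vertexAt_sndTime] at h2
      have hij : i = j := by
        have := congrArg base h2
        rwa [base_sndVertex, base_plain] at this
      subst hij
      exact .inr (by simpa using h1)
  · intro h
    by_cases h1 : (s j).1 = .stay
    · refine ⟨sndTime j, by simpa [h1] using h, ?_⟩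
      rw [vertexAt_sndTime, h1]
      rfl
    · exact ⟨fstTime j, by simpa using h1, by simp⟩

open Classical in
/-- The step at `j` in the construction of the partial matching `m`. -/
noncomputable def stepOf (m : HalfVertex n → HalfVertex n) (j : Fin n) : Move × Move :=
  if m (prime j) ≠ prime j then
    (if plain j < m (plain j) then .add else .remove,
      if prime j < m (prime j) then .add else .remove)
  else if plain j < m (plain j) then (.stay, .add)
  else if m (plain j) < plain j then (.remove, .stay) else (.stay, .stay)

variable {m : HalfVertex n → HalfVertex n}

theorem stepOf_mem (m : HalfVertex n → HalfVertex n) (j : Fin n) : stepOf m j ∈ elementarySteps := by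
  rw [stepOf]
  split_ifs <;> simp [elementarySteps]

theorem follows_stepOf (H : IsPairing m) : Follows (vertexAt (stepOf m)) (moveAt (stepOf m)) m := by
  have hlt (j : Fin n) (h : m (prime j) ≠ prime j) (h' : ¬ plain j < m (plain j)) :
      m (plain j) < plain j := lt_of_le_of_ne (not_lt.1 h') (H.plain_ne j h)
  have hlt' (j : Fin n) (h : m (prime j) ≠ prime j) (h' : ¬ prime j < m (prime j)) :
      m (prime j) < prime j := lt_of_le_of_ne (not_lt.1 h') h
  refine ⟨H.involutive, fun z => ?_, fun h ha => ?_, fun h ha => ?_⟩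
  · rcases eq_plain_or_eq_prime z with hz | hz <;> rw [hz]
    · rw [exists_vertexAt_eq_plain, stepOf]
      split_ifs with h1 h2 h3 h4 h5 h6
      · simpa using h2.ne'
      · simpa using h2.ne'
      · simpa using H.plain_ne _ h1
      · simpa using H.plain_ne _ h1
      · simpa using h5.ne'
      · simpa using h6.ne
      · simpa using le_antisymm (not_lt.1 h5) (not_lt.1 h6)
    · rw [exists_vertexAt_eq_prime, stepOf]
      split_ifs with h1 h2 h3 h4 h5 h6 <;> simp [h1]
  · obtain ⟨j, rfl | rfl⟩ := eq_fstTime_or_eq_sndTime h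
    · rw [moveAt_fstTime, stepOf] at ha
      rw [vertexAt_fstTime]
      split_ifs at ha with h1 h2 <;> assumption
    · rw [moveAt_sndTime, stepOf] at ha
      rw [vertexAt_sndTime, stepOf]
      split_ifs at ha ⊢ with h1 h2 h3 <;> assumption
  · obtain ⟨j, rfl | rfl⟩ := eq_fstTime_or_eq_sndTime h
    · rw [moveAt_fstTime, stepOf] at ha
      rw [vertexAt_fstTime]
      split_ifs at ha with h1 h2 h3 h4 h5
      all_goals first | assumption | exact hlt j h1 ‹_›
    · rw [moveAt_sndTime, stepOf] at ha
      rw [vertexAt_sndTime, stepOf]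
      split_ifs at ha ⊢ with h1 h2 h3 <;> exact hlt' j h1 ‹_›

/-- The matching fixes what happens at `j` and `j'`. When only `j` is matched, the half of the step
doing it is forced, since (add, stay) and (stay, remove) are not elementary. -/
theorem Follows.eq_stepOf (hs : ∀ j, s j ∈ elementarySteps)
    (F : Follows (vertexAt s) (moveAt s) m) : s = stepOf m := by
  ext1 j
  have h1 := F.ne_iff (prime j)
  rw [exists_vertexAt_eq_prime] at h1
  have h2 := F.ne_iff (plain j)
  rw [exists_vertexAt_eq_plain] at h2
  have h3 := F.add (fstTime j)
  have h4 := F.add (sndTime j)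
  have h5 := F.remove (fstTime j)
  have h6 := F.remove (sndTime j)
  rw [moveAt_fstTime, vertexAt_fstTime] at h3 h5
  rw [moveAt_sndTime, vertexAt_sndTime] at h4 h6
  have hj := hs j
  rw [stepOf]
  rcases e : s j with ⟨a, b⟩
  rw [e] at h1 h2 h3 h4 h5 h6 hj
  cases a <;> cases b <;> simp [elementarySteps] at hj <;>
    simp [sndVertex] at h1 h2 h3 h4 h5 h6 <;> simp [*, not_lt_of_gt]

end Times

/-! ### Vacillating tableaux -/

namespace VacillatingTableau

variable {n : ℕ} (V : VacillatingTableau n ⊥)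

/-- The steps of a vacillating tableau. -/
noncomputable def steps (j : Fin n) : Move × Move := (V.step j).choose

theorem steps_mem (j : Fin n) : V.steps j ∈ elementarySteps := (V.step j).choose_spec.1

/-- Consecutive shapes determine the move between them, by comparing the numbers of squares. -/
theorem stepAt_iff {j : Fin n} {s : Move × Move} : V.StepAt j s ↔ s = V.steps j := by
  have h : V.StepAt j (V.steps j) := (V.step j).choose_spec.2
  constructor
  · intro h'
    exact Prod.ext (Move.rel_inj h'.1 h.1) (Move.rel_inj h'.2 h.2)
  · rintro rfl
    exact h

theorem models_iff {S : Set (Move × Move)} : V.Models S ↔ ∀ j, V.steps j ∈ S := by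
  refine forall_congr' fun j => ⟨?_, fun h => ⟨_, h, V.stepAt_iff.2 rfl⟩⟩
  rintro ⟨s, h1, h2⟩
  rwa [← V.stepAt_iff.1 h2]

/-- The shapes, indexed by natural numbers. -/
def shapeAt (h : ℕ) : YoungDiagram := V.shape (Fin.ofNat (2 * n + 1) h)

theorem ofNat_eq {n h : ℕ} (hh : h < 2 * n + 1) : Fin.ofNat (2 * n + 1) h = ⟨h, hh⟩ :=
  Fin.ext (Nat.mod_eq_of_lt hh)

theorem shapeAt_eq {h : ℕ} (hh : h < 2 * n + 1) : V.shapeAt h = V.shape ⟨h, hh⟩ := by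
  rw [shapeAt, ofNat_eq hh]

theorem shapeAt_zero : V.shapeAt 0 = ⊥ := (V.shapeAt_eq (Nat.succ_pos _)).trans V.shape_zero

theorem shapeAt_last : V.shapeAt (2 * n) = ⊥ :=
  (V.shapeAt_eq (Nat.lt_succ_self _)).trans V.shape_last

theorem rel_shapeAt (h : Fin (2 * n)) :
    (moveAt V.steps h).Rel (V.shapeAt h) (V.shapeAt (h + 1)) := by
  obtain ⟨j, rfl | rfl⟩ := eq_fstTime_or_eq_sndTime h
  · rw [moveAt_fstTime, V.shapeAt_eq (by omega), V.shapeAt_eq (by omega)]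
    exact (V.stepAt_iff.2 rfl).1
  · rw [moveAt_sndTime, V.shapeAt_eq (by omega), V.shapeAt_eq (by omega)]
    exact (V.stepAt_iff.2 rfl).2

theorem isPhi_iff {H : HalfGraph n} : V.IsPhi H ↔
    (∃ P T, IsRun (vertexAt V.steps) (moveAt V.steps) P T ∧
      (∀ h ≤ 2 * n, (T h).shape = V.shapeAt h) ∧ H.arcs = P (2 * n)) ∧
    H.verts = {v | ∃ j, v = plain j ∨
      (v = prime j ∧ (V.steps j).1 ≠ .stay ∧ (V.steps j).2 ≠ .stay)} := by
  refine and_congr ⟨?_, ?_⟩ ?_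
  · rintro ⟨P, T, h1, h2, h3, h4⟩
    refine ⟨fun h => P (Fin.ofNat (2 * n + 1) h), fun h => T (Fin.ofNat (2 * n + 1) h),
      ⟨?_, ?_, fun h => ?_, fun h => ?_⟩, fun h hh => ?_, ?_⟩
    · exact h1
    · exact Tableau.shape_eq_bot_iff.1 ((h2 _).trans V.shape_zero)
    · obtain ⟨j, rfl | rfl⟩ := eq_fstTime_or_eq_sndTime h
      · rw [ofNat_eq (by omega), ofNat_eq (by omega), moveAt_fstTime, vertexAt_fstTime]
        exact (h3 j _ (V.stepAt_iff.2 rfl)).1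
      · rw [ofNat_eq (by omega), ofNat_eq (by omega), moveAt_sndTime, vertexAt_sndTime]
        exact (h3 j _ (V.stepAt_iff.2 rfl)).2
    · simp only [h2]
      exact V.rel_shapeAt h
    · exact h2 _
    · rw [h4]
      simp only
      rw [ofNat_eq (by omega)]
      rfl
  · rintro ⟨P, T, h1, h2, h3⟩
    refine ⟨fun h => P h, fun h => T h, h1.arcs_zero, fun h => ?_, fun j s hs => ?_, h3⟩
    · rw [h2 _ (by omega), V.shapeAt_eq h.2]
    · rw [V.stepAt_iff] at hs
      subst hs
      have h4 := h1.act (fstTime j)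
      have h5 := h1.act (sndTime j)
      rw [moveAt_fstTime, vertexAt_fstTime] at h4
      rw [moveAt_sndTime, vertexAt_sndTime] at h5
      exact ⟨h4, h5⟩
  · suffices e : {v | ∃ j, v = plain j ∨
        (v = prime j ∧ ∃ a b : Move, a ≠ .stay ∧ b ≠ .stay ∧ V.StepAt j (a, b))} =
        {v | ∃ j, v = plain j ∨
          (v = prime j ∧ (V.steps j).1 ≠ .stay ∧ (V.steps j).2 ≠ .stay)} by
      rw [e]
    ext v
    refine exists_congr fun j => or_congr_right (and_congr_right fun _ => ?_)
    simp only [V.stepAt_iff]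
    constructor
    · rintro ⟨a, b, h1, h2, h3⟩
      rw [← h3]
      exact ⟨h1, h2⟩
    · rintro ⟨h1, h2⟩
      exact ⟨_, _, h1, h2, rfl⟩

theorem IsPhi.unique {H H' : HalfGraph n} (h : V.IsPhi H) (h' : V.IsPhi H') : H = H' := by
  obtain ⟨⟨P, T, h1, h2, h3⟩, h4⟩ := V.isPhi_iff.1 h
  obtain ⟨⟨P', T', h1', h2', h3'⟩, h4'⟩ := V.isPhi_iff.1 h'
  refine HalfGraph.ext (h4.trans h4'.symm) ?_
  rw [h3, h3']
  exact (h1.unique h1' (fun h hh => (h2 h hh).trans (h2' h hh).symm) _ le_rfl).1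

/-- The arcs alone determine an involution, hence its steps and the set of vertices; what remains is
a run of `V` ending in the arcs of `m`. -/
theorem isPhi_halfGraphOf_iff {m : HalfVertex n → HalfVertex n} (hm : Function.Involutive m) :
    V.IsPhi (halfGraphOf m) ↔ V.steps = stepOf m ∧ IsPairing m ∧
      ∃ P T, IsRun (vertexAt V.steps) (moveAt V.steps) P T ∧
        (∀ h ≤ 2 * n, (T h).shape = V.shapeAt h) ∧ P (2 * n) = arcsOf m := by
  rw [V.isPhi_iff]
  constructor
  · rintro ⟨⟨P, T, h1, h2, h3⟩, h4⟩
    obtain ⟨m', F, h5⟩ := h1.exists_follows increasingMoves_vertexAt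
      (Tableau.shape_eq_bot_iff.1 ((h2 _ le_rfl).trans V.shapeAt_last))
    obtain rfl : m = m' := eq_of_arcsOf_eq hm F.involutive (h3.trans h5)
    refine ⟨F.eq_stepOf V.steps_mem, ⟨hm, fun j hj => ?_⟩, P, T, h1, h2, h5⟩
    rw [F.ne_iff, exists_vertexAt_eq_prime] at hj
    rw [F.ne_iff, exists_vertexAt_eq_plain]
    exact .inl hj.1
  · rintro ⟨h0, H, P, T, h1, h2, h3⟩
    refine ⟨⟨P, T, h1, h2, h3.symm⟩, ?_⟩
    ext v
    refine exists_congr fun j => or_congr_right (and_congr_right fun _ => ?_)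
    rw [(follows_stepOf H).ne_iff, exists_vertexAt_eq_prime, h0]

theorem exists_isPhi : ∃ m, IsPairing m ∧ V.IsPhi (halfGraphOf m) := by
  obtain ⟨P, T, h1, h2⟩ := exists_isRun increasingMoves_vertexAt V.shapeAt V.shapeAt_zero
    V.rel_shapeAt
  obtain ⟨m, F, h3⟩ := h1.exists_follows increasingMoves_vertexAt
    (Tableau.shape_eq_bot_iff.1 ((h2 _ le_rfl).trans V.shapeAt_last))
  have H : IsPairing m := by
    refine ⟨F.involutive, fun j hj => ?_⟩
    rw [F.ne_iff, exists_vertexAt_eq_prime] at hj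
    rw [F.ne_iff, exists_vertexAt_eq_plain]
    exact .inl hj.1
  exact ⟨m, H, (V.isPhi_halfGraphOf_iff F.involutive).2
    ⟨F.eq_stepOf V.steps_mem, H, P, T, h1, h2, h3⟩⟩

theorem exists_of_isPairing {m : HalfVertex n → HalfVertex n} (H : IsPairing m) :
    ∃ V : VacillatingTableau n ⊥, V.IsPhi (halfGraphOf m) := by
  obtain ⟨P, T, h1, h2, h3⟩ := (follows_stepOf H).exists_isRun increasingMoves_vertexAt
  let V : VacillatingTableau n ⊥ :=
    { shape := fun h => (T h).shape
      shape_zero := Tableau.shape_eq_bot_iff.2 h1.rows_zero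
      shape_last := Tableau.shape_eq_bot_iff.2 h2
      step := fun j => by
        have h4 := h1.rel (fstTime j)
        have h5 := h1.rel (sndTime j)
        rw [moveAt_fstTime] at h4
        rw [moveAt_sndTime] at h5
        exact ⟨stepOf m j, stepOf_mem m j, h4, h5⟩ }
  have hs : V.steps = stepOf m := by
    ext1 j
    symm
    rw [← V.stepAt_iff]
    have h4 := h1.rel (fstTime j)
    have h5 := h1.rel (sndTime j)
    rw [moveAt_fstTime] at h4
    rw [moveAt_sndTime] at h5
    exact ⟨h4, h5⟩
  refine ⟨V, (V.isPhi_halfGraphOf_iff H.involutive).2 ⟨hs, H, P, T, by rwa [hs], fun h hh => ?_, h3⟩⟩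
  rw [V.shapeAt_eq (by omega)]

theorem eq_of_isPhi {V V' : VacillatingTableau n ⊥} {m : HalfVertex n → HalfVertex n}
    (hm : Function.Involutive m) (h : V.IsPhi (halfGraphOf m)) (h' : V'.IsPhi (halfGraphOf m)) :
    V = V' := by
  obtain ⟨h1, -, P, T, h2, h3, h4⟩ := (V.isPhi_halfGraphOf_iff hm).1 h
  obtain ⟨h1', -, P', T', h2', h3', h4'⟩ := (V'.isPhi_halfGraphOf_iff hm).1 h'
  rw [h1] at h2
  rw [h1'] at h2'
  ext1
  ext1 h
  have hh : (h : ℕ) ≤ 2 * n := by omega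
  have := h2.backward_unique increasingMoves_vertexAt hm h2' h4 h4'
    (Tableau.shape_eq_bot_iff.1 ((h3 _ le_rfl).trans V.shapeAt_last))
    (Tableau.shape_eq_bot_iff.1 ((h3' _ le_rfl).trans V'.shapeAt_last)) hh
  have e := (h3 _ hh).symm.trans ((congrArg Tableau.shape this).trans (h3' _ hh))
  rwa [V.shapeAt_eq h.2, V'.shapeAt_eq h.2] at e

theorem rowsLT_iff {m : HalfVertex n → HalfVertex n} (hm : Function.Involutive m)
    (h : V.IsPhi (halfGraphOf m)) {k : ℕ} : V.RowsLT k ↔ ¬ HasCrossing m k := by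
  obtain ⟨h1, H, P, T, h2, h3, h4⟩ := (V.isPhi_halfGraphOf_iff hm).1 h
  have F := follows_stepOf H
  rw [← h1] at F
  rw [h2.hasCrossing_iff increasingMoves_vertexAt F h4
    (Tableau.shape_eq_bot_iff.1 ((h3 _ le_rfl).trans V.shapeAt_last))]
  push Not
  constructor
  · intro h h' hh
    rw [← Tableau.length_rowLens_shape, h3 _ hh, V.shapeAt_eq (by omega)]
    exact h _
  · intro h h'
    rw [← V.shapeAt_eq h'.2, ← h3 _ (by omega), Tableau.length_rowLens_shape]
    exact h _ (by omega)

end VacillatingTableau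

/-! ### Matchings, partitions and braids -/

section Types

variable {n : ℕ} {m : HalfVertex n → HalfVertex n}

theorem isMatching_contract_iff (H : IsPairing m) : (contract m H.involutive).IsMatching ↔
    ∀ j, stepOf m j ∈ ({(.remove, .stay), (.stay, .add)} : Set (Move × Move)) := by
  refine forall_congr' fun j => ?_
  rw [TangledDiagram.degree, contract_arcs, arcDegree_contractArcs H.involutive, stepOf]
  by_cases h : m (prime j) = prime j
  · rcases lt_trichotomy (plain j) (m (plain j)) with h1 | h1 | h1
    · simp [h, h1, h1.ne']
    · simp [h, ← h1]
    · simp [h, h1, h1.ne, h1.not_gt]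
  · have := H.plain_ne j h
    simp [h, this]
    split_ifs <;> simp

theorem isPartition_contract_iff (H : IsPairing m) : (contract m H.involutive).IsPartition ↔
    ∀ j, stepOf m j ∈ ({(.remove, .stay), (.stay, .add), (.stay, .stay), (.remove, .add)} :
      Set (Move × Move)) := by
  refine forall_congr' fun j => ?_
  rw [degree_contract_eq_two_iff, mem_contract_crossAt, stepOf, contract_arcs]
  by_cases h : m (prime j) = prime j
  · simp only [h, ne_eq, not_true_eq_false, and_false, false_imp_iff, if_false, true_iff]
    split_ifs <;> simp
  have h' := H.plain_ne j h
  simp only [h, h', ne_eq, not_false_eq_true, and_self, true_imp_iff, if_true]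
  constructor
  · rintro ⟨h1, i, s, h2, h3, h4, h5⟩
    rw [mem_contractArcs_right H.involutive h2] at h4
    rw [mem_contractArcs_left h3] at h5
    rcases h4 with h4 | h4 <;> rcases h5 with h5 | h5
    -- One half-vertex cannot be joined both to the left and to the right of `j`.
    · omega
    · have h6 : m (plain j) < plain j := lt_of_base_lt (by rwa [h4])
      have h7 : prime j < m (prime j) := lt_of_base_lt (by rwa [h5])
      simp [h6.not_gt, h7]
    -- If `j` opened and `j'` closed, the two arcs would cross at the vertex.
    · refine absurd ?_ h1
      rw [crosses_plain_prime_iff (by rw [h5]; exact h3.ne') (by rw [h4]; exact h2.ne)]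
      exact .inr ⟨by rwa [h4], by rwa [h5]⟩
    · omega
  · intro h1
    have h2 : ¬ plain j < m (plain j) ∧ prime j < m (prime j) := by
      split_ifs at h1 with h2 h3 h4 <;> simp at h1
      exact ⟨h2, h4⟩
    have h3 : m (plain j) < plain j := lt_of_le_of_ne (not_lt.1 h2.1) h'
    have h4 : base (m (plain j)) < j := by
      refine lt_of_le_of_ne (base_le_of_lt h3) fun e => ?_
      have := (eq_of_lt_of_base_eq h3 e).2
      simp at this
    have h5 : j < base (m (prime j)) := by
      refine lt_of_le_of_ne (base_le_of_lt h2.2) fun e => ?_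
      have := (eq_of_lt_of_base_eq h2.2 e).1
      simp at this
    refine ⟨?_, _, _, h4, h5, (mem_contractArcs_right H.involutive h4).2 (.inl rfl),
      (mem_contractArcs_left h5).2 (.inr rfl)⟩
    rw [crosses_plain_prime_iff h4.ne h5.ne']
    rintro (⟨-, h6⟩ | ⟨h6, -⟩)
    · exact h5.not_gt (h6.1 h4)
    · exact h5.not_gt h6

theorem isBraid_contract_iff (H : IsPairing m) : (contract m H.involutive).IsBraid ↔
    ∀ j, stepOf m j ∈ ({(.remove, .stay), (.stay, .add), (.stay, .stay), (.add, .remove)} :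
      Set (Move × Move)) := by
  refine forall_congr' fun j => ?_
  rw [degree_contract_eq_two_iff, mem_contract_crossAt, stepOf, contract_arcs,
    mem_contractArcs_loop]
  by_cases h : m (prime j) = prime j
  · simp only [h, ne_eq, not_true_eq_false, and_false, false_imp_iff, if_false, true_iff]
    split_ifs <;> simp
  have h' := H.plain_ne j h
  simp only [h, h', ne_eq, not_false_eq_true, and_self, true_imp_iff, if_true]
  constructor
  · rintro (h1 | ⟨h1, i, s, h2, h3, h4, h5⟩)
    · have h2 : m (prime j) = plain j := by rw [← h1, H.involutive]
      rw [h1, h2]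
      simp [(plain_lt_prime j).not_gt]
    rw [mem_contractArcs_right H.involutive h2] at h4
    rw [mem_contractArcs_left h3] at h5
    rcases h4 with h4 | h4 <;> rcases h5 with h5 | h5
    · omega
    · rw [crosses_plain_prime_iff (by rw [h4]; exact h2.ne) (by rw [h5]; exact h3.ne'), h4, h5]
        at h1
      rcases h1 with ⟨-, h6⟩ | ⟨h6, -⟩
      · exact absurd (h6.1 h2) h3.not_gt
      · exact absurd h6 h3.not_gt
    · have h6 : plain j < m (plain j) := lt_of_base_lt (by rwa [h5])
      have h7 : m (prime j) < prime j := lt_of_base_lt (by rwa [h4])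
      simp [h6, h7.not_gt]
    · omega
  · intro h1
    have h2 : plain j < m (plain j) ∧ ¬ prime j < m (prime j) := by
      split_ifs at h1 with h2 h3 h4 <;> simp at h1
      exact ⟨h2, h3⟩
    have h3 : m (prime j) < prime j := lt_of_le_of_ne (not_lt.1 h2.2) h
    -- The step (add, remove) covers both kinds of braid vertices: a loop closes the arc just
    -- opened, otherwise the two arcs cross.
    by_cases hl : m (plain j) = prime j
    · exact .inl hl
    have h4 : base (m (prime j)) < j := by
      refine lt_of_le_of_ne (base_le_of_lt h3) fun e => hl ?_
      have := (eq_of_lt_of_base_eq h3 e).1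
      rw [base_prime] at this
      rw [← this, H.involutive]
    have h5 : j < base (m (plain j)) := by
      refine lt_of_le_of_ne (base_le_of_lt h2.1) fun e => hl ?_
      have := (eq_of_lt_of_base_eq h2.1 e).2
      rwa [← e] at this
    refine .inr ⟨?_, _, _, h4, h5, (mem_contractArcs_right H.involutive h4).2 (.inr rfl),
      (mem_contractArcs_left h5).2 (.inl rfl)⟩
    rw [crosses_plain_prime_iff h5.ne' h4.ne]
    exact .inr ⟨h4, h5⟩

end Types

/-! ### The theorem, by composing the two correspondences -/

theorem corollary1 (n : ℕ) :
    Function.Injective (TangledDiagram.inflation : TangledDiagram n → HalfGraph n) ∧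
    ∃ β : VacillatingTableau n ⊥ ≃ TangledDiagram n,
      (∀ (V : VacillatingTableau n ⊥) (H : HalfGraph n), V.IsPhi H ↔ H = (β V).inflation) ∧
      ∀ k : ℕ,
        Set.BijOn β
          {V | V.Models {(.remove, .stay), (.stay, .add)} ∧ V.RowsLT k}
          {D | D.IsMatching ∧ D.Noncrossing k} ∧
        Set.BijOn β
          {V | V.Models {(.remove, .stay), (.stay, .add), (.stay, .stay), (.remove, .add)} ∧
            V.RowsLT k}
          {D | D.IsPartition ∧ D.Noncrossing k} ∧
        Set.BijOn β
          {V | V.Models {(.remove, .stay), (.stay, .add), (.stay, .stay), (.add, .remove)} ∧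
            V.RowsLT k}
          {D | D.IsBraid ∧ D.Noncrossing k} := by
  have hinj {m m' : HalfVertex n → HalfVertex n} (H : IsPairing m) (H' : IsPairing m')
      (h : halfGraphOf m = halfGraphOf m') : m = m' :=
    eq_of_arcsOf_eq H.involutive H'.involutive (congrArg HalfGraph.arcs h)
  refine ⟨fun D D' h => ?_, ?_⟩
  · obtain ⟨m, H, rfl⟩ := exists_contract_eq D
    obtain ⟨m', H', rfl⟩ := exists_contract_eq D'
    rw [inflation_contract H, inflation_contract H'] at h
    obtain rfl := hinj H H' h
    rfl
  -- β sends `V` to the contraction of the unique pairing whose graph is φ(V).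
  choose m H hphi using fun V : VacillatingTableau n ⊥ => V.exists_isPhi
  let f (V : VacillatingTableau n ⊥) : TangledDiagram n := contract (m V) (H V).involutive
  have hf : Function.Bijective f := by
    constructor
    · intro V V' h
      have h' := congrArg TangledDiagram.inflation h
      rw [inflation_contract (H V), inflation_contract (H V')] at h'
      have h1 := hphi V'
      rw [← h'] at h1
      exact VacillatingTableau.eq_of_isPhi (H V).involutive (hphi V) h1
    · intro D
      obtain ⟨m', H', rfl⟩ := exists_contract_eq D
      obtain ⟨V, hV⟩ := VacillatingTableau.exists_of_isPairing H'
      obtain rfl := hinj H' (H V) (VacillatingTableau.IsPhi.unique V hV (hphi V))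
      exact ⟨V, rfl⟩
  refine ⟨Equiv.ofBijective f hf, fun V G => ?_, fun k => ?_⟩
  · change V.IsPhi G ↔ G = (contract (m V) (H V).involutive).inflation
    rw [inflation_contract (H V)]
    exact ⟨fun h => VacillatingTableau.IsPhi.unique V h (hphi V), fun h => h ▸ hphi V⟩
  · have hs (V : VacillatingTableau n ⊥) : V.steps = stepOf (m V) :=
      ((V.isPhi_halfGraphOf_iff (H V).involutive).1 (hphi V)).1
    have hk (V : VacillatingTableau n ⊥) : (f V).Noncrossing k ↔ V.RowsLT k :=
      (noncrossing_contract_iff _).trans (V.rowsLT_iff (H V).involutive (hphi V)).symm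
    refine ⟨Equiv.bijOn _ fun V => and_congr ?_ (hk V), Equiv.bijOn _ fun V => and_congr ?_ (hk V),
      Equiv.bijOn _ fun V => and_congr ?_ (hk V)⟩
    · rw [V.models_iff, hs]
      exact isMatching_contract_iff (H V)
    · rw [V.models_iff, hs]
      exact isPartition_contract_iff (H V)
    · rw [V.models_iff, hs]
      exact isBraid_contract_iff (H V)
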